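/- Let $K$ be an algebraically closed field of arbitrary characteristic and let $k\subseteq K$ be a subfield. For pairwise distinct points $p_1,\dots,p_{10}\in\mathbb P^2(K)$ let $X$ be the blow-up of $\mathbb P^2_K$ at these points, with exceptional divisors $E_1,\dots,E_{10}$, and let $H$ be the pullback to $X$ of a line. A divisor $D$ on $X$ is called semi-effective if $h^0(X,\mathcal O_X(nD))>0$ for some integer $n>0$. The points $p_1,\dots,p_{10}$ are called generic over $k$ if $(p_1,\dots,p_{10})$ lies in no proper closed subset of $(\mathbb P^2)^{10}$ defined over $k$, i.e. if no nonzero polynomial over $k$ that is homogeneous in each of ten groups of three variables vanishes at $(p_1,\dots,p_{10})$. (a) If $p_1,\dots,p_{10}$ are generic over $k$, then the divisor $D=13H-5E_1-4E_2-\cdots-4E_{10}$ on $X$ is not semi-effective. (b) Equivalently, if $p_1,\dots,p_{10}$ are generic over $k$, then for every integer $n\ge 1$ there is no nonzero form of degree $13n$ in three variables over $K$ that vanishes at $p_1$ to order at least $5n$ and at each of $p_2,\dots,p_{10}$ to order at least $4n$. (c) More precisely, for every integer $n\ge 1$ there is a nonempty open subset $U_n\subseteq(\mathbb P^2)^{10}$,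 the non-vanishing locus of a nonzero multihomogeneous polynomial over $k$, such that for all pairwise distinct points with $(p_1,\dots,p_{10})\in U_n(K)$ one has $H^0(X,\mathcal O_X(nD))=0$, and there is no nonzero form as in (b). -/

import Mathlib

open MvPolynomial

namespace BlowUpPlane

universe u v

/-- The projective plane over `K`, by its closed points. -/
abbrev Plane (K : Type v) [Field K] : Type v := Projectivization K (Fin 3 → K)

/-- A polynomial in `r` groups of three variables is multihomogeneous of multidegree `e` if it is
homogeneous of degree `e i` in the `i`-th group. Such polynomials define the closed subsets of
`(ℙ²)^r`. -/
def IsMultihomogeneous {k : Type u} [Field k] {r : ℕ}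
    (G : MvPolynomial (Fin r × Fin 3) k) (e : Fin r → ℕ) : Prop :=
  IsWeightedHomogeneous (fun ij : Fin r × Fin 3 => (Pi.single ij.1 1 : Fin r → ℕ)) G e

section

variable {K : Type v} [Field K] {r : ℕ}

/-- The value of a polynomial in `r` groups of three variables at representatives of the points
`p i`. For a multihomogeneous polynomial, whether it vanishes does not depend on the
representatives. -/
noncomputable def multiEval {k : Type u} [Field k] [Algebra k K]
    (p : Fin r → Plane K) (G : MvPolynomial (Fin r × Fin 3) k) : K :=
  aeval (fun ij : Fin r × Fin 3 => (p ij.1).rep ij.2) G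

/-- The points `p 0, …, p (r - 1)` of `ℙ²(K)` are generic over the subfield `k`: the point
`(p i)` of `(ℙ²)^r` lies in no proper closed subset of `(ℙ²)^r` that is defined over `k`. -/
def IsGeneric (k : Type u) [Field k] [Algebra k K] (p : Fin r → Plane K) : Prop :=
  ∀ (e : Fin r → ℕ) (G : MvPolynomial (Fin r × Fin 3) k),
    IsMultihomogeneous G e → G ≠ 0 → multiEval p G ≠ 0

/-- The coordinates on the ambient affine space of the multicone over the blow-up: `Sum.inl j` are
the homogeneous coordinates `x j` of a point of the plane, and `Sum.inr (i, j)` are the homogeneous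
coordinates `ℓ i j` of the `i`-th line. -/
abbrev Coord (r : ℕ) : Type := Fin 3 ⊕ (Fin r × Fin 3)

/-- The multicone over the blow-up `X` of `ℙ²` at the (distinct) points `p i`. The blow-up of `ℙ²`
at one point `p` is the incidence variety of pairs `(x, ℓ)` of a point `x` and a line `ℓ` through
`p` and `x`; the blow-up at several distinct points is the fibre product over `ℙ²`:
`X = {(x, ℓ₁, …, ℓᵣ) | p i ∈ ℓ i, x ∈ ℓ i} ⊆ ℙ² × (ℙ²*)^r`.
The elements of the multicone are the tuples of nonzero coordinate vectors of points of `X`. -/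
def cone (p : Fin r → Plane K) : Set (Coord r → K) :=
  {z | (∃ j, z (Sum.inl j) ≠ 0) ∧
    ∀ i, (∃ j, z (Sum.inr (i, j)) ≠ 0) ∧
      (∑ j, z (Sum.inr (i, j)) * (p i).rep j = 0) ∧
      (∑ j, z (Sum.inr (i, j)) * z (Sum.inl j) = 0)}

/-- The (multicone over the) exceptional divisor `E i`: the points of `X` that lie over `p i`. -/
def exceptional (p : Fin r → Plane K) (i : Fin r) : Set (Coord r → K) :=
  {z | z ∈ cone p ∧ (fun j => z (Sum.inl j)) ∈ (p i).submodule}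

/-- The homogeneous ideal of the subscheme `m₁ E₁ + ⋯ + mᵣ Eᵣ`: the product of the powers of the
ideals of the exceptional divisors. -/
noncomputable def exceptionalIdeal (p : Fin r → Plane K) (m : Fin r → ℕ) :
    Ideal (MvPolynomial (Coord r) K) :=
  ∏ i, (vanishingIdeal K (exceptional p i)) ^ m i

/-- `H⁰(X, 𝒪_X(d H - m₁ E₁ - ⋯ - mᵣ Eᵣ))`, where `𝒪_X(dH)` is the pullback of `𝒪(d)` from `ℙ²` and
`𝒪_X(-E i)` is the ideal sheaf of `E i`. A section is a function `s` on the multicone which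

* is homogeneous of degree `d` in `x` and of degree `0` in every `ℓ i`, and
* is, in a neighbourhood of every point `q`, a quotient `A / B` of polynomials with `B q ≠ 0` and
  with `A` in the ideal of `m₁ E₁ + ⋯ + mᵣ Eᵣ`.

(The equation `s * B = A` may be required on the whole multicone: if it holds on the open set
where a polynomial `h` is nonzero, replace `A, B` by `h * A, h * B`.) -/
def H0 (p : Fin r → Plane K) (d : ℕ) (m : Fin r → ℕ) : Submodule K (cone p → K) where
  carrier := {s |
    (∀ (z w : cone p) (a : K) (b : Fin r → K),
      (∀ j, w.1 (Sum.inl j) = a * z.1 (Sum.inl j)) →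
      (∀ i j, w.1 (Sum.inr (i, j)) = b i * z.1 (Sum.inr (i, j))) →
      s w = a ^ d * s z) ∧
    (∀ q : cone p, ∃ A B : MvPolynomial (Coord r) K,
      A ∈ exceptionalIdeal p m ∧ eval q.1 B ≠ 0 ∧
        ∀ z : cone p, s z * eval z.1 B = eval z.1 A)}
  add_mem' := by
    rintro s t ⟨hs, hs'⟩ ⟨ht, ht'⟩
    refine ⟨fun z w a b h1 h2 => ?_, fun q => ?_⟩
    · simp only [Pi.add_apply, hs z w a b h1 h2, ht z w a b h1 h2]
      ring
    · obtain ⟨A, B, hA, hB, h⟩ := hs' q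
      obtain ⟨A', B', hA', hB', h'⟩ := ht' q
      refine ⟨B' * A + B * A', B * B',
        Ideal.add_mem _ (Ideal.mul_mem_left _ _ hA) (Ideal.mul_mem_left _ _ hA'), ?_, fun z => ?_⟩
      · simpa using ⟨hB, hB'⟩
      · simp only [Pi.add_apply, map_add, map_mul, ← h z, ← h' z]
        ring
  zero_mem' := by
    refine ⟨fun z w a b h1 h2 => by simp, fun q => ⟨0, 1, Ideal.zero_mem _, by simp, by simp⟩⟩
  smul_mem' := by
    rintro c s ⟨hs, hs'⟩
    refine ⟨fun z w a b h1 h2 => ?_, fun q => ?_⟩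
    · simp only [Pi.smul_apply, smul_eq_mul, hs z w a b h1 h2]
      ring
    · obtain ⟨A, B, hA, hB, h⟩ := hs' q
      refine ⟨C c * A, B, Ideal.mul_mem_left _ _ hA, hB, fun z => ?_⟩
      simp only [Pi.smul_apply, smul_eq_mul, map_mul, eval_C, ← h z]
      ring

/-- The divisor `D = d H - m₁ E₁ - ⋯ - mᵣ Eᵣ` on the blow-up of `ℙ²` at the points `p i` is
semi-effective: `h⁰(nD) > 0` for some `n > 0`. -/
def IsSemiEffective (p : Fin r → Plane K) (d : ℕ) (m : Fin r → ℕ) : Prop :=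
  ∃ n : ℕ, 0 < n ∧ H0 p (n * d) (fun i => n * m i) ≠ ⊥

/-- The form `F` vanishes at `x ∈ ℙ²` to order at least `m`: the Taylor expansion of `F` at a
representative of `x` has no terms of degree less than `m`. For a form `F ≠ 0` this says that the
curve `F = 0` has multiplicity at least `m` at `x`. -/
def VanishesToOrder (F : MvPolynomial (Fin 3) K) (x : Plane K) (m : ℕ) : Prop :=
  ∀ α : Fin 3 →₀ ℕ, α.degree < m →
    coeff α (aeval (fun j => X j + C (x.rep j) : Fin 3 → MvPolynomial (Fin 3) K) F) = 0

/-- There is a plane curve of degree `d` with multiplicity at least `m i` at the point `p i` for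
all `i` (possibly reducible or non-reduced). -/
def ExistsCurve (p : Fin r → Plane K) (d : ℕ) (m : Fin r → ℕ) : Prop :=
  ∃ F : MvPolynomial (Fin 3) K, F ≠ 0 ∧ F.IsHomogeneous d ∧ ∀ i, VanishesToOrder F (p i) (m i)

end

/-- The multiplicities `(5, 4, 4, 4, 4, 4, 4, 4, 4, 4)`. -/
def mult : Fin 10 → ℕ := fun i => if i = 0 then 5 else 4

end BlowUpPlane

/-! ### Zeros of regular functions and the group law on a Weierstrass curve -/

namespace WeierstrassCurve.Affine.CoordinateRing

open Polynomial

variable {F : Type*} [Field F] {W : WeierstrassCurve.Affine F}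

/-! Since 13² = 5² + 9·4², the divisor has self-intersection 0, so an argument finer than a
dimension count is needed. Absence of a form of degree 13n with the prescribed multiplicities means
that some maximal minor of the matrix of Taylor conditions is nonzero. Hence for each n one
configuration over one extension field of k suffices (`exists_isMultihomogeneous`). The
configuration used consists of points p_i(t) over F(t), linear in t, which for t = 0 lie on a plane
cubic Γ with equation c.

Let G be a form over F[t] with these multiplicities along p_i(t). The main claim is that G lies in
(t, c)^(4n+1) (`exists_expansion`). If G lies in (t, c)^m with m ≤ 4n, its leading part is a binary
form in t and c with coefficients on Γ, and it vanishes to high order at the velocities of the p_i.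
The cubic Γ is the quotient of an elliptic curve E by a point P₀ of order two. On E there are
functions ρ₁, ρ₂, exchanged by translation by P₀ after division by x⁶, and both give the velocities
at the twenty preimages of the points. Substituting (t : c) = (1 + z : ρ₁ + ρ₂ z) turns the leading
part into a polynomial in z over the functions on E. Its coefficient at z^l has at most 91n + m - l
poles, all at infinity, at least 13n - l zeros at P₀, and 2·41·n = 82n zeros at the preimages. For m
≤ 4n a nonzero coefficient can have no other zeros, and the group law of E then gives a linear
relation. Because the preimages add up to 0, the relation implies 4n·P = 0 for a preimage P of p_0.
If 4n·P ≠ 0, the leading part therefore vanishes (`leading_eq_zero`), its coefficients are divisible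
by c modulo t, and m increases.

Now G modulo t is divisible by c^(4n+1). A general line through p_0 leaves at most 13n - 5n = 8n
intersections outside p_0, but c^(4n+1) requires 8n + 2. So G is divisible by t
(`map_eval_eq_zero`), and repeated division gives G = 0.

A configuration with 4n·P ≠ 0 exists over an algebraic closure of the field of Laurent series over
k: the order of the x-coordinate doubles along P, 2P, 4P, …, so too many multiples of P are distinct
(`exists_tenPoints_smul_ne_zero`). Finally, a nonzero section on the blow-up is, away from the
exceptional divisors, a nonzero form with the required multiplicities (`existsCurve_of_H0_ne_bot`).
-/

variable (W) in
/-- The coordinate function `x`. -/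
noncomputable def coordX : W.CoordinateRing := mk W (Polynomial.C Polynomial.X)

variable (W) in
/-- The coordinate function `y`. -/
noncomputable def coordY : W.CoordinateRing := mk W Polynomial.X

theorem algebraMap_eq (p : F[X]) : algebraMap F[X] W.CoordinateRing p = mk W (Polynomial.C p) :=
  rfl

theorem coord_equation : coordY W ^ 2 + algebraMap F _ W.a₁ * coordX W * coordY W
    + algebraMap F _ W.a₃ * coordY W = coordX W ^ 3 + algebraMap F _ W.a₂ * coordX W ^ 2
      + algebraMap F _ W.a₄ * coordX W + algebraMap F _ W.a₆ := by
  have : mk W (Polynomial.X ^ 2 + Polynomial.C (Polynomial.C W.a₁ * Polynomial.X +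
      Polynomial.C W.a₃) * Polynomial.X - Polynomial.C (Polynomial.X ^ 3 + Polynomial.C W.a₂ *
      Polynomial.X ^ 2 + Polynomial.C W.a₄ * Polynomial.X + Polynomial.C W.a₆)) = 0 :=
    AdjoinRoot.mk_self
  simp only [map_sub, map_add, map_mul, map_pow] at this
  rw [← sub_eq_zero, ← this]
  simp only [coordX, coordY, IsScalarTower.algebraMap_apply F F[X] W.CoordinateRing,
    algebraMap_eq, Polynomial.algebraMap_eq]
  ring

/-- Evaluation of a regular function at a point of the affine curve. -/
noncomputable def evalAt {x y : F} (h : W.Equation x y) : W.CoordinateRing →+* F :=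
  AdjoinRoot.lift (Polynomial.evalRingHom x) y (by
    rw [Polynomial.eval₂_evalRingHom]; exact h)

@[simp] theorem evalAt_coordX {x y : F} (h : W.Equation x y) : evalAt h (coordX W) = x := by
  simp [evalAt, coordX]

@[simp] theorem evalAt_coordY {x y : F} (h : W.Equation x y) : evalAt h (coordY W) = y := by
  simp [evalAt, coordY]

@[simp] theorem evalAt_algebraMap {x y : F} (h : W.Equation x y) (a : F) :
    evalAt h (algebraMap F _ a) = a := by
  rw [IsScalarTower.algebraMap_apply F F[X] W.CoordinateRing, algebraMap_eq]
  simp [evalAt]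

theorem evalAt_surjective {x y : F} (h : W.Equation x y) : Function.Surjective (evalAt h) :=
  fun a => ⟨_, evalAt_algebraMap h a⟩

theorem XYIdeal_eq_span {x y : F} : XYIdeal W x (Polynomial.C y) =
    Ideal.span {coordX W - algebraMap F _ x, coordY W - algebraMap F _ y} := by
  simp only [XYIdeal, XClass, YClass, coordX, coordY, map_sub,
    IsScalarTower.algebraMap_apply F F[X] W.CoordinateRing, algebraMap_eq,
    Polynomial.algebraMap_eq]

theorem mem_XYIdeal_iff {x y : F} (h : W.Equation x y) {g : W.CoordinateRing} :
    g ∈ XYIdeal W x (Polynomial.C y) ↔ evalAt h g = 0 := by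
  rw [XYIdeal_eq_span]
  constructor
  · intro hg
    obtain ⟨a, b, rfl⟩ := Ideal.mem_span_pair.1 hg
    simp
  · intro hg
    obtain ⟨p, q, rfl⟩ := exists_smul_basis_eq g
    have key : ∀ p : F[X], ∃ r, algebraMap F[X] W.CoordinateRing p =
        algebraMap F _ (p.eval x) + r * (coordX W - algebraMap F _ x) := by
      intro p
      obtain ⟨r, hr⟩ := Polynomial.X_sub_C_dvd_sub_C_eval (p := p) (a := x)
      refine ⟨algebraMap F[X] _ r, ?_⟩
      have := congrArg (algebraMap F[X] W.CoordinateRing) hr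
      simp only [map_sub, map_mul] at this
      rw [sub_eq_iff_eq_add] at this
      rw [this]
      simp only [coordX, IsScalarTower.algebraMap_apply F F[X] W.CoordinateRing, algebraMap_eq,
        Polynomial.algebraMap_eq]
      ring
    obtain ⟨r, hr⟩ := key p
    obtain ⟨s, hs⟩ := key q
    rw [Algebra.smul_def, Algebra.smul_def, hr, hs] at hg ⊢
    change evalAt h (_ + _ * coordY W) = 0 at hg
    change _ + _ * coordY W ∈ _
    simp only [map_add, map_mul, map_sub, evalAt_algebraMap, evalAt_coordX, evalAt_coordY, sub_self,
      mul_zero, add_zero, mul_one] at hg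
    refine Ideal.mem_span_pair.2 ⟨r + s * coordY W, algebraMap F _ (q.eval x), ?_⟩
    have hg' : algebraMap F W.CoordinateRing (p.eval x) =
      - (algebraMap F _ (q.eval x) * algebraMap F _ y) := by
      rw [← map_mul, ← map_neg]; congr 1; linear_combination hg
    rw [hg']; ring

theorem XYIdeal_isMaximal {x y : F} (h : W.Equation x y) :
    (XYIdeal W x (Polynomial.C y)).IsMaximal := by
  have : XYIdeal W x (Polynomial.C y) = RingHom.ker (evalAt h) := by
    ext g; rw [mem_XYIdeal_iff h, RingHom.mem_ker]
  rw [this]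
  exact RingHom.ker_isMaximal_of_surjective _ (evalAt_surjective h)

theorem XYIdeal_isCoprime {x y x' y' : F} (h : W.Equation x y) (h' : W.Equation x' y')
    (hne : (x, y) ≠ (x', y')) :
    IsCoprime (XYIdeal W x (Polynomial.C y)) (XYIdeal W x' (Polynomial.C y')) := by
  rw [Ideal.isCoprime_iff_sup_eq]
  refine (XYIdeal_isMaximal h).coprime_of_ne (XYIdeal_isMaximal h') fun he => hne ?_
  have h1 : coordX W - algebraMap F _ x ∈ XYIdeal W x' (Polynomial.C y') := by
    rw [← he, mem_XYIdeal_iff h]; simp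
  have h2 : coordY W - algebraMap F _ y ∈ XYIdeal W x' (Polynomial.C y') := by
    rw [← he, mem_XYIdeal_iff h]; simp
  rw [mem_XYIdeal_iff h'] at h1 h2
  simp only [map_sub, evalAt_coordX, evalAt_coordY, evalAt_algebraMap, sub_eq_zero] at h1 h2
  rw [h1, h2]

variable (W) in
/-- The involution of the coordinate ring induced by the negation of points. -/
noncomputable def conj : W.CoordinateRing →+* W.CoordinateRing :=
  AdjoinRoot.lift (algebraMap F[X] _)
    (-coordY W - algebraMap F _ W.a₁ * coordX W - algebraMap F _ W.a₃) (by
    have := coord_equation (W := W)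
    change Polynomial.eval₂ _ _ (Polynomial.X ^ 2 + Polynomial.C (Polynomial.C W.a₁ * Polynomial.X +
      Polynomial.C W.a₃) * Polynomial.X - Polynomial.C (Polynomial.X ^ 3 + Polynomial.C W.a₂ *
      Polynomial.X ^ 2 + Polynomial.C W.a₄ * Polynomial.X + Polynomial.C W.a₆)) = 0
    simp only [Polynomial.eval₂_sub, Polynomial.eval₂_add, Polynomial.eval₂_mul,
      Polynomial.eval₂_pow, Polynomial.eval₂_X, Polynomial.eval₂_C, map_add, map_mul,
      map_pow]
    simp only [coordX, coordY, IsScalarTower.algebraMap_apply F F[X] W.CoordinateRing,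
      algebraMap_eq, Polynomial.algebraMap_eq] at this ⊢
    linear_combination this)

theorem conj_algebraMap (p : F[X]) : conj W (algebraMap F[X] _ p) = algebraMap F[X] _ p := by
  rw [conj]
  exact AdjoinRoot.lift_of _

theorem conj_coordX : conj W (coordX W) = coordX W := conj_algebraMap _

theorem conj_algebraMap' (p : F) : conj W (algebraMap F _ p) = algebraMap F _ p := by
  rw [IsScalarTower.algebraMap_apply F F[X] W.CoordinateRing, conj_algebraMap]

theorem conj_coordY : conj W (coordY W) =
    -coordY W - algebraMap F _ W.a₁ * coordX W - algebraMap F _ W.a₃ := by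
  rw [conj]
  exact AdjoinRoot.lift_root _

/-- The coordinate ring is free of rank two over `F[X]` with involution `conj W`, so the norm is the
product of the two conjugates. This reduces the counting of zeros to divisibility of polynomials in
x. -/
theorem algebraMap_norm (g : W.CoordinateRing) :
    algebraMap F[X] _ (Algebra.norm F[X] g) = g * conj W g := by
  obtain ⟨p, q, rfl⟩ := exists_smul_basis_eq g
  rw [show algebraMap F[X] W.CoordinateRing _ = _ from coe_norm_smul_basis p q, Algebra.smul_def, Algebra.smul_def, map_mul]
  rw [mul_one]
  change _ = (_ + _ * coordY W) * conj W (_ + _ * coordY W)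
  rw [map_add (conj W), map_mul (conj W), conj_algebraMap, conj_algebraMap, conj_coordY]
  simp only [map_add, map_sub, map_mul, map_neg, coordX, coordY,
    IsScalarTower.algebraMap_apply F F[X] W.CoordinateRing,
      algebraMap_eq, Polynomial.algebraMap_eq]
  ring

theorem conj_mem_XYIdeal {x y : F} {g : W.CoordinateRing}
    (hg : g ∈ XYIdeal W x (Polynomial.C y)) :
    conj W g ∈ XYIdeal W x (Polynomial.C (W.negY x y)) := by
  rw [XYIdeal_eq_span] at hg ⊢
  obtain ⟨a, b, rfl⟩ := Ideal.mem_span_pair.1 hg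
  refine Ideal.mem_span_pair.2 ⟨conj W a - conj W b * algebraMap F _ W.a₁, - conj W b, ?_⟩
  simp only [map_add, map_mul, map_sub, conj_coordX, conj_coordY, conj_algebraMap', negY, map_neg]
  ring

theorem conj_mem_XYIdeal_pow {x y : F} {g : W.CoordinateRing} {e : ℕ}
    (hg : g ∈ XYIdeal W x (Polynomial.C y) ^ e) :
    conj W g ∈ XYIdeal W x (Polynomial.C (W.negY x y)) ^ e := by
  have : XYIdeal W x (Polynomial.C y) ≤
      (XYIdeal W x (Polynomial.C (W.negY x y))).comap (conj W) := fun a ha => conj_mem_XYIdeal ha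
  exact Ideal.le_comap_pow _ e (Ideal.pow_right_mono this e hg)

/-- As 1 and y form a basis over `F[X]`, a quotient can be replaced by its coefficient at 1. -/
theorem algebraMap_dvd_iff {p q : F[X]} :
    algebraMap F[X] W.CoordinateRing p ∣ algebraMap F[X] _ q ↔ p ∣ q := by
  refine ⟨?_, fun h => map_dvd _ h⟩
  rintro ⟨g, hg⟩
  obtain ⟨a, b, rfl⟩ := exists_smul_basis_eq g
  have : (q - p * a) • (1 : W.CoordinateRing) + (-(p * b)) • mk W Polynomial.X = 0 := by
    simp only [Algebra.smul_def, map_sub, map_mul, map_neg, hg]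
    ring
  have := (smul_basis_eq_zero this).1
  exact ⟨a, by linear_combination this⟩

theorem algebraMap_injective : Function.Injective (algebraMap F[X] W.CoordinateRing) :=
  FaithfulSMul.algebraMap_injective _ _

variable [DecidableEq F]

/-- A regular function on a Weierstrass curve has at least as many poles at infinity as zeros. If
the numbers agree, then the sum of the zeros in the group of points vanishes. -/
theorem sum_smul_eq_zero_of_mem_pow {ι : Type*} [Fintype ι] {x y : ι → F}
    (h : ∀ i, W.Nonsingular (x i) (y i)) (hinj : Function.Injective fun i => (x i, y i))
    (e : ι → ℕ) {g : W.CoordinateRing} (hg : g ≠ 0)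
    (hmem : ∀ i, g ∈ XYIdeal W (x i) (Polynomial.C (y i)) ^ e i)
    (hdeg : (Algebra.norm F[X] g).degree ≤ (∑ i, e i : ℕ)) :
    ∑ i, e i • (Point.some _ _ (h i) : W.Point) = 0 := by
  classical
  set J : Ideal W.CoordinateRing := ∏ i, XYIdeal W (x i) (Polynomial.C (y i)) ^ e i with hJ
  set J' : Ideal W.CoordinateRing :=
    ∏ i, XYIdeal W (x i) (Polynomial.C (W.negY (x i) (y i))) ^ e i with hJ'
  set D : F[X] := ∏ i, (Polynomial.X - Polynomial.C (x i)) ^ e i with hD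
  have hgJ : g ∈ J := by
    rw [hJ, Ideal.prod_eq_iInf_of_pairwise_isCoprime]
    · simpa using hmem
    · intro i _ j _ hij
      exact (XYIdeal_isCoprime (h i).1 (h j).1 fun he => hij (hinj he)).pow
  have hgJ' : conj W g ∈ J' := by
    rw [hJ', Ideal.prod_eq_iInf_of_pairwise_isCoprime]
    · simpa using fun i => conj_mem_XYIdeal_pow (hmem i)
    · intro i _ j _ hij
      refine (XYIdeal_isCoprime ((nonsingular_neg ..).mpr (h i)).1
        ((nonsingular_neg ..).mpr (h j)).1 fun he => hij (hinj ?_)).pow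
      simp only [Prod.mk.injEq, negY] at he ⊢
      obtain ⟨h1, h2⟩ := he
      refine ⟨h1, ?_⟩
      rw [h1] at h2
      linear_combination -h2
  -- A point and its negative are together the zeros of x minus a constant.
  have hJJ' : J * J' = Ideal.span {algebraMap F[X] W.CoordinateRing D} := by
    rw [hJ, hJ', ← Finset.prod_mul_distrib, hD, map_prod, ← Ideal.prod_span_singleton]
    refine Finset.prod_congr rfl fun i _ => ?_
    rw [← mul_pow, mul_comm, XYIdeal_neg_mul (h i), XIdeal, Ideal.span_singleton_pow, map_pow]
    rfl
  have hDmonic : D.Monic := Polynomial.monic_prod_of_monic _ _ fun i _ =>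
    (Polynomial.monic_X_sub_C _).pow _
  have hDdeg : D.degree = (∑ i, e i : ℕ) := by
    rw [hD, Polynomial.degree_prod]
    simp
  have hN : Algebra.norm F[X] g ≠ 0 := fun h0 => hg (by
    have : algebraMap F[X] _ (Algebra.norm F[X] g) = g * conj W g := algebraMap_norm g
    have hinv : conj W (conj W g) = g := by
      obtain ⟨p, q, rfl⟩ := exists_smul_basis_eq g
      rw [Algebra.smul_def, Algebra.smul_def]
      change conj W (conj W (_ + _ * coordY W)) = _ + _ * coordY W
      simp only [map_add, map_mul, conj_algebraMap, conj_coordY, map_sub, map_neg, conj_coordX,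
        conj_algebraMap', map_one]
      ring
    rw [h0, map_zero, eq_comm, mul_eq_zero] at this
    rcases this with h | h
    · exact h
    · rw [← hinv, h, map_zero])
  have hdvd : D ∣ Algebra.norm F[X] g := by
    rw [← algebraMap_dvd_iff (W := W), algebraMap_norm, ← Ideal.mem_span_singleton, ← hJJ']
    exact Ideal.mul_mem_mul hgJ hgJ'
  obtain ⟨c, hc⟩ := hdvd
  have hc0 : c ≠ 0 := by rintro rfl; exact hN (by rw [hc, mul_zero])
  -- The norm has at least the zeros of `D` and at most that degree, so nothing is left over.
  have hcdeg : c.degree = 0 := by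
    rw [hc, Polynomial.degree_mul, hDdeg, Polynomial.degree_eq_natDegree hc0] at hdeg
    rw [Polynomial.degree_eq_natDegree hc0]
    norm_cast at hdeg ⊢
    omega
  have hcu : IsUnit c := Polynomial.isUnit_iff_degree_eq_zero.2 hcdeg
  have hspan : Ideal.span {g} * Ideal.span {conj W g} = J * J' := by
    rw [Ideal.span_singleton_mul_span_singleton, ← algebraMap_norm, hJJ', hc, map_mul,
      Ideal.span_singleton_mul_right_unit (hcu.map _)]
  -- Both products equal the nonzero principal ideal of `D`. Multiplying by `J` and cancelling this
  -- ideal turns the inclusion for `conj W g` into the reverse inclusion for `g`.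
  have hle : J ≤ Ideal.span {g} := by
    have hD0 : algebraMap F[X] W.CoordinateRing D ≠ 0 := fun h0 =>
      hDmonic.ne_zero (algebraMap_injective (by rw [h0, map_zero]))
    rw [← Ideal.span_singleton_mul_right_mono hD0, ← hJJ']
    calc J * J' * J = Ideal.span {g} * Ideal.span {conj W g} * J := by rw [hspan]
      _ ≤ Ideal.span {g} * J' * J := by
          gcongr
          rwa [Ideal.span_singleton_le_iff_mem]
      _ = J * J' * Ideal.span {g} := by ring
  have hJg : J = Ideal.span {g} :=
    le_antisymm hle ((Ideal.span_singleton_le_iff_mem _).2 hgJ)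
  -- The ideal of zeros is principal, so the class of the sum is trivial.
  apply Point.toClass_injective
  rw [map_zero, map_sum]
  simp only [map_nsmul, Point.toClass_some]
  change Additive.ofMul (∏ i, ClassGroup.mk W.FunctionField (XYIdeal' (h i)) ^ e i) = 0
  rw [ofMul_eq_zero]
  simp only [← map_pow, ← map_prod]
  refine (ClassGroup.mk_eq_one_of_coe_ideal (I' := J) ?_).2 ⟨g, hg, hJg⟩
  rw [hJ]
  simp only [Units.coe_prod, Units.val_pow_eq_pow_val, XYIdeal'_eq]
  rw [← FractionalIdeal.coeIdealHom_apply, map_prod]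
  simp only [map_pow, FractionalIdeal.coeIdealHom_apply]

end WeierstrassCurve.Affine.CoordinateRing

/-! ### Pole orders at infinity -/

namespace WeierstrassCurve.Affine.CoordinateRing

open Polynomial

variable {F : Type*} [Field F] {W : WeierstrassCurve.Affine F}

/-- The pole order at infinity of a regular function (with value `⊥` at zero). -/
noncomputable def poleOrder (g : W.CoordinateRing) : WithBot ℕ := (Algebra.norm F[X] g).degree

theorem poleOrder_mul (g h : W.CoordinateRing) :
    poleOrder (g * h) = poleOrder g + poleOrder h := by
  simp [poleOrder, Polynomial.degree_mul]

/-- Here x has a double and y a triple pole. The two summands have pole orders of different parity,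
so they cannot cancel. -/
theorem poleOrder_smul_basis (p q : F[X]) :
    poleOrder (algebraMap F[X] W.CoordinateRing p + algebraMap F[X] _ q * coordY W) =
      max (2 • p.degree) (2 • q.degree + 3) := by
  rw [poleOrder, ← degree_norm_smul_basis (W' := W) p q, Algebra.smul_def, Algebra.smul_def,
    mul_one]
  rfl

theorem exists_algebraMap_add_mul (g : W.CoordinateRing) :
    ∃ p q : F[X], g = algebraMap F[X] W.CoordinateRing p + algebraMap F[X] _ q * coordY W := by
  obtain ⟨p, q, rfl⟩ := exists_smul_basis_eq g
  refine ⟨p, q, ?_⟩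
  rw [Algebra.smul_def, Algebra.smul_def, mul_one]
  rfl

theorem poleOrder_add_le (g h : W.CoordinateRing) :
    poleOrder (g + h) ≤ max (poleOrder g) (poleOrder h) := by
  obtain ⟨p, q, rfl⟩ := exists_algebraMap_add_mul g
  obtain ⟨r, s, rfl⟩ := exists_algebraMap_add_mul h
  have : algebraMap F[X] W.CoordinateRing p + algebraMap F[X] _ q * coordY W +
      (algebraMap F[X] W.CoordinateRing r + algebraMap F[X] _ s * coordY W) =
      algebraMap F[X] W.CoordinateRing (p + r) + algebraMap F[X] _ (q + s) * coordY W := by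
    rw [map_add, map_add]; ring
  rw [this]
  simp only [poleOrder_smul_basis]
  have h1 : (p + r).degree ≤ max p.degree r.degree := Polynomial.degree_add_le p r
  have h2 : (q + s).degree ≤ max q.degree s.degree := Polynomial.degree_add_le q s
  refine max_le ?_ ?_
  · rcases le_max_iff.1 h1 with h | h
    · exact le_max_of_le_left (le_max_of_le_left (nsmul_le_nsmul_right h 2))
    · exact le_max_of_le_right (le_max_of_le_left (nsmul_le_nsmul_right h 2))
  · rcases le_max_iff.1 h2 with h | h
    · exact le_max_of_le_left (le_max_of_le_right (by gcongr))
    · exact le_max_of_le_right (le_max_of_le_right (by gcongr))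

theorem poleOrder_coordX : poleOrder (coordX W) = 2 := by
  have := poleOrder_smul_basis (W := W) Polynomial.X 0
  rw [map_zero, zero_mul, add_zero] at this
  exact this.trans (by simp)

theorem poleOrder_coordY : poleOrder (coordY W) = 3 := by
  have := poleOrder_smul_basis (W := W) 0 1
  rw [map_zero, zero_add, map_one, one_mul] at this
  exact this.trans (by simp)

theorem poleOrder_algebraMap {a : F} (ha : a ≠ 0) :
    poleOrder (algebraMap F W.CoordinateRing a) = 0 := by
  have := poleOrder_smul_basis (W := W) (Polynomial.C a) 0
  rw [map_zero, zero_mul, add_zero] at this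
  rw [IsScalarTower.algebraMap_apply F F[X] W.CoordinateRing]
  exact this.trans (by simp [Polynomial.degree_C ha])

@[simp] theorem poleOrder_zero : poleOrder (0 : W.CoordinateRing) = ⊥ := by
  have := poleOrder_smul_basis (W := W) 0 0
  rw [map_zero, zero_mul, add_zero] at this
  exact this.trans (by simp)

theorem poleOrder_algebraMap_le (a : F) : poleOrder (algebraMap F W.CoordinateRing a) ≤ 0 := by
  rcases eq_or_ne a 0 with rfl | ha
  · simp
  · exact (poleOrder_algebraMap ha).le

@[simp] theorem poleOrder_one : poleOrder (1 : W.CoordinateRing) = 0 := by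
  simp [poleOrder]

theorem poleOrder_pow (g : W.CoordinateRing) (n : ℕ) : poleOrder (g ^ n) = n • poleOrder g := by
  induction n with
  | zero => simp
  | succ n ih => rw [pow_succ, poleOrder_mul, ih, succ_nsmul]

theorem poleOrder_neg (g : W.CoordinateRing) : poleOrder (-g) = poleOrder g := by
  have : -g = algebraMap F _ (-1) * g := by simp
  rw [this, poleOrder_mul, poleOrder_algebraMap (by simp), zero_add]

theorem poleOrder_eq_bot_iff {g : W.CoordinateRing} : poleOrder g = ⊥ ↔ g = 0 := by
  refine ⟨fun h => ?_, fun h => by simp [h]⟩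
  obtain ⟨p, q, rfl⟩ := exists_algebraMap_add_mul g
  rw [poleOrder_smul_basis, max_eq_bot] at h
  have hp : p = 0 := by
    rw [← Polynomial.degree_eq_bot]
    by_contra h0
    obtain ⟨n, hn⟩ := WithBot.ne_bot_iff_exists.1 h0
    rw [← hn] at h
    exact absurd h.1 (by rw [two_nsmul, ← WithBot.coe_add]; exact WithBot.coe_ne_bot)
  have hq : q = 0 := by
    rw [← Polynomial.degree_eq_bot]
    by_contra h0
    obtain ⟨n, hn⟩ := WithBot.ne_bot_iff_exists.1 h0
    rw [← hn] at h
    refine absurd h.2 ?_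
    rw [two_nsmul, ← WithBot.coe_add]
    exact WithBot.coe_ne_bot (a := n + n + 3)
  simp [hp, hq]

theorem poleOrder_sum_lt {ι : Type*} (s : Finset ι) (g : ι → W.CoordinateRing) {D : WithBot ℕ}
    (hD : ⊥ < D) (h : ∀ i ∈ s, poleOrder (g i) < D) : poleOrder (∑ i ∈ s, g i) < D := by
  classical
  induction s using Finset.induction_on with
  | empty => simpa using hD
  | insert a s ha ih =>
    rw [Finset.sum_insert ha]
    exact (poleOrder_add_le _ _).trans_lt (max_lt (h a (Finset.mem_insert_self a s))
      (ih fun i hi => h i (Finset.mem_insert_of_mem hi)))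

theorem poleOrder_sum_le {ι : Type*} (s : Finset ι) (g : ι → W.CoordinateRing) {D : WithBot ℕ}
    (h : ∀ i ∈ s, poleOrder (g i) ≤ D) : poleOrder (∑ i ∈ s, g i) ≤ D := by
  classical
  induction s using Finset.induction_on with
  | empty => simp
  | insert a s ha ih =>
    rw [Finset.sum_insert ha]
    exact (poleOrder_add_le _ _).trans (max_le (h a (Finset.mem_insert_self a s))
      (ih fun i hi => h i (Finset.mem_insert_of_mem hi)))

/-- Functions with distinct pole orders are linearly independent. -/
theorem eq_zero_of_sum_smul_eq_zero {ι : Type*} (s : Finset ι) (g : ι → W.CoordinateRing)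
    (hg : ∀ i ∈ s, g i ≠ 0) (hinj : Set.InjOn (fun i => poleOrder (g i)) s) (c : ι → F)
    (hsum : ∑ i ∈ s, algebraMap F _ (c i) * g i = 0) : ∀ i ∈ s, c i = 0 := by
  classical
  by_contra! hne
  obtain ⟨i₀, hi₀, hc₀⟩ := hne
  obtain ⟨i, hi, hmax⟩ := (s.filter fun i => c i ≠ 0).exists_max_image (fun i => poleOrder (g i))
    ⟨i₀, by simp [hi₀, hc₀]⟩
  simp only [Finset.mem_filter] at hi hmax
  have hpos : ⊥ < poleOrder (g i) :=
    bot_lt_iff_ne_bot.2 fun h => hg i hi.1 (poleOrder_eq_bot_iff.1 h)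
  rw [← Finset.add_sum_erase _ _ hi.1, add_eq_zero_iff_eq_neg] at hsum
  have h1 : poleOrder (algebraMap F _ (c i) * g i) = poleOrder (g i) := by
    rw [poleOrder_mul, poleOrder_algebraMap hi.2, zero_add]
  have h2 : poleOrder (∑ j ∈ s.erase i, algebraMap F _ (c j) * g j) < poleOrder (g i) := by
    refine poleOrder_sum_lt _ _ hpos fun j hj => ?_
    rw [Finset.mem_erase] at hj
    rcases eq_or_ne (c j) 0 with h0 | h0
    · simpa [h0] using hpos
    · rw [poleOrder_mul, poleOrder_algebraMap h0, zero_add]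
      exact lt_of_le_of_ne (hmax j ⟨hj.2, h0⟩) fun he => hj.1 (hinj hj.2 hi.1 he)
  rw [hsum, poleOrder_neg] at h1
  exact h2.ne h1

end WeierstrassCurve.Affine.CoordinateRing

/-! ### The cubic as a quotient by a point of order two -/

namespace BlowUpPlane

section Cubic

variable {F : Type*} [Field F] (b g : F)

/-- The Weierstrass curve `y² + x y = x³ + b x² + g x`. -/
def curve : WeierstrassCurve.Affine F := ⟨1, b, 0, g, 0⟩

/-- The homogeneous equation of the quotient of `curve b g` by its point `(0, 0)` of order two. -/
noncomputable def cubic : MvPolynomial (Fin 3) F :=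
  X 1 ^ 2 * X 2 + X 0 * X 1 * X 2 - X 0 ^ 3 - C b * X 0 ^ 2 * X 2 + C (4 * g) * X 0 * X 2 ^ 2
    + C ((1 + 4 * b) * g) * X 2 ^ 3

open WeierstrassCurve.Affine.CoordinateRing

/-- The ring of regular functions on the affine curve. -/
abbrev Fun : Type _ := (curve b g).CoordinateRing

theorem coordY_sq : coordY (curve b g) ^ 2 = -coordX (curve b g) * coordY (curve b g)
    + coordX (curve b g) ^ 3 + algebraMap F _ b * coordX (curve b g) ^ 2
      + algebraMap F _ g * coordX (curve b g) := by
  have h := coord_equation (W := curve b g)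
  have h1 : (curve b g).a₁ = 1 := rfl
  have h2 : (curve b g).a₂ = b := rfl
  have h3 : (curve b g).a₃ = 0 := rfl
  have h4 : (curve b g).a₄ = g := rfl
  have h6 : (curve b g).a₆ = 0 := rfl
  simp only [h1, h2, h3, h4, h6, map_one, map_zero] at h
  linear_combination h

/-- Homogeneous coordinates of the quotient map of `curve b g` by the point `(0, 0)`. -/
noncomputable def quotientMap : Fin 3 → Fun b g :=
  ![coordX _ ^ 3 + algebraMap F _ g * coordX _,
    coordX _ ^ 2 * coordY _ - algebraMap F _ g * coordY _ - algebraMap F _ g * coordX _,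
    coordX _ ^ 2]

/-- In affine coordinates the map is X = x + g/x, Y = y - gy/x² - g/x, the sums of the coordinates
of a point and of its translate by (0, 0). The factor x² clears denominators. -/
theorem cubic_quotientMap : aeval (quotientMap b g) (cubic b g) = 0 := by
  have h := coordY_sq b g
  simp only [cubic, quotientMap, map_add, map_sub, map_mul, map_pow, aeval_X, algHom_C,
    Matrix.cons_val, map_ofNat, map_one]
  generalize coordX (curve b g) = x at *
  generalize coordY (curve b g) = y at *
  generalize algebraMap F (Fun b g) b = B at *
  generalize algebraMap F (Fun b g) g = G at *
  linear_combination ((x ^ 2 - G) ^ 2 * x ^ 2) * h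

theorem coordX_eq : coordX (curve b g) = algebraMap (Polynomial F) _ Polynomial.X := rfl

theorem algebraMap_eq_C (a : F) :
    algebraMap F (Fun b g) a = algebraMap (Polynomial F) _ (Polynomial.C a) :=
  IsScalarTower.algebraMap_apply F (Polynomial F) (Fun b g) a

theorem poleOrder_quotientMap_zero : poleOrder (quotientMap b g 0) = 6 := by
  have h : quotientMap b g 0 = algebraMap (Polynomial F) _
      (Polynomial.X ^ 3 + Polynomial.C g * Polynomial.X)
      + algebraMap (Polynomial F) _ 0 * coordY (curve b g) := by
    simp [quotientMap, coordX_eq, algebraMap_eq_C]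
  rw [h, poleOrder_smul_basis]
  have : (Polynomial.X ^ 3 + Polynomial.C g * Polynomial.X : Polynomial F).degree = 3 := by
    compute_degree!
  rw [this]
  rfl

theorem poleOrder_quotientMap_one : poleOrder (quotientMap b g 1) = 7 := by
  have h : quotientMap b g 1 = algebraMap (Polynomial F) _ (Polynomial.C (-g) * Polynomial.X)
      + algebraMap (Polynomial F) _ (Polynomial.X ^ 2 - Polynomial.C g)
        * coordY (curve b g) := by
    simp only [quotientMap, coordX_eq, algebraMap_eq_C, map_mul, map_sub, map_pow, map_neg,
      Matrix.cons_val]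
    ring
  rw [h, poleOrder_smul_basis]
  have h1 : (Polynomial.X ^ 2 - Polynomial.C g : Polynomial F).degree = 2 := by
    compute_degree!
  have h2 : (Polynomial.C (-g) * Polynomial.X : Polynomial F).degree ≤ 1 := by
    compute_degree
  rw [h1]
  refine max_eq_right ((nsmul_le_nsmul_right h2 2).trans ?_)
  decide

theorem poleOrder_quotientMap_two : poleOrder (quotientMap b g 2) = 4 := by
  have h : quotientMap b g 2 = coordX (curve b g) ^ 2 := by
    simp [quotientMap]
  rw [h, poleOrder_pow, poleOrder_coordX]
  rfl

theorem poleOrder_quotientMap_prod (m : Fin 3 →₀ ℕ) :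
    poleOrder (m.prod fun i k => quotientMap b g i ^ k) =
      ((6 * m 0 + 7 * m 1 + 4 * m 2 : ℕ) : WithBot ℕ) := by
  rw [Finsupp.prod_fintype _ _ (by simp), Fin.prod_univ_three, poleOrder_mul, poleOrder_mul,
    poleOrder_pow, poleOrder_pow, poleOrder_pow, poleOrder_quotientMap_zero,
    poleOrder_quotientMap_one, poleOrder_quotientMap_two]
  simp only [nsmul_eq_mul]
  push_cast
  ring

/-- The forms of degree `d - k`, with `0` as the only such form if `d < k`. -/
noncomputable def formsSub (R : Type*) [CommRing R] (d k : ℕ) :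
    Submodule R (MvPolynomial (Fin 3) R) :=
  if k ≤ d then homogeneousSubmodule (Fin 3) R (d - k) else ⊥

theorem mem_formsSub {R : Type*} [CommRing R] {d k : ℕ} {A : MvPolynomial (Fin 3) R} :
    A ∈ formsSub R d k ↔ A = 0 ∨ ∃ e, e + k = d ∧ A.IsHomogeneous e := by
  rw [formsSub]
  split_ifs with h
  · rw [mem_homogeneousSubmodule]
    constructor
    · exact fun hA => Or.inr ⟨d - k, by omega, hA⟩
    · rintro (rfl | ⟨e, he, hA⟩)
      · exact isHomogeneous_zero _ _ _
      · rwa [show d - k = e by omega]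
  · rw [Submodule.mem_bot]
    refine ⟨Or.inl, ?_⟩
    rintro (h0 | ⟨e, he, -⟩)
    · exact h0
    · omega

/-- Division with remainder by the cubic: up to sign it is monic in `X 0`, so the cube of `X 0` can
be traded for terms of lower degree in `X 0`. -/
theorem monomial_mem_reduction (d : ℕ) (n : ℕ) : ∀ m : Fin 3 →₀ ℕ, m 0 = n → m.degree = d →
    (monomial m 1 : MvPolynomial (Fin 3) F) ∈
      (formsSub F d 3).map (LinearMap.mulLeft F (cubic b g)) ⊔
        restrictSupport F {m : Fin 3 →₀ ℕ | m.degree = d ∧ m 0 ≤ 2} := by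
  induction n using Nat.strong_induction_on with
  | _ n ih =>
    intro m hm hd
    by_cases h2 : m 0 ≤ 2
    · refine Submodule.mem_sup_right ?_
      rw [mem_restrictSupport_iff]
      intro a ha
      have := support_monomial_subset ha
      rw [Finset.mem_singleton] at this
      subst this
      exact ⟨hd, h2⟩
    · push Not at h2
      obtain ⟨m', rfl⟩ : ∃ m', m = m' + Finsupp.single 0 3 := by
        refine ⟨m - Finsupp.single 0 3, (tsub_add_cancel_of_le ?_).symm⟩
        rw [Finsupp.single_le_iff]; exact h2
      have hdeg : m'.degree + 3 = d := by
        rw [← hd, map_add, Finsupp.degree_single]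
      have e1 := ih (m' 0) (by simp at hm; omega)
        (m' + Finsupp.single 1 2 + Finsupp.single 2 1) (by simp)
        (by simp only [map_add, Finsupp.degree_single]; omega)
      have e2 := ih (m' 0 + 1) (by simp at hm; omega)
        (m' + Finsupp.single 0 1 + Finsupp.single 1 1 + Finsupp.single 2 1) (by simp)
        (by simp only [map_add, Finsupp.degree_single]; omega)
      have e3 := ih (m' 0 + 2) (by simp at hm; omega)
        (m' + Finsupp.single 0 2 + Finsupp.single 2 1) (by simp)
        (by simp only [map_add, Finsupp.degree_single]; omega)
      have e4 := ih (m' 0 + 1) (by simp at hm; omega)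
        (m' + Finsupp.single 0 1 + Finsupp.single 2 2) (by simp)
        (by simp only [map_add, Finsupp.degree_single]; omega)
      have e5 := ih (m' 0) (by simp at hm; omega)
        (m' + Finsupp.single 2 3) (by simp)
        (by simp only [map_add, Finsupp.degree_single]; omega)
      have e0 : cubic b g * monomial m' 1 ∈
          (formsSub F d 3).map (LinearMap.mulLeft F (cubic b g)) ⊔
            restrictSupport F {m : Fin 3 →₀ ℕ | m.degree = d ∧ m 0 ≤ 2} := by
        refine Submodule.mem_sup_left ⟨monomial m' 1, ?_, rfl⟩
        exact mem_formsSub.2 (Or.inr ⟨m'.degree, hdeg, isHomogeneous_monomial _ rfl⟩)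
      have key : (monomial (m' + Finsupp.single 0 3) 1 : MvPolynomial (Fin 3) F) =
          - (cubic b g * monomial m' 1) + monomial (m' + Finsupp.single 1 2 + Finsupp.single 2 1) 1
          + monomial (m' + Finsupp.single 0 1 + Finsupp.single 1 1 + Finsupp.single 2 1) 1
          - b • monomial (m' + Finsupp.single 0 2 + Finsupp.single 2 1) 1
          + (4 * g) • monomial (m' + Finsupp.single 0 1 + Finsupp.single 2 2) 1
          + ((1 + 4 * b) * g) • monomial (m' + Finsupp.single 2 3) 1 := by
        simp only [monomial_add_single, cubic, MvPolynomial.smul_eq_C_mul, pow_one]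
        ring
      rw [key]
      exact add_mem (add_mem (sub_mem (add_mem (add_mem (neg_mem e0) e1) e2)
        (Submodule.smul_mem _ _ e3)) (Submodule.smul_mem _ _ e4)) (Submodule.smul_mem _ _ e5)

/-- A monomial of degree `d` pulls back to a function of pole order 4d + 2 m₀ + 3 m₁. With m₀ ≤ 2
this number determines m₀ modulo 3 and then m₁, so distinct monomials have distinct pole orders. -/
theorem eq_zero_of_aeval_quotientMap {d : ℕ} {A : MvPolynomial (Fin 3) F}
    (hA : ∀ m ∈ A.support, m.degree = d ∧ m 0 ≤ 2) (h0 : aeval (quotientMap b g) A = 0) :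
    A = 0 := by
  rw [aeval_def, eval₂_eq] at h0
  have := eq_zero_of_sum_smul_eq_zero A.support
    (fun m => ∏ i ∈ m.support, quotientMap b g i ^ m i) ?_ ?_ (fun m => coeff m A) h0
  · ext m
    by_cases hm : m ∈ A.support
    · simpa using this m hm
    · simpa using hm
  · intro m _ h
    have := poleOrder_quotientMap_prod b g m
    rw [Finsupp.prod, h, poleOrder_zero] at this
    exact WithBot.bot_ne_coe this
  · intro m hm m' hm' he
    have h1 := poleOrder_quotientMap_prod b g m
    have h2 := poleOrder_quotientMap_prod b g m'
    rw [Finsupp.prod] at h1 h2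
    simp only at he
    rw [h1, h2] at he
    replace he : 6 * m 0 + 7 * m 1 + 4 * m 2 = 6 * m' 0 + 7 * m' 1 + 4 * m' 2 := by
      exact_mod_cast he
    have hd := (hA m hm).1
    have hd' := (hA m' hm').1
    have := (hA m hm).2
    have := (hA m' hm').2
    rw [Finsupp.degree_eq_sum, Fin.sum_univ_three] at hd hd'
    ext i
    fin_cases i <;> simp <;> omega

/-- The cubic generates the ideal of the forms that vanish on the image of `quotientMap`. -/
theorem exists_eq_cubic_mul {d k : ℕ} {A : MvPolynomial (Fin 3) F} (hA : A ∈ formsSub F d k)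
    (h0 : aeval (quotientMap b g) A = 0) :
    ∃ B ∈ formsSub F d (k + 3), A = cubic b g * B := by
  rcases mem_formsSub.1 hA with rfl | ⟨e, he, hA⟩
  · exact ⟨0, zero_mem _, by simp⟩
  have : A ∈ (formsSub F e 3).map (LinearMap.mulLeft F (cubic b g)) ⊔
        restrictSupport F {m : Fin 3 →₀ ℕ | m.degree = e ∧ m 0 ≤ 2} := by
    rw [A.as_sum]
    refine sum_mem fun m hm => ?_
    rw [← mul_one (coeff m A), ← smul_eq_mul, ← smul_monomial]
    refine Submodule.smul_mem _ _ (monomial_mem_reduction b g e (m 0) m rfl ?_)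
    have := hA (mem_support_iff.1 hm)
    rw [Finsupp.degree_eq_weight_one]
    exact this
  obtain ⟨_, ⟨B, hB, rfl⟩, R, hR, rfl⟩ := Submodule.mem_sup.1 this
  rw [LinearMap.mulLeft_apply] at *
  rw [map_add, map_mul, cubic_quotientMap, zero_mul, zero_add] at h0
  have hR0 : R = 0 := eq_zero_of_aeval_quotientMap b g (fun m hm => hR hm) h0
  refine ⟨B, ?_, by rw [hR0, add_zero]⟩
  rcases mem_formsSub.1 hB with rfl | ⟨e', he', hB⟩
  · exact zero_mem _
  · exact mem_formsSub.2 (Or.inr ⟨e', by omega, hB⟩)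

end Cubic

end BlowUpPlane

/-! ### Taylor expansions and orders of vanishing -/

namespace BlowUpPlane

section Taylor

variable {σ : Type*} [Fintype σ]

theorem add_pow_of_le {S : Type*} [CommSemiring S] (a b : S) {n N : ℕ} (h : n ≤ N) :
    (a + b) ^ n = ∑ k ∈ Finset.range (N + 1), (n.choose k : S) * a ^ (n - k) * b ^ k := by
  rw [add_comm, add_pow]
  refine (Finset.sum_subset (Finset.range_mono (by omega)) fun k _ hk => ?_).trans
    (Finset.sum_congr rfl fun k _ => by ring)
  rw [Finset.mem_range] at hk
  rw [Nat.choose_eq_zero_of_lt (by omega)]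
  simp

theorem prod_add_pow_of_le {S : Type*} [CommSemiring S] [DecidableEq σ] (a b : σ → S) {β : σ → ℕ}
    {N : ℕ} (h : ∀ i, β i ≤ N) :
    ∏ i, (a i + b i) ^ β i = ∑ α ∈ Fintype.piFinset fun _ : σ => Finset.range (N + 1),
      (∏ i, ((β i).choose (α i) : S) * a i ^ (β i - α i)) * ∏ i, b i ^ α i := by
  simp_rw [← Finset.prod_mul_distrib]
  exact (Finset.prod_congr rfl fun i _ => add_pow_of_le (a i) (b i) (h i)).trans
    (Finset.prod_univ_sum _ fun i k => ((β i).choose k : S) * a i ^ (β i - k) * b i ^ k)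

/-- The coefficient of a translated monomial. -/
theorem coeff_prod_X_add_C {R : Type*} [CommSemiring R] (a : σ → R) (β α : σ →₀ ℕ) :
    coeff α (∏ i, (X i + C (a i) : MvPolynomial σ R) ^ β i) =
      ∏ i, ((β i).choose (α i) : R) * a i ^ (β i - α i) := by
  classical
  have h1 : ∀ i, β i ≤ ∑ i, (β i + α i) := fun i =>
    (Nat.le_add_right _ _).trans (Finset.single_le_sum (f := fun i => β i + α i)
      (fun _ _ => Nat.zero_le _) (Finset.mem_univ i))
  have h2 : ∀ i, α i ≤ ∑ i, (β i + α i) := fun i =>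
    (Nat.le_add_left _ _).trans (Finset.single_le_sum (f := fun i => β i + α i)
      (fun _ _ => Nat.zero_le _) (Finset.mem_univ i))
  simp_rw [add_comm (X _)]
  rw [prod_add_pow_of_le _ _ h1, coeff_sum, Finset.sum_eq_single (α : σ → ℕ)]
  · have : (∏ i, X i ^ α i : MvPolynomial σ R) = monomial α 1 := by
      rw [monomial_eq, C_1, one_mul, Finsupp.prod_fintype _ _ (by simp)]
    rw [this]
    have : (∏ i, ((β i).choose (α i) : MvPolynomial σ R) * C (a i) ^ (β i - α i)) =
        C (∏ i, ((β i).choose (α i) : R) * a i ^ (β i - α i)) := by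
      simp
    rw [this, coeff_C_mul, coeff_monomial, if_pos rfl, mul_one]
  · intro γ _ hγ
    have : (∏ i, X i ^ γ i : MvPolynomial σ R) = monomial (Finsupp.equivFunOnFinite.symm γ) 1 := by
      rw [monomial_eq, C_1, one_mul, Finsupp.prod_fintype _ _ (by simp)]
      simp
    rw [this]
    have : (∏ i, ((β i).choose (γ i) : MvPolynomial σ R) * C (a i) ^ (β i - γ i)) =
        C (∏ i, ((β i).choose (γ i) : R) * a i ^ (β i - γ i)) := by
      simp
    rw [this, coeff_C_mul, coeff_monomial, if_neg, mul_zero]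
    rintro rfl
    exact hγ (by simp)
  · intro h
    exact absurd (by simpa using fun i => Nat.lt_succ_of_le (h2 i)) h

/-- `F` vanishes to order at least `m` at the vector `p`. -/
def VanishesAt {R : Type*} [CommRing R] (F : MvPolynomial σ R) (p : σ → R) (m : ℕ) : Prop :=
  ∀ α : σ →₀ ℕ, α.degree < m → coeff α (aeval (fun j => X j + C (p j)) F) = 0

theorem coeff_aeval_X_add_C {R : Type*} [CommRing R] (F : MvPolynomial σ R) (p : σ → R)
    (α : σ →₀ ℕ) : coeff α (aeval (fun j => X j + C (p j)) F) =
      ∑ β ∈ F.support, coeff β F * ∏ i, ((β i).choose (α i) : R) * p i ^ (β i - α i) := by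
  rw [aeval_def, eval₂_eq', coeff_sum]
  refine Finset.sum_congr rfl fun β _ => ?_
  rw [algebraMap_eq, coeff_C_mul, coeff_prod_X_add_C]

/-- Taylor's formula with a scaled base point: by homogeneity the term of order |α| carries the
factor `s ^ (d - |α|)`. Binomial coefficients replace derivatives, which keeps it valid in every
characteristic. -/
theorem eval₂Hom_homogeneous_add {R S : Type*} [CommRing R] [CommRing S] [DecidableEq σ]
    (φ : R →+* S) {F : MvPolynomial σ R} {d : ℕ} (hF : F.IsHomogeneous d) (p : σ → R)
    (s : S) (h : σ → S) :
    eval₂Hom φ (fun j => s * φ (p j) + h j) F =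
      ∑ α ∈ Fintype.piFinset fun _ : σ => Finset.range (d + 1),
        φ (coeff (Finsupp.equivFunOnFinite.symm α) (aeval (fun j => X j + C (p j)) F)) *
          s ^ (d - ∑ i, α i) * ∏ i, h i ^ α i := by
  simp_rw [coeff_aeval_X_add_C, map_sum, Finset.sum_mul]
  rw [Finset.sum_comm, coe_eval₂Hom, eval₂_eq']
  refine Finset.sum_congr rfl fun β hβ => ?_
  have hd : ∑ i, β i = d := by
    have := hF (mem_support_iff.1 hβ)
    rw [← this, ← Finsupp.degree_eq_sum, Finsupp.degree_eq_weight_one]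
    rfl
  rw [prod_add_pow_of_le (N := d), Finset.mul_sum]
  · refine Finset.sum_congr rfl fun α _ => ?_
    simp only [map_mul, map_prod, map_pow, map_natCast, Finsupp.equivFunOnFinite_symm_apply_apply]
    by_cases hle : ∀ i, α i ≤ β i
    · have : ∑ i, (β i - α i) = d - ∑ i, α i := by
        rw [← hd]
        exact Finset.sum_tsub_distrib _ fun i _ => hle i
      rw [← this, ← Finset.prod_pow_eq_pow_sum]
      simp only [mul_pow, Finset.prod_mul_distrib]
      ring
    · push Not at hle
      obtain ⟨i, hi⟩ := hle
      have h0 : ∀ f : σ → S, ∏ i, ((β i).choose (α i) : S) * f i = 0 := fun f =>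
        Finset.prod_eq_zero (Finset.mem_univ i) (by rw [Nat.choose_eq_zero_of_lt hi]; simp)
      rw [h0, h0]
      ring
  · intro i
    rw [← hd]
    exact Finset.single_le_sum (fun _ _ => Nat.zero_le _) (Finset.mem_univ i)

/-- Only Taylor terms of order at least `m` in the displacement `h` survive. -/
theorem VanishesAt.eval₂Hom_mem_pow {R S : Type*} [CommRing R] [CommRing S]
    (φ : R →+* S) {F : MvPolynomial σ R} {d : ℕ} (hF : F.IsHomogeneous d) {p : σ → R} {m : ℕ}
    (hp : VanishesAt F p m) (s : S) {h : σ → S} {I : Ideal S} (hI : ∀ i, h i ∈ I) :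
    eval₂Hom φ (fun j => s * φ (p j) + h j) F ∈ I ^ m := by
  classical
  rw [eval₂Hom_homogeneous_add φ hF]
  refine sum_mem fun α _ => ?_
  by_cases hα : ∑ i, α i < m
  · rw [hp _ (by simpa [Finsupp.degree_eq_sum] using hα)]
    simp
  · refine Ideal.mul_mem_left _ _ (Ideal.pow_le_pow_right (not_lt.1 hα) ?_)
    rw [← Finset.prod_pow_eq_pow_sum]
    exact Ideal.prod_mem_prod fun i _ => Ideal.pow_mem_pow (hI i) _

/-- On the line through `p` and `w` the point `p` is at infinity, so multiplicity `m` there lowers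
the degree by `m`. -/
theorem VanishesAt.natDegree_le {R : Type*} [CommRing R] {F : MvPolynomial σ R} {d : ℕ}
    (hF : F.IsHomogeneous d) {p : σ → R} {m : ℕ} (hp : VanishesAt F p m) (w : σ → R) :
    (eval₂Hom Polynomial.C (fun j => Polynomial.X * Polynomial.C (p j) + Polynomial.C (w j))
      F).natDegree ≤ d - m := by
  classical
  rw [eval₂Hom_homogeneous_add Polynomial.C hF]
  refine Polynomial.natDegree_sum_le_of_forall_le _ _ fun α _ => ?_
  by_cases hα : ∑ i, α i < m
  · rw [hp _ (by simpa [Finsupp.degree_eq_sum] using hα)]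
    simp
  · simp_rw [← map_pow, ← map_prod]
    refine (Polynomial.natDegree_mul_C_le _ _).trans ((Polynomial.natDegree_C_mul_le _ _).trans
      ((Polynomial.natDegree_X_pow_le _).trans ?_))
    omega

end Taylor

end BlowUpPlane

/-! ### Ten points on the cubic and their velocities -/

namespace BlowUpPlane

open WeierstrassCurve.Affine.CoordinateRing WeierstrassCurve.Affine

/-- Ten points `(x i true + x i false, Y i)` on the affine quotient of `curve b g` by its point
`(0, 0)` of order two, together with the `x`-coordinates of their preimages. -/
structure TenPoints (F : Type*) [Field F] where
  /-- the coefficient of `x²` -/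
  b : F
  /-- the coefficient of `x` -/
  g : F
  /-- four lines through the point at infinity -/
  c : Fin 4 → F
  /-- the `x`-coordinates of the preimages -/
  x : Fin 10 → Bool → F
  /-- the `y`-coordinates of the points -/
  Y : Fin 10 → F
  Δ_ne_zero : (curve b g).Δ ≠ 0
  g_ne_zero : g ≠ 0
  x_mul : ∀ i, x i true * x i false = g
  eqn : ∀ i, Y i ^ 2 + (x i true + x i false) * Y i =
    (x i true + x i false + b) * ((x i true + x i false) ^ 2 - 4 * g) - g
  ne_zero : ∀ i, 2 * Y i + (x i true + x i false) ≠ 0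
  inj : Function.Injective fun i => (x i true + x i false, Y i)
  -- At such points ρ₁ and ρ₂ agree: at a preimage (x, y) the second factor is (x - g/x)(x - g/x + 1
  -- + 2y/x), and ρ₁ - ρ₂ is a multiple of x² - g + x + 2y.
  incidence : ∀ i, (∏ k, (x i true + x i false - c k)) *
    ((x i true + x i false) ^ 2 + (x i true + x i false) + 2 * Y i - 4 * g) = 0
  -- This makes the right side of the equation of E equal to x(x - u)(x - v), with u, v the two
  -- x-coordinates over the point 0, and the next condition selects the preimage (u, 0).
  b_eq : b = -(x 0 true + x 0 false)
  Y_zero : Y 0 = - x 0 false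

/-- Solving Y = y - gy/x² - g/x for y, with g = x x', gives this y-coordinate. -/
theorem lift_eqn {F : Type*} [Field F] {x x' Y b : F} (hne : x ≠ x')
    (h : Y ^ 2 + (x + x') * Y = (x + x' + b) * ((x + x') ^ 2 - 4 * (x * x')) - x * x') :
    (x * (Y + x') / (x - x')) ^ 2 + x * (x * (Y + x') / (x - x')) =
      x ^ 3 + b * x ^ 2 + (x * x') * x := by
  have : x - x' ≠ 0 := sub_ne_zero.2 hne
  field_simp
  linear_combination x ^ 2 * h

namespace TenPoints

variable {F : Type*} [Field F] (D : TenPoints F)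

/-- The `x`-coordinate of the `i`-th point. -/
def X (i : Fin 10) : F := D.x i true + D.x i false

theorem X_eq (i : Fin 10) (s : Bool) : D.X i = D.x i s + D.x i (!s) := by
  cases s <;> simp [X, add_comm]

theorem x_mul' (i : Fin 10) (s : Bool) : D.x i s * D.x i (!s) = D.g := by
  cases s <;> simp [← D.x_mul i, mul_comm]

theorem x_ne_zero (i : Fin 10) (s : Bool) : D.x i s ≠ 0 := fun h => D.g_ne_zero (by
  rw [← D.x_mul' i s, h, zero_mul])

/-- The equation of the cubic says (2Y + X)² = (X² - 4g)(1 + 4(X + b)), and X² - 4g is the square of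
the difference of the two x-coordinates. -/
theorem x_ne (i : Fin 10) (s : Bool) : D.x i s ≠ D.x i (!s) := by
  intro h
  have h1 := D.eqn i
  have h2 := D.ne_zero i
  have h3 := D.x_mul' i s
  have h4 := D.X_eq i s
  simp only [X] at h4
  rw [h4] at h1 h2
  rw [← h] at h1 h2 h3
  apply h2
  rw [← pow_eq_zero_iff two_ne_zero]
  linear_combination 4 * h1 + 4 * (4 * (D.x i s + D.x i s + D.b) + 1) * h3

theorem x_sub_ne_zero (i : Fin 10) (s : Bool) : D.x i s - D.x i (!s) ≠ 0 :=
  sub_ne_zero.2 (D.x_ne i s)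

/-- The `y`-coordinates of the preimages. -/
noncomputable def y (i : Fin 10) (s : Bool) : F :=
  D.x i s * (D.Y i + D.x i (!s)) / (D.x i s - D.x i (!s))

/-- The elliptic curve. -/
abbrev W : WeierstrassCurve.Affine F := curve D.b D.g

theorem equation_iff {x y : F} : D.W.Equation x y ↔
    y ^ 2 + x * y = x ^ 3 + D.b * x ^ 2 + D.g * x := by
  rw [WeierstrassCurve.Affine.equation_iff]
  have h1 : D.W.a₁ = 1 := rfl
  have h2 : D.W.a₂ = D.b := rfl
  have h3 : D.W.a₃ = 0 := rfl
  have h4 : D.W.a₄ = D.g := rfl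
  have h6 : D.W.a₆ = 0 := rfl
  rw [h1, h2, h3, h4, h6]
  simp

theorem negY_eq {x y : F} : D.W.negY x y = -y - x := by
  have h1 : D.W.a₁ = 1 := rfl
  have h3 : D.W.a₃ = 0 := rfl
  simp [WeierstrassCurve.Affine.negY, h1, h3]

theorem nonsingular {x y : F} (h : D.W.Equation x y) : D.W.Nonsingular x y :=
  (WeierstrassCurve.Affine.equation_iff_nonsingular_of_Δ_ne_zero D.Δ_ne_zero).1 h

theorem equation_zero : D.W.Equation 0 0 := by
  rw [equation_iff]; ring

theorem equation (i : Fin 10) (s : Bool) : D.W.Equation (D.x i s) (D.y i s) := by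
  rw [equation_iff, ← D.x_mul' i s]
  refine lift_eqn (D.x_ne i s) ?_
  have := D.eqn i
  rwa [← X, D.X_eq i s, ← D.x_mul' i s] at this

theorem xy_injective : Function.Injective fun p : Fin 10 × Bool => (D.x p.1 p.2, D.y p.1 p.2) := by
  rintro ⟨i, s⟩ ⟨j, t⟩ h
  simp only [Prod.mk.injEq] at h
  obtain ⟨h1, h2⟩ := h
  have h3 : D.x i (!s) = D.x j (!t) := by
    have := D.x_mul' i s
    rw [← D.x_mul' j t, h1] at this
    exact mul_left_cancel₀ (D.x_ne_zero j t) this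
  have h4 : D.Y i = D.Y j := by
    rw [y, y, h1, h3] at h2
    have h5 := D.x_sub_ne_zero j t
    have h6 := D.x_ne_zero j t
    field_simp at h2
    linear_combination h2
  have hij : i = j := D.inj (by
    simp only [Prod.mk.injEq]
    refine ⟨?_, h4⟩
    change D.X i = D.X j
    rw [D.X_eq i s, D.X_eq j t, h1, h3])
  subst hij
  congr 1
  by_contra hst
  have : t = !s := by cases s <;> cases t <;> simp_all
  rw [this] at h1
  exact D.x_ne i s h1

/-- The speed at which the `i`-th point moves, up to a factor. -/
noncomputable def speed (i : Fin 10) : F :=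
  (∏ k, (D.X i - D.c k)) * (D.x i true + (D.Y i + D.x i false) / (D.x i true - D.x i false))

/-- The velocity must not depend on the chosen preimage. On the four lines it is zero; elsewhere
`incidence` equates the two expressions. -/
theorem speed_eq (i : Fin 10) (s : Bool) : D.speed i =
    (∏ k, (D.X i - D.c k)) * (D.x i s + (D.Y i + D.x i (!s)) / (D.x i s - D.x i (!s))) := by
  cases s
  · have h := D.incidence i
    rw [← X] at h
    have h1 := D.x_sub_ne_zero i true
    have h2 := D.x_sub_ne_zero i false
    have h3 := D.x_mul i
    simp only [Bool.not_true, Bool.not_false] at h1 h2 ⊢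
    rw [speed]
    rcases mul_eq_zero.1 h with h0 | h0
    · rw [h0]; simp
    · congr 1
      rw [X] at h0
      rw [← neg_sub (D.x i true)]
      field_simp
      linear_combination h0 - 4 * h3
  · rfl

theorem prod_eq (i : Fin 10) (s : Bool) :
    ∏ k, (D.x i s ^ 2 - D.c k * D.x i s + D.g) = D.x i s ^ 4 * ∏ k, (D.X i - D.c k) := by
  have : ∀ k, D.x i s ^ 2 - D.c k * D.x i s + D.g = D.x i s * (D.X i - D.c k) := fun k => by
    rw [D.X_eq i s, ← D.x_mul' i s]; ring
  simp_rw [this, Finset.prod_mul_distrib]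
  simp

theorem rho_one_eq (i : Fin 10) (s : Bool) :
    (D.x i s ^ 3 + D.x i s * D.y i s) * ∏ k, (D.x i s ^ 2 - D.c k * D.x i s + D.g) =
      D.speed i * D.x i s ^ 6 := by
  rw [prod_eq, D.speed_eq i s, y]
  have := D.x_sub_ne_zero i s
  field_simp

/-- Translation by (0, 0) sends x to g/x and y to -gy/x² - g/x. It exchanges the two functions
divided by x⁶, so this is the preceding value read at the other preimage. -/
theorem rho_two_eq (i : Fin 10) (s : Bool) :
    (D.g * D.x i s - D.x i s * D.y i s - D.x i s ^ 2) *
      ∏ k, (D.x i s ^ 2 - D.c k * D.x i s + D.g) = D.speed i * D.x i s ^ 6 := by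
  rw [prod_eq, D.speed_eq i s, y, ← D.x_mul' i s]
  have h1 := D.x_sub_ne_zero i s
  have h := D.incidence i
  rw [← X] at h
  rcases mul_eq_zero.1 h with h0 | h0
  · rw [h0]; simp
  · rw [D.X_eq i s, ← D.x_mul' i s] at h0
    field_simp
    linear_combination (-(D.x i s ^ 6 * ∏ k, (D.X i - D.c k))) * h0

end TenPoints

end BlowUpPlane

/-! ### Functions on the elliptic curve and relations between their zeros -/

namespace BlowUpPlane

open WeierstrassCurve.Affine.CoordinateRing WeierstrassCurve.Affine

namespace TenPoints

variable {F : Type*} [Field F] (D : TenPoints F)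

/-- The ring of regular functions on the affine elliptic curve. -/
abbrev A : Type _ := Fun D.b D.g

/-- The coordinate function `x`. -/
noncomputable abbrev fx : D.A := coordX D.W

/-- The coordinate function `y`. -/
noncomputable abbrev fy : D.A := coordY D.W

/-- A function that vanishes at the preimages of the points on the four given lines. -/
noncomputable def lines : D.A :=
  ∏ k, (D.fx ^ 2 - algebraMap F _ (D.c k) * D.fx + algebraMap F _ D.g)

/-- The first of two conjugate functions that agree at the preimages of the points. -/
noncomputable def rho₁ : D.A := (D.fx ^ 3 + D.fx * D.fy) * D.lines

/-- The second of two conjugate functions that agree at the preimages of the points. -/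
noncomputable def rho₂ : D.A :=
  (algebraMap F _ D.g * D.fx - D.fx * D.fy - D.fx ^ 2) * D.lines

/-- The ideal of the point `(0, 0)`. -/
noncomputable def I₀ : Ideal D.A := XYIdeal D.W 0 (Polynomial.C 0)

/-- The ideals of the preimages of the points. -/
noncomputable def I (i : Fin 10) (s : Bool) : Ideal D.A :=
  XYIdeal D.W (D.x i s) (Polynomial.C (D.y i s))

theorem mem_I {i : Fin 10} {s : Bool} {f : D.A} :
    f ∈ D.I i s ↔ evalAt (D.equation i s) f = 0 :=
  mem_XYIdeal_iff _

theorem mem_I₀ {f : D.A} : f ∈ D.I₀ ↔ evalAt D.equation_zero f = 0 :=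
  mem_XYIdeal_iff _

theorem evalAt_lines {x y : F} (h : D.W.Equation x y) :
    evalAt h D.lines = ∏ k, (x ^ 2 - D.c k * x + D.g) := by
  simp [lines, fx]

theorem evalAt_rho₁ (i : Fin 10) (s : Bool) :
    evalAt (D.equation i s) D.rho₁ = D.speed i * D.x i s ^ 6 := by
  rw [← rho_one_eq, rho₁, map_mul, evalAt_lines]
  simp [fx, fy]

theorem evalAt_rho₂ (i : Fin 10) (s : Bool) :
    evalAt (D.equation i s) D.rho₂ = D.speed i * D.x i s ^ 6 := by
  rw [← rho_two_eq, rho₂, map_mul, evalAt_lines]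
  simp [fx, fy]

theorem fy_mem : D.fy ∈ D.I₀ := by simp [mem_I₀, fy]

theorem fx_mem' : D.fx ∈ D.I₀ := by simp [mem_I₀, fx]

/-- As g ≠ 0, the equation of the curve expresses x through products of two functions vanishing at
the origin. -/
theorem fx_mem : D.fx ∈ D.I₀ ^ 2 := by
  have h := coordY_sq D.b D.g
  have hg : algebraMap F D.A D.g⁻¹ * algebraMap F D.A D.g = 1 := by
    rw [← map_mul, inv_mul_cancel₀ D.g_ne_zero, map_one]
  have : D.fx = algebraMap F D.A D.g⁻¹ * (D.fy * D.fy + D.fx * D.fy -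
      D.fx * D.fx * D.fx - algebraMap F _ D.b * (D.fx * D.fx)) := by
    linear_combination (-D.fx) * hg - algebraMap F D.A D.g⁻¹ * h
  rw [this]
  have h1 := D.fy_mem
  have h2 := D.fx_mem'
  rw [sq]
  exact Ideal.mul_mem_left _ _ (sub_mem (sub_mem (add_mem (Ideal.mul_mem_mul h1 h1)
    (Ideal.mul_mem_mul h2 h1)) (Ideal.mul_mem_right _ _ (Ideal.mul_mem_mul h2 h2)))
    (Ideal.mul_mem_left _ _ (Ideal.mul_mem_mul h2 h2)))

theorem rho₁_mem : D.rho₁ ∈ D.I₀ ^ 3 := by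
  refine Ideal.mul_mem_right _ _ (add_mem (Ideal.pow_mem_pow D.fx_mem' 3) ?_)
  rw [pow_succ]
  exact Ideal.mul_mem_mul D.fx_mem D.fy_mem

theorem rho₂_mem : D.rho₂ ∈ D.I₀ ^ 2 :=
  Ideal.mul_mem_right _ _ (sub_mem (sub_mem (Ideal.mul_mem_left _ _ D.fx_mem)
    (Ideal.mul_mem_right _ _ D.fx_mem)) (Ideal.pow_mem_pow D.fx_mem' 2))

theorem quotientMap_mem (j : Fin 3) : quotientMap D.b D.g j ∈ D.I₀ := by
  rw [mem_I₀]
  fin_cases j <;> simp [quotientMap]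

theorem evalAt_quotientMap (i : Fin 10) (s : Bool) (j : Fin 3) :
    evalAt (D.equation i s) (quotientMap D.b D.g j) = D.x i s ^ 2 * ![D.X i, D.Y i, 1] j := by
  have h1 := D.x_mul' i s
  have h2 := D.x_sub_ne_zero i s
  have h3 := D.X_eq i s
  fin_cases j
  · simp [quotientMap]
    rw [← h1, h3]
    ring
  · simp [quotientMap]
    rw [← h1, y]
    field_simp
    ring
  · simp [quotientMap]

theorem poleOrder_le_of_eq {f : D.A} (p q : Polynomial F)
    (h : f = algebraMap (Polynomial F) _ p + algebraMap (Polynomial F) _ q * coordY D.W) {m : ℕ}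
    {k : ℕ} (hp : p.degree ≤ m) (hq : q.degree ≤ k) : poleOrder f ≤ (max (2 * m) (2 * k + 3) : ℕ) := by
  rw [h, poleOrder_smul_basis]
  refine max_le ((nsmul_le_nsmul_right hp 2).trans ?_) ?_
  · rw [two_nsmul]
    have : ((m : WithBot ℕ) + m) = ((2 * m : ℕ) : WithBot ℕ) := by push_cast; ring
    rw [this]
    exact_mod_cast le_max_left _ _
  · have h3 := nsmul_le_nsmul_right hq 2
    calc 2 • q.degree + 3 ≤ 2 • (k : WithBot ℕ) + 3 := by gcongr
      _ ≤ _ := by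
        rw [two_nsmul]
        have : ((k : WithBot ℕ) + k + 3) = ((2 * k + 3 : ℕ) : WithBot ℕ) := by push_cast; ring
        rw [this]
        exact_mod_cast le_max_right _ _

theorem lines_eq : D.lines = algebraMap (Polynomial F) _
    (∏ k, (Polynomial.X ^ 2 - Polynomial.C (D.c k) * Polynomial.X + Polynomial.C D.g)) := by
  rw [lines, map_prod]
  refine Finset.prod_congr rfl fun k _ => ?_
  rw [map_add, map_sub, map_mul, map_pow, ← algebraMap_eq_C, ← algebraMap_eq_C, ← coordX_eq]

theorem monic_lines :
    (∏ k, (Polynomial.X ^ 2 - Polynomial.C (D.c k) * Polynomial.X + Polynomial.C D.g)).Monic :=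
  Polynomial.monic_prod_of_monic _ _ fun k _ => by monicity!

theorem lines_ne_zero : D.lines ≠ 0 := by
  rw [lines_eq]
  intro h
  exact D.monic_lines.ne_zero (algebraMap_injective (W := D.W) (by rw [h, map_zero]))

theorem poleOrder_lines : poleOrder D.lines ≤ (16 : ℕ) := by
  refine (D.poleOrder_le_of_eq
    (∏ k, (Polynomial.X ^ 2 - Polynomial.C (D.c k) * Polynomial.X + Polynomial.C D.g)) 0
    (by rw [lines_eq, map_zero, zero_mul, add_zero]) (m := 8) (k := 0) ?_ (by simp)).trans (by norm_num)
  rw [Polynomial.degree_prod]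
  refine (Finset.sum_le_card_nsmul _ _ 2 fun k _ => ?_).trans (by rfl)
  compute_degree

theorem poleOrder_rho₁ : poleOrder D.rho₁ ≤ (22 : ℕ) := by
  rw [rho₁, poleOrder_mul]
  refine (add_le_add (D.poleOrder_le_of_eq (Polynomial.X ^ 3) Polynomial.X (m := 3) (k := 1)
    ?_ (by compute_degree!) (by compute_degree!)) D.poleOrder_lines).trans (by norm_num)
  rw [map_pow, ← coordX_eq]

theorem poleOrder_rho₂ : poleOrder D.rho₂ ≤ (21 : ℕ) := by
  rw [rho₂, poleOrder_mul]
  refine (add_le_add (D.poleOrder_le_of_eq (Polynomial.C D.g * Polynomial.X - Polynomial.X ^ 2)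
    (-Polynomial.X) (m := 2) (k := 1) ?_ (by compute_degree!) (by compute_degree!))
    D.poleOrder_lines).trans (by norm_num)
  rw [map_sub, map_mul, map_pow, map_neg, ← coordX_eq, ← algebraMap_eq_C]
  ring

/-- This function gives the relation between the preimages, and its being nonzero makes `T` and `V`
independent. The factor x² + x - g + 2y is nonzero even in characteristic 2, because its part in x
is monic. -/
theorem rho₁_sub_rho₂_ne_zero : D.rho₁ - D.rho₂ ≠ 0 := by
  have h : D.rho₁ - D.rho₂ = D.fx * (algebraMap (Polynomial F) _
      (Polynomial.X ^ 2 + Polynomial.X - Polynomial.C D.g) +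
      algebraMap (Polynomial F) _ (Polynomial.C 2) * coordY D.W) * D.lines := by
    rw [rho₁, rho₂, map_sub, map_add, map_pow, ← coordX_eq, ← algebraMap_eq_C,
      ← algebraMap_eq_C, map_ofNat]
    ring
  have hx : D.fx ≠ 0 := fun h => by
    have := poleOrder_coordX (W := D.W)
    rw [show coordX D.W = 0 from h, poleOrder_zero] at this
    exact absurd this (by decide)
  rw [h]
  refine mul_ne_zero (mul_ne_zero hx fun h0 => ?_) D.lines_ne_zero
  have h1 := poleOrder_smul_basis (W := D.W) (Polynomial.X ^ 2 + Polynomial.X - Polynomial.C D.g)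
    (Polynomial.C 2)
  have h2 : (Polynomial.X ^ 2 + Polynomial.X - Polynomial.C D.g).degree = 2 := by
    compute_degree!
  rw [h0, poleOrder_zero, h2, eq_comm, max_eq_bot] at h1
  exact absurd h1.1 (by decide)

theorem y_zero_true : D.y 0 true = 0 := by
  rw [y, D.Y_zero]
  simp

theorem y_zero_false : D.y 0 false = -D.x 0 false := by
  have := D.x_sub_ne_zero 0 false
  simp only [Bool.not_false] at this
  rw [y, D.Y_zero]
  simp only [Bool.not_false]
  field_simp
  ring

variable [DecidableEq F]

/-- The preimages of the points. -/
noncomputable def P (i : Fin 10) (s : Bool) : D.W.Point := Point.some _ _ (D.nonsingular (D.equation i s))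

/-- The point `(0, 0)` of order two. -/
noncomputable def P₀ : D.W.Point := Point.some _ _ (D.nonsingular D.equation_zero)

theorem sum_P_eq_zero {a : ℕ} {e : Fin 10 → ℕ} {f : D.A} (hf : f ≠ 0) (h₀ : f ∈ D.I₀ ^ a)
    (h : ∀ i s, f ∈ D.I i s ^ e i) (hdeg : poleOrder f ≤ (a + 2 * ∑ i, e i : ℕ)) :
    a • D.P₀ + ∑ i, e i • (D.P i true + D.P i false) = 0 := by
  have := sum_smul_eq_zero_of_mem_pow (W := D.W) (ι := Option (Fin 10 × Bool))
    (x := fun o => o.elim 0 fun p => D.x p.1 p.2) (y := fun o => o.elim 0 fun p => D.y p.1 p.2)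
    (by
      rintro (_ | ⟨i, s⟩)
      · exact D.nonsingular D.equation_zero
      · exact D.nonsingular (D.equation i s))
    (by
      rintro (_ | p) (_ | q) h
      · rfl
      · exact absurd (Prod.mk.inj h).1.symm (D.x_ne_zero _ _)
      · exact absurd (Prod.mk.inj h).1 (D.x_ne_zero _ _)
      · exact congrArg some (D.xy_injective h))
    (fun o => o.elim a fun p => e p.1) hf
    (by
      rintro (_ | ⟨i, s⟩)
      · exact h₀
      · exact h i s)
    (hdeg.trans (by
      rw [Fintype.sum_option, Fintype.sum_prod_type]
      simp [Finset.mul_sum, two_mul]))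
  rw [Fintype.sum_option, Fintype.sum_prod_type] at this
  simp only [Fintype.sum_bool, Option.elim] at this
  simp only [smul_add]
  exact this

theorem two_smul_P₀ : 2 • D.P₀ = 0 := by
  have := D.sum_P_eq_zero (a := 2) (e := fun _ => 0) (f := D.fx) ?_ D.fx_mem (by simp) ?_
  · simpa using this
  · intro h
    have := poleOrder_coordX (W := D.W)
    rw [show coordX D.W = 0 from h, poleOrder_zero] at this
    exact absurd this (by decide)
  · rw [poleOrder_coordX]; simp

/-- The zeros of y are (0, 0), (u, 0) and (v, 0), by the choice of `b`; their sum is zero, and `D.P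
0 false` is the negative of (v, 0). -/
theorem P_zero_false : D.P 0 false = D.P₀ + D.P 0 true := by
  have he : D.W.Equation (D.x 0 false) 0 := by
    rw [equation_iff, D.b_eq, ← D.x_mul 0]; ring
  have hneg : D.P 0 false = -(Point.some _ _ (D.nonsingular he) : D.W.Point) := by
    rw [Point.neg_some, P, Point.some.injEq]
    exact ⟨rfl, by rw [y_zero_false, negY_eq]; ring⟩
  have hy : D.fy ≠ 0 := fun h => by
    have := poleOrder_coordY (W := D.W)
    rw [show coordY D.W = 0 from h, poleOrder_zero] at this
    exact absurd this (by decide)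
  have := sum_smul_eq_zero_of_mem_pow (W := D.W) (ι := Fin 3)
    (x := ![0, D.x 0 true, D.x 0 false]) (y := ![0, D.y 0 true, 0])
    (by
      intro i
      fin_cases i
      · exact D.nonsingular D.equation_zero
      · exact D.nonsingular (D.equation 0 true)
      · exact D.nonsingular he)
    (by
      intro i j h
      have h1 := (Prod.mk.inj h).1
      have a1 := D.x_ne_zero 0 true
      have a2 := D.x_ne_zero 0 false
      have a3 := D.x_ne 0 true
      simp only [Bool.not_true] at a3
      fin_cases i <;> fin_cases j <;> simp_all [eq_comm])
    (fun _ => 1) hy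
    (by
      intro i
      rw [pow_one]
      fin_cases i
      · exact D.fy_mem
      · refine (D.mem_I (i := 0) (s := true)).2 ?_
        simp [fy, y_zero_true]
      · refine (mem_XYIdeal_iff he).2 ?_
        simp [fy])
    (by
      have := poleOrder_coordY (W := D.W)
      rw [poleOrder] at this
      rw [this]; rfl)
  simp only [Fin.sum_univ_three, one_smul] at this
  rw [hneg, eq_comm, eq_neg_iff_add_eq_zero]
  exact this

/-- The function ρ₁ - ρ₂ has at most 22 poles, a double zero at P₀ and zeros at the twenty
preimages. -/
theorem sum_P : ∑ i, (D.P i true + D.P i false) = 0 := by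
  have := D.sum_P_eq_zero (a := 2) (e := fun _ => 1) D.rho₁_sub_rho₂_ne_zero
    (sub_mem (Ideal.pow_le_pow_right (by norm_num) D.rho₁_mem) D.rho₂_mem)
    (fun i s => by
      rw [pow_one, mem_I, map_sub, evalAt_rho₁, evalAt_rho₂, sub_self])
    (by
      rw [sub_eq_add_neg]
      refine (poleOrder_add_le _ _).trans (max_le (D.poleOrder_rho₁.trans (by simp)) ?_)
      rw [poleOrder_neg]
      exact D.poleOrder_rho₂.trans (by simp; decide))
  rw [D.two_smul_P₀, zero_add] at this
  simpa only [one_smul] using this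

/-- If there are functions with too many zeros, then one of the points is a torsion point. -/
theorem smul_P_eq_zero {n a : ℕ} {f : D.A} (hf : f ≠ 0) (h₀ : f ∈ D.I₀ ^ a)
    (h : ∀ i s, f ∈ D.I i s ^ (n * mult i)) (hdeg : poleOrder f ≤ (a + 82 * n : ℕ)) :
    (4 * n) • D.P 0 true = 0 := by
  have h1 := D.sum_P_eq_zero hf h₀ h (hdeg.trans (by
    rw [← Finset.mul_sum, show ∑ i, mult i = 41 by decide]
    exact_mod_cast (by omega : a + 82 * n ≤ a + 2 * (n * 41))))
  -- The common multiplicity 4n drops out by `sum_P`; only the excess n at the point 0 contributes.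
  have h2 : ∀ i : Fin 10, (n * mult i) • (D.P i true + D.P i false) =
      (4 * n) • (D.P i true + D.P i false) +
        if i = 0 then n • (D.P i true + D.P i false) else 0 := by
    intro i
    rw [mult]
    split_ifs
    · rw [← add_smul]; congr 1; ring
    · rw [add_zero, mul_comm]
  simp_rw [h2] at h1
  rw [Finset.sum_add_distrib, ← Finset.smul_sum, D.sum_P, smul_zero, zero_add,
    Finset.sum_ite_eq' Finset.univ 0, if_pos (Finset.mem_univ _), D.P_zero_false] at h1
  have h3 := D.two_smul_P₀
  -- Doubling the relation removes the multiples of P₀, whatever `a` is.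
  have h4 : (4 * n) • D.P 0 true + (a + n) • (2 • D.P₀) =
      2 • (a • D.P₀ + n • (D.P 0 true + (D.P₀ + D.P 0 true))) := by
    module
  rw [h1, h3, smul_zero, smul_zero, add_zero] at h4
  exact h4

end TenPoints

end BlowUpPlane

/-! ### Deforming the quotient map along the moving points -/

namespace BlowUpPlane

open WeierstrassCurve.Affine.CoordinateRing WeierstrassCurve.Affine

namespace TenPoints

variable {F : Type*} [Field F] (D : TenPoints F)

/-- A partial derivative of the cubic along the curve. -/
noncomputable def U : D.A := 2 * quotientMap D.b D.g 1 * quotientMap D.b D.g 2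
  + quotientMap D.b D.g 0 * quotientMap D.b D.g 2

/-- The deformation parameter as a function of an auxiliary parameter. -/
noncomputable def T : Polynomial D.A := 1 + Polynomial.X

/-- The normal displacement as a function of an auxiliary parameter. -/
noncomputable def V : Polynomial D.A :=
  Polynomial.C D.rho₁ + Polynomial.C D.rho₂ * Polynomial.X

/-- The substitution for the deformation parameter. -/
noncomputable def φ : Polynomial F →+* Polynomial (Polynomial D.A) :=
  Polynomial.eval₂RingHom ((Polynomial.C.comp Polynomial.C).comp (algebraMap F D.A))
    (Polynomial.X * Polynomial.C (Polynomial.C D.U * D.T))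

theorem φ_C (a : F) : D.φ (Polynomial.C a) =
    Polynomial.C (Polynomial.C (algebraMap F D.A a)) := by simp [φ]

theorem φ_X : D.φ Polynomial.X = Polynomial.X * Polynomial.C (Polynomial.C D.U * D.T) := by
  simp [φ]

/-- A first order deformation of the quotient map. -/
noncomputable def arc : Fin 3 → Polynomial (Polynomial D.A) :=
  ![Polynomial.C (Polynomial.C (quotientMap D.b D.g 0)),
    Polynomial.C (Polynomial.C (quotientMap D.b D.g 1)) + Polynomial.X * Polynomial.C D.V,
    Polynomial.C (Polynomial.C (quotientMap D.b D.g 2))]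

/-- The pullback of forms along the deformed quotient map. -/
noncomputable def Φ : MvPolynomial (Fin 3) (Polynomial F) →+* Polynomial (Polynomial D.A) :=
  eval₂Hom D.φ D.arc

/-- The moving points. -/
noncomputable def pt (i : Fin 10) : Fin 3 → Polynomial F :=
  ![Polynomial.C (D.X i),
    Polynomial.C (D.Y i) + Polynomial.C (D.speed i / (2 * D.Y i + D.X i)) * Polynomial.X, 1]

theorem evalAt_U (i : Fin 10) (s : Bool) :
    evalAt (D.equation i s) D.U = D.x i s ^ 4 * (2 * D.Y i + D.X i) := by
  rw [U]
  simp only [map_add, map_mul, map_ofNat, evalAt_quotientMap, Matrix.cons_val]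
  ring

theorem U_notMem (i : Fin 10) (s : Bool) : D.U ∉ D.I i s := by
  rw [mem_I, evalAt_U]
  exact mul_ne_zero (pow_ne_zero _ (D.x_ne_zero i s)) (D.ne_zero i)

/-- Modulo the ideal of a preimage, `arc` is the moving point scaled by x². Indeed both ρ's have the
value speed·x⁶ there, so `V` becomes speed·x⁶·`T`, and the factor `U` in the substitution for t
cancels the denominator of the velocity. Taylor's formula then applies. -/
theorem Φ_mem {G : MvPolynomial (Fin 3) (Polynomial F)} {d e : ℕ} (hG : G.IsHomogeneous d)
    (i : Fin 10) (h : VanishesAt G (D.pt i) e) (s : Bool) (m l : ℕ) :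
    ((D.Φ G).coeff m).coeff l ∈ D.I i s ^ e := by
  have key := VanishesAt.eval₂Hom_mem_pow D.φ hG h
    (Polynomial.C (Polynomial.C (quotientMap D.b D.g 2)))
    (h := fun j => D.arc j - Polynomial.C (Polynomial.C (quotientMap D.b D.g 2)) * D.φ (D.pt i j))
    (I := ((D.I i s).map Polynomial.C).map Polynomial.C) (by
      have hC : ∀ f ∈ D.I i s, Polynomial.C (Polynomial.C f) ∈
          ((D.I i s).map Polynomial.C).map Polynomial.C := fun f hf =>
        Ideal.mem_map_of_mem _ (Ideal.mem_map_of_mem _ hf)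
      have hne : 2 * D.Y i + D.X i ≠ 0 := D.ne_zero i
      intro j
      fin_cases j
      · have : D.arc 0 - Polynomial.C (Polynomial.C (quotientMap D.b D.g 2)) * D.φ (D.pt i 0) =
            Polynomial.C (Polynomial.C (quotientMap D.b D.g 0 -
              quotientMap D.b D.g 2 * algebraMap F _ (D.X i))) := by
          simp [arc, pt, φ_C]
        change D.arc 0 - _ * D.φ (D.pt i 0) ∈ _
        rw [this]
        refine hC _ (D.mem_I.2 ?_)
        simp [evalAt_quotientMap]
      · set w := D.speed i / (2 * D.Y i + D.X i) with hw
        have : D.arc 1 - Polynomial.C (Polynomial.C (quotientMap D.b D.g 2)) * D.φ (D.pt i 1) =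
            Polynomial.C (Polynomial.C (quotientMap D.b D.g 1 -
              quotientMap D.b D.g 2 * algebraMap F _ (D.Y i))) +
            Polynomial.X * (Polynomial.C (Polynomial.C
              (D.rho₁ - quotientMap D.b D.g 2 * algebraMap F _ w * D.U)) +
            Polynomial.C Polynomial.X * Polynomial.C (Polynomial.C
              (D.rho₂ - quotientMap D.b D.g 2 * algebraMap F _ w * D.U))) := by
          simp only [arc, pt, Matrix.cons_val, map_add, map_sub, map_mul, φ_C, φ_X, V, T, ← hw,
            map_one]
          ring
        change D.arc 1 - _ * D.φ (D.pt i 1) ∈ _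
        rw [this]
        have hz : D.x i s ^ 2 * w * (D.x i s ^ 4 * (2 * D.Y i + D.X i)) =
            D.speed i * D.x i s ^ 6 := by
          rw [hw]; field_simp
        refine add_mem (hC _ (D.mem_I.2 ?_)) (Ideal.mul_mem_left _ _ (add_mem
          (hC _ (D.mem_I.2 ?_)) (Ideal.mul_mem_left _ _ (hC _ (D.mem_I.2 ?_)))))
        · simp [evalAt_quotientMap]
        · simp only [map_sub, map_mul, evalAt_rho₁, evalAt_quotientMap, evalAt_U,
            evalAt_algebraMap, Matrix.cons_val, mul_one, hz, sub_self]
        · simp only [map_sub, map_mul, evalAt_rho₂, evalAt_quotientMap, evalAt_U,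
            evalAt_algebraMap, Matrix.cons_val, mul_one, hz, sub_self]
      · change D.arc 2 - _ * D.φ (D.pt i 2) ∈ _
        simp [arc, pt])
  have h1 : (fun j => Polynomial.C (Polynomial.C (quotientMap D.b D.g 2)) * D.φ (D.pt i j) +
      (D.arc j - Polynomial.C (Polynomial.C (quotientMap D.b D.g 2)) * D.φ (D.pt i j))) =
      D.arc := by
    funext j; ring
  rw [h1, ← Ideal.map_pow, ← Ideal.map_pow, Ideal.mem_map_C_iff] at key
  exact Ideal.mem_map_C_iff.1 (key m) l

theorem Φ_X : D.Φ (C Polynomial.X) = Polynomial.X * Polynomial.C (Polynomial.C D.U * D.T) := by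
  rw [Φ, eval₂Hom_C, φ_X]

/-- Taylor expansion in the second coordinate, whose partial derivative is `U`. Together with `Φ_X`
it shows that t and the cubic have the leading terms `U * T` and `U * V`. -/
theorem Φ_cubic : D.Φ (map Polynomial.C (cubic D.b D.g)) = Polynomial.X *
    (Polynomial.C (Polynomial.C D.U * D.V) +
      Polynomial.X * Polynomial.C (D.V ^ 2 * Polynomial.C (quotientMap D.b D.g 2))) := by
  have h := congrArg (fun f => Polynomial.C (Polynomial.C f)) (cubic_quotientMap D.b D.g)
  simp only [cubic, map_add, map_sub, map_mul, map_pow, aeval_X, algHom_C, map_zero] at h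
  simp only [cubic, map_add, map_sub, map_mul, map_pow, map_X, map_C, Φ, eval₂Hom_X', eval₂Hom_C,
    φ_C, arc, Matrix.cons_val, U]
  have h2 : (Polynomial.C (Polynomial.C 2) : Polynomial (Polynomial D.A)) = 2 := by
    rw [map_ofNat, map_ofNat]
  rw [h2]
  linear_combination h

theorem eval_Φ (G : MvPolynomial (Fin 3) (Polynomial F)) : (D.Φ G).eval 0 =
    Polynomial.C (aeval (quotientMap D.b D.g) (map (Polynomial.evalRingHom 0) G)) := by
  have : (Polynomial.evalRingHom 0).comp D.Φ = (Polynomial.C.comp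
      (aeval (quotientMap D.b D.g) : _ →ₐ[F] D.A).toRingHom).comp
        (map (Polynomial.evalRingHom 0)) := by
    refine MvPolynomial.ringHom_ext (fun r => ?_) fun j => ?_
    · induction r using Polynomial.induction_on' with
      | add p q hp hq => simp only [map_add, hp, hq]
      | monomial k a =>
        rw [← Polynomial.C_mul_X_pow_eq_monomial]
        simp only [map_mul, map_pow, RingHom.comp_apply, Φ_X]
        simp [Φ, φ_C]
    · fin_cases j <;> simp [Φ, arc]
  exact RingHom.congr_fun this G

/-- The leading form of an expansion in powers of the cubic and the deformation parameter. -/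
noncomputable def leading (m : ℕ) (A : ℕ → MvPolynomial (Fin 3) F) : Polynomial D.A :=
  ∑ j ∈ Finset.range (m + 1), D.T ^ j * D.V ^ (m - j) *
    Polynomial.C (aeval (quotientMap D.b D.g) (A j))

/-- Each summand contains m factors divisible by the outer variable, so the coefficient of order m
sees only their leading terms and the values of the `A j` at t = 0. -/
theorem coeff_Φ_sum (m : ℕ) (A : ℕ → MvPolynomial (Fin 3) (Polynomial F)) :
    (D.Φ (∑ j ∈ Finset.range (m + 1), C Polynomial.X ^ j *
      map Polynomial.C (cubic D.b D.g) ^ (m - j) * A j)).coeff m =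
    Polynomial.C (D.U ^ m) * D.leading m fun j => map (Polynomial.evalRingHom 0) (A j) := by
  have : D.Φ (∑ j ∈ Finset.range (m + 1), C Polynomial.X ^ j *
      map Polynomial.C (cubic D.b D.g) ^ (m - j) * A j) = Polynomial.X ^ m *
      ∑ j ∈ Finset.range (m + 1), (Polynomial.C (Polynomial.C D.U * D.T)) ^ j *
        (Polynomial.C (Polynomial.C D.U * D.V) + Polynomial.X *
          Polynomial.C (D.V ^ 2 * Polynomial.C (quotientMap D.b D.g 2))) ^ (m - j) *
        D.Φ (A j) := by
    rw [map_sum, Finset.mul_sum]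
    refine Finset.sum_congr rfl fun j hj => ?_
    rw [Finset.mem_range] at hj
    rw [map_mul, map_mul, map_pow, map_pow, Φ_X, Φ_cubic, mul_pow, mul_pow]
    have : (Polynomial.X : Polynomial (Polynomial D.A)) ^ m =
        Polynomial.X ^ j * Polynomial.X ^ (m - j) := by
      rw [← pow_add]; congr 1; omega
    rw [this]
    ring
  rw [this]
  have h := Polynomial.coeff_X_pow_mul (∑ j ∈ Finset.range (m + 1),
    (Polynomial.C (Polynomial.C D.U * D.T)) ^ j *
        (Polynomial.C (Polynomial.C D.U * D.V) + Polynomial.X *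
          Polynomial.C (D.V ^ 2 * Polynomial.C (quotientMap D.b D.g 2))) ^ (m - j) *
        D.Φ (A j)) m 0
  rw [zero_add] at h
  rw [h, Polynomial.coeff_zero_eq_eval_zero, Polynomial.eval_finsetSum, leading, Finset.mul_sum]
  refine Finset.sum_congr rfl fun j hj => ?_
  rw [Finset.mem_range] at hj
  rw [Polynomial.eval_mul, Polynomial.eval_mul, Polynomial.eval_pow, Polynomial.eval_pow, eval_Φ]
  simp only [Polynomial.eval_C, Polynomial.eval_add, Polynomial.eval_mul, Polynomial.eval_X,
    zero_mul, add_zero]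
  have : (D.U : D.A) ^ m = D.U ^ j * D.U ^ (m - j) := by rw [← pow_add]; congr 1; omega
  rw [this, map_mul, map_pow, map_pow, mul_pow, mul_pow]
  ring

/-- As `U` does not vanish at the point, it is invertible modulo each power of the maximal ideal. -/
theorem mem_of_U_pow_mul_mem {i : Fin 10} {s : Bool} {e m : ℕ} {f : D.A}
    (h : D.U ^ m * f ∈ D.I i s ^ e) : f ∈ D.I i s ^ e := by
  have hc : IsCoprime (Ideal.span {D.U}) (D.I i s) := by
    rw [Ideal.isCoprime_iff_sup_eq]
    refine (XYIdeal_isMaximal (D.equation i s)).1.2 _ (right_lt_sup.2 fun h => ?_)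
    exact D.U_notMem i s (h (Ideal.mem_span_singleton_self _))
  have hc' : IsCoprime (Ideal.span {D.U} ^ m) (D.I i s ^ e) := hc.pow
  rw [Ideal.span_singleton_pow, Ideal.isCoprime_iff_exists] at hc'
  obtain ⟨a, ha, b, hb, hab⟩ := hc'
  obtain ⟨a, rfl⟩ := Ideal.mem_span_singleton.1 ha
  rw [← one_mul f, ← hab, add_mul]
  refine add_mem ?_ (Ideal.mul_mem_right _ _ hb)
  rw [mul_right_comm]
  exact Ideal.mul_mem_right _ _ h

end TenPoints

end BlowUpPlane

/-! ### Counting zeros and poles of the leading form -/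

namespace BlowUpPlane

open WeierstrassCurve.Affine.CoordinateRing WeierstrassCurve.Affine

namespace TenPoints

variable {F : Type*} [Field F] (D : TenPoints F)

theorem poleOrder_aeval_quotientMap_le {e : ℕ} {A : MvPolynomial (Fin 3) F}
    (hA : A.IsHomogeneous e) : poleOrder (aeval (quotientMap D.b D.g) A) ≤ (7 * e : ℕ) := by
  rw [aeval_def, eval₂_eq]
  refine poleOrder_sum_le _ _ fun m hm => ?_
  have he : m.degree = e := by
    rw [← hA (mem_support_iff.1 hm), Finsupp.degree_eq_weight_one]; rfl
  have h := poleOrder_quotientMap_prod D.b D.g m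
  rw [Finsupp.prod] at h
  rw [poleOrder_mul, h]
  refine (add_le_add_left (poleOrder_algebraMap_le _) _).trans ?_
  rw [zero_add, ← he, Finsupp.degree_eq_sum, Fin.sum_univ_three]
  exact_mod_cast (by omega)

theorem aeval_quotientMap_mem {e : ℕ} {A : MvPolynomial (Fin 3) F}
    (hA : A.IsHomogeneous e) : aeval (quotientMap D.b D.g) A ∈ D.I₀ ^ e := by
  rw [aeval_def, eval₂_eq]
  refine sum_mem fun m hm => Ideal.mul_mem_left _ _ ?_
  have he : m.degree = e := by
    rw [← hA (mem_support_iff.1 hm), Finsupp.degree_eq_weight_one]; rfl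
  rw [← he, Finsupp.degree_apply, ← Finset.prod_pow_eq_pow_sum]
  exact Ideal.prod_mem_prod fun i _ => Ideal.pow_mem_pow (D.quotientMap_mem i) _

/-- The sum of the pole order of a coefficient and its index is at most `d`. -/
def HasPoleOrderLE (d : ℕ) (p : Polynomial D.A) : Prop :=
  ∀ l : ℕ, poleOrder (p.coeff l) + l ≤ (d : WithBot ℕ)

/-- The sum of the vanishing order of a coefficient at the origin and its index is at least `d`. -/
def HasOrderGE (d : ℕ) (p : Polynomial D.A) : Prop :=
  ∀ l : ℕ, p.coeff l ∈ D.I₀ ^ (d - l)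

variable {D}

theorem poleOrder_sum_add_le {ι : Type*} (s : Finset ι) (f : ι → D.A) {l d : WithBot ℕ}
    (h : ∀ i ∈ s, poleOrder (f i) + l ≤ d) : poleOrder (∑ i ∈ s, f i) + l ≤ d := by
  refine Finset.sum_induction f (fun f => poleOrder f + l ≤ d) (fun f g hf hg => ?_)
    (by simp) h
  refine (add_le_add_left (poleOrder_add_le f g) l).trans ?_
  rcases max_choice (poleOrder f) (poleOrder g) with h | h <;> rw [h] <;> assumption

theorem HasPoleOrderLE.mul {d e : ℕ} {p q : Polynomial D.A} (hp : D.HasPoleOrderLE d p)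
    (hq : D.HasPoleOrderLE e q) : D.HasPoleOrderLE (d + e) (p * q) := fun l => by
  rw [Polynomial.coeff_mul]
  refine poleOrder_sum_add_le _ _ fun ij hij => ?_
  rw [Finset.HasAntidiagonal.mem_antidiagonal] at hij
  rw [poleOrder_mul, ← hij]
  push_cast
  rw [add_add_add_comm]
  exact add_le_add (hp _) (hq _)

theorem HasPoleOrderLE.pow {d : ℕ} {p : Polynomial D.A} (hp : D.HasPoleOrderLE d p) (n : ℕ) :
    D.HasPoleOrderLE (n * d) (p ^ n) := by
  induction n with
  | zero =>
    intro l
    rw [pow_zero, Polynomial.coeff_one]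
    split_ifs with h
    · simp [h]
    · simp
  | succ n ih =>
    rw [pow_succ, add_mul, one_mul]
    exact ih.mul hp

theorem HasPoleOrderLE.sum {ι : Type*} {s : Finset ι} {d : ℕ} {p : ι → Polynomial D.A}
    (hp : ∀ i ∈ s, D.HasPoleOrderLE d (p i)) : D.HasPoleOrderLE d (∑ i ∈ s, p i) := fun l => by
  rw [Polynomial.finsetSum_coeff]
  exact poleOrder_sum_add_le _ _ fun i hi => hp i hi l

theorem hasPoleOrderLE_C {d : ℕ} {f : D.A} (h : poleOrder f ≤ (d : WithBot ℕ)) :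
    D.HasPoleOrderLE d (Polynomial.C f) := fun l => by
  rw [Polynomial.coeff_C]
  split_ifs with h0
  · simpa [h0] using h
  · simp

theorem hasPoleOrderLE_C_add_C_mul_X {d : ℕ} {f g : D.A} (h : poleOrder f ≤ (d : WithBot ℕ))
    (h' : poleOrder g + 1 ≤ (d : WithBot ℕ)) :
    D.HasPoleOrderLE d (Polynomial.C f + Polynomial.C g * Polynomial.X) := fun l => by
  rcases l with - | - | l
  · simpa using h
  · simpa using h'
  · simp

theorem HasOrderGE.mul {d e : ℕ} {p q : Polynomial D.A} (hp : D.HasOrderGE d p)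
    (hq : D.HasOrderGE e q) : D.HasOrderGE (d + e) (p * q) := fun l => by
  rw [Polynomial.coeff_mul]
  refine sum_mem fun ij hij => ?_
  rw [Finset.HasAntidiagonal.mem_antidiagonal] at hij
  refine Ideal.pow_le_pow_right (n := (d - ij.1) + (e - ij.2)) (by omega) ?_
  rw [pow_add]
  exact Ideal.mul_mem_mul (hp _) (hq _)

theorem hasOrderGE_zero (p : Polynomial D.A) : D.HasOrderGE 0 p := fun l => by simp

theorem HasOrderGE.pow {d : ℕ} {p : Polynomial D.A} (hp : D.HasOrderGE d p) (n : ℕ) :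
    D.HasOrderGE (n * d) (p ^ n) := by
  induction n with
  | zero => rw [zero_mul]; exact hasOrderGE_zero _
  | succ n ih =>
    rw [pow_succ, add_mul, one_mul]
    exact ih.mul hp

theorem HasOrderGE.sum {ι : Type*} {s : Finset ι} {d : ℕ} {p : ι → Polynomial D.A}
    (hp : ∀ i ∈ s, D.HasOrderGE d (p i)) : D.HasOrderGE d (∑ i ∈ s, p i) := fun l => by
  rw [Polynomial.finsetSum_coeff]
  exact sum_mem fun i hi => hp i hi l

theorem hasOrderGE_C {d : ℕ} {f : D.A} (h : f ∈ D.I₀ ^ d) :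
    D.HasOrderGE d (Polynomial.C f) := fun l => by
  rw [Polynomial.coeff_C]
  split_ifs with h0
  · simpa [h0] using h
  · simp

theorem hasPoleOrderLE_T : D.HasPoleOrderLE 1 D.T := by
  have : D.T = Polynomial.C 1 + Polynomial.C 1 * Polynomial.X := by simp [T]
  rw [this]
  exact hasPoleOrderLE_C_add_C_mul_X (by simp) (by simp)

theorem hasPoleOrderLE_V : D.HasPoleOrderLE 22 D.V :=
  hasPoleOrderLE_C_add_C_mul_X D.poleOrder_rho₁
    ((add_le_add_left D.poleOrder_rho₂ 1).trans (by decide))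

theorem hasOrderGE_V : D.HasOrderGE 3 D.V := fun l => by
  rw [V]
  rcases l with - | - | l
  · simpa using D.rho₁_mem
  · simpa using D.rho₂_mem
  · simp

/-- With weights 1 for `T`, 22 for `V` and 7 for each coordinate, j + 22(m - j) + 7(d - 3(m - j)) =
7d + m. -/
theorem hasPoleOrderLE_leading {d m : ℕ} {A : ℕ → MvPolynomial (Fin 3) F}
    (hA : ∀ j ≤ m, A j ∈ formsSub F d (3 * (m - j))) :
    D.HasPoleOrderLE (7 * d + m) (D.leading m A) := by
  refine HasPoleOrderLE.sum fun j hj => ?_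
  rw [Finset.mem_range] at hj
  rcases mem_formsSub.1 (hA j (by omega)) with h | ⟨e, he, hAe⟩
  · intro l
    simp [h]
  · have := ((hasPoleOrderLE_T.pow j).mul (hasPoleOrderLE_V.pow (m - j))).mul
      (hasPoleOrderLE_C (D.poleOrder_aeval_quotientMap_le hAe))
    convert this using 1
    omega

/-- At the origin `V` has weight 3 and each coordinate weight 1, which replaces exactly the degree 3
of the cubic. -/
theorem hasOrderGE_leading {d m : ℕ} {A : ℕ → MvPolynomial (Fin 3) F}
    (hA : ∀ j ≤ m, A j ∈ formsSub F d (3 * (m - j))) :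
    D.HasOrderGE d (D.leading m A) := by
  refine HasOrderGE.sum fun j hj => ?_
  rw [Finset.mem_range] at hj
  rcases mem_formsSub.1 (hA j (by omega)) with h | ⟨e, he, hAe⟩
  · intro l
    simp [h]
  · have := ((hasOrderGE_zero (D.T ^ j)).mul (hasOrderGE_V.pow (m - j))).mul
      (hasOrderGE_C (D.aeval_quotientMap_mem hAe))
    convert this using 1
    omega

theorem T_ne_zero : D.T ≠ 0 := by
  rw [T, add_comm, ← map_one Polynomial.C]
  exact Polynomial.X_add_C_ne_zero 1

/-- At z = -1 the factor `T` vanishes and `V` becomes ρ₁ - ρ₂ ≠ 0, so the term without `T` has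
coefficient zero. Then `T` is cancelled and the argument repeated. -/
theorem eq_zero_of_sum_T_V (m : ℕ) : ∀ a : ℕ → D.A, ∑ j ∈ Finset.range (m + 1),
    D.T ^ j * D.V ^ (m - j) * Polynomial.C (a j) = 0 → ∀ j ≤ m, a j = 0 := by
  induction m with
  | zero =>
    intro a h j hj
    obtain rfl : j = 0 := by omega
    simpa using h
  | succ m ih =>
    intro a h
    have h0 : a 0 = 0 := by
      have := congrArg (Polynomial.eval (-1)) h
      rw [Polynomial.eval_finsetSum, Finset.sum_eq_single 0] at this
      · simp only [T, V, pow_zero, one_mul, tsub_zero, Polynomial.eval_mul, Polynomial.eval_pow,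
          Polynomial.eval_add, Polynomial.eval_C, Polynomial.eval_X, Polynomial.eval_zero, mul_neg,
          mul_one, ← sub_eq_add_neg] at this
        exact (mul_eq_zero.1 this).resolve_left (pow_ne_zero _ D.rho₁_sub_rho₂_ne_zero)
      · intro j _ hj
        simp [T, hj]
      · simp
    rw [Finset.sum_range_succ', h0, map_zero, mul_zero, add_zero] at h
    have h1 : D.T * ∑ j ∈ Finset.range (m + 1),
        D.T ^ j * D.V ^ (m - j) * Polynomial.C (a (j + 1)) = 0 := by
      rw [← h, Finset.mul_sum]
      refine Finset.sum_congr rfl fun j _ => ?_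
      rw [Nat.add_sub_add_right]
      ring
    have h2 := ih _ ((mul_eq_zero.1 h1).resolve_left T_ne_zero)
    intro j hj
    rcases j with - | j
    · exact h0
    · exact h2 j (by omega)

theorem leading_eq_zero [DecidableEq F] {n m : ℕ} (hP : (4 * n) • D.P 0 true ≠ 0) (hm : m ≤ 4 * n)
    {A : ℕ → MvPolynomial (Fin 3) F} (hA : ∀ j ≤ m, A j ∈ formsSub F (13 * n) (3 * (m - j)))
    (h : ∀ i s l, (D.leading m A).coeff l ∈ D.I i s ^ (n * mult i)) : D.leading m A = 0 := by
  ext l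
  rw [Polynomial.coeff_zero]
  by_contra hf
  refine hP (D.smul_P_eq_zero hf (hasOrderGE_leading hA l) (fun i s => h i s l) ?_)
  have h1 := hasPoleOrderLE_leading (D := D) hA l
  obtain ⟨k, hk⟩ := WithBot.ne_bot_iff_exists.1 fun h => hf (poleOrder_eq_bot_iff.1 h)
  rw [← hk] at h1 ⊢
  have h2 : k + l ≤ 7 * (13 * n) + m := WithBot.coe_le_coe.1 h1
  -- The bound 91n + m - l ≤ 95n - l is where m ≤ 4n enters. For l > 13n the truncated difference is
  -- 0 and the inequality still holds.
  exact WithBot.coe_le_coe.2 (show k ≤ 13 * n - l + 82 * n by omega)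

theorem aeval_quotientMap_eq_zero [DecidableEq F] {n m : ℕ} (hP : (4 * n) • D.P 0 true ≠ 0)
    (hm : m ≤ 4 * n) {G : MvPolynomial (Fin 3) (Polynomial F)} (hG : G.IsHomogeneous (13 * n))
    (hv : ∀ i, VanishesAt G (D.pt i) (n * mult i)) {A : ℕ → MvPolynomial (Fin 3) (Polynomial F)}
    (hA : ∀ j ≤ m, MvPolynomial.map (Polynomial.evalRingHom 0) (A j) ∈ formsSub F (13 * n) (3 * (m - j)))
    (hGA : G = ∑ j ∈ Finset.range (m + 1), C Polynomial.X ^ j *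
      MvPolynomial.map Polynomial.C (cubic D.b D.g) ^ (m - j) * A j) :
    ∀ j ≤ m, aeval (quotientMap D.b D.g) (MvPolynomial.map (Polynomial.evalRingHom 0) (A j)) = 0 := by
  refine eq_zero_of_sum_T_V m _ (leading_eq_zero hP hm hA fun i s l => ?_)
  refine D.mem_of_U_pow_mul_mem (m := m) ?_
  have := D.Φ_mem hG i (hv i) s m l
  rwa [hGA, coeff_Φ_sum, Polynomial.coeff_C_mul] at this

end TenPoints

/-! ### Expansion in powers of the cubic and the parameter -/

theorem map_eval_mem_formsSub {F : Type*} [Field F] {d k : ℕ}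
    {A : MvPolynomial (Fin 3) (Polynomial F)} (hA : A ∈ formsSub (Polynomial F) d k) :
    MvPolynomial.map (Polynomial.evalRingHom 0) A ∈ formsSub F d k := by
  rcases mem_formsSub.1 hA with rfl | ⟨e, he, h⟩
  · rw [map_zero]; exact zero_mem _
  · exact mem_formsSub.2 (Or.inr ⟨e, he, h.map _⟩)

theorem map_C_mem_formsSub {F : Type*} [Field F] {d k : ℕ}
    {A : MvPolynomial (Fin 3) F} (hA : A ∈ formsSub F d k) :
    MvPolynomial.map Polynomial.C A ∈ formsSub (Polynomial F) d k := by
  rcases mem_formsSub.1 hA with rfl | ⟨e, he, h⟩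
  · rw [map_zero]; exact zero_mem _
  · exact mem_formsSub.2 (Or.inr ⟨e, he, h.map _⟩)

theorem exists_eq_C_X_mul {F : Type*} [Field F] {d k : ℕ} {A : MvPolynomial (Fin 3) (Polynomial F)}
    (hA : A ∈ formsSub _ d k) (h : MvPolynomial.map (Polynomial.evalRingHom 0) A = 0) :
    ∃ B ∈ formsSub _ d k, A = C Polynomial.X * B := by
  obtain ⟨B, rfl⟩ : C Polynomial.X ∣ A := by
    rw [C_dvd_iff_dvd_coeff]
    intro m
    have := congrArg (coeff m) h
    rw [coeff_map, coeff_zero, Polynomial.coe_evalRingHom, ← Polynomial.coeff_zero_eq_eval_zero] at this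
    exact Polynomial.X_dvd_iff.2 this
  refine ⟨B, ?_, rfl⟩
  rcases mem_formsSub.1 hA with h | ⟨e, he, h⟩
  · rw [mul_eq_zero, C_eq_zero] at h
    rw [h.resolve_left Polynomial.X_ne_zero]
    exact zero_mem _
  · refine mem_formsSub.2 (Or.inr ⟨e, he, fun m hm => h ?_⟩)
    rw [coeff_C_mul]
    exact mul_ne_zero Polynomial.X_ne_zero hm

theorem aeval_X_add_C_map {σ R S : Type*} [CommRing R] [CommRing S] (φ : R →+* S)
    (G : MvPolynomial σ R) (p : σ → R) :
    aeval (fun j => X j + C (φ (p j))) (MvPolynomial.map φ G) =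
      MvPolynomial.map φ (aeval (fun j => X j + C (p j)) G) := by
  have : ((aeval (fun j => X j + C (φ (p j))) :
      MvPolynomial σ S →ₐ[S] MvPolynomial σ S) : MvPolynomial σ S →+* MvPolynomial σ S).comp
      (MvPolynomial.map φ) = (MvPolynomial.map φ).comp ((aeval (fun j => X j + C (p j)) :
        MvPolynomial σ R →ₐ[R] MvPolynomial σ R) : MvPolynomial σ R →+* MvPolynomial σ R) :=
    MvPolynomial.ringHom_ext (fun r => by simp) fun j => by simp
  exact RingHom.congr_fun this G

theorem VanishesAt.map {σ R S : Type*} [Fintype σ] [CommRing R] [CommRing S] (φ : R →+* S)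
    {G : MvPolynomial σ R} {p : σ → R} {m : ℕ} (h : VanishesAt G p m) :
    VanishesAt (MvPolynomial.map φ G) (fun j => φ (p j)) m := fun α hα => by
  rw [aeval_X_add_C_map, coeff_map, h α hα, map_zero]

namespace TenPoints

variable {F : Type*} [Field F] {D : TenPoints F}

/-- The term of degree 3 is missing because the point 0 lies on the cubic. The coefficient of degree
2 is the gradient there applied to `w`. -/
theorem cubic_line (w : Fin 3 → F) :
    eval₂Hom Polynomial.C (fun j => Polynomial.X * Polynomial.C (![D.X 0, D.Y 0, 1] j) +
      Polynomial.C (w j)) (cubic D.b D.g) =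
    Polynomial.C ((D.Y 0 - 3 * D.X 0 ^ 2 - 2 * D.b * D.X 0 + 4 * D.g) * w 0 +
      (2 * D.Y 0 + D.X 0) * w 1 + (D.Y 0 ^ 2 + D.X 0 * D.Y 0 - D.b * D.X 0 ^ 2 +
      8 * D.g * D.X 0 + 3 * (1 + 4 * D.b) * D.g) * w 2) * Polynomial.X ^ 2 +
    Polynomial.C ((w 1 * w 2 - 3 * w 0 ^ 2 - 2 * D.b * w 0 * w 2 + 4 * D.g * w 2 ^ 2) * D.X 0 +
      (2 * w 1 * w 2 + w 0 * w 2) * D.Y 0 + (w 1 ^ 2 + w 0 * w 1 - D.b * w 0 ^ 2 +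
      8 * D.g * w 0 * w 2 + 3 * (1 + 4 * D.b) * D.g * w 2 ^ 2)) * Polynomial.X +
    Polynomial.C (eval w (cubic D.b D.g)) := by
  have h := congrArg Polynomial.C (D.eqn 0)
  rw [← X] at h
  simp only [cubic, map_add, map_sub, map_mul, map_pow, eval₂Hom_X', eval₂Hom_C, eval_X, eval_C,
    Matrix.cons_val, map_one, map_ofNat] at h ⊢
  linear_combination (Polynomial.X ^ 3) * h

variable [DecidableEq F]

/-- While m ≤ 4n, every coefficient vanishes on the cubic at t = 0. It is thus a multiple of the
cubic plus a multiple of t, and each part raises the order of its term by one. -/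
theorem exists_expansion {n : ℕ} (hP : (4 * n) • D.P 0 true ≠ 0)
    {G : MvPolynomial (Fin 3) (Polynomial F)} (hG : G.IsHomogeneous (13 * n))
    (hv : ∀ i, VanishesAt G (D.pt i) (n * mult i)) (m : ℕ) (hm : m ≤ 4 * n + 1) :
    ∃ A : ℕ → MvPolynomial (Fin 3) (Polynomial F),
      (∀ j ≤ m, A j ∈ formsSub _ (13 * n) (3 * (m - j))) ∧
      G = ∑ j ∈ Finset.range (m + 1), C Polynomial.X ^ j *
        MvPolynomial.map Polynomial.C (cubic D.b D.g) ^ (m - j) * A j := by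
  induction m with
  | zero =>
    have h : G ∈ formsSub (Polynomial F) (13 * n) 0 :=
      mem_formsSub.2 (Or.inr ⟨13 * n, add_zero _, hG⟩)
    refine ⟨fun _ => G, fun j hj => ?_, ?_⟩
    · rwa [Nat.zero_sub, mul_zero]
    · rw [zero_add, Finset.sum_range_one, pow_zero, one_mul, Nat.sub_self, pow_zero, one_mul]
  | succ m ih =>
    obtain ⟨A, hA, hGA⟩ := ih (by omega)
    have hA0 : ∀ j ≤ m, MvPolynomial.map (Polynomial.evalRingHom 0) (A j) ∈
        formsSub F (13 * n) (3 * (m - j)) := fun j hj =>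
      map_eval_mem_formsSub (hA j hj)
    have h0 := aeval_quotientMap_eq_zero hP (show m ≤ 4 * n by omega) hG hv hA0 hGA
    have hB : ∀ j, ∃ B : MvPolynomial (Fin 3) F,
        (j ≤ m → B ∈ formsSub F (13 * n) (3 * (m - j) + 3) ∧
          MvPolynomial.map (Polynomial.evalRingHom 0) (A j) = cubic D.b D.g * B) ∧ (m < j → B = 0) := by
      intro j
      by_cases hj : j ≤ m
      · obtain ⟨B, hB, h⟩ := exists_eq_cubic_mul D.b D.g (hA0 j hj) (h0 j hj)
        exact ⟨B, fun _ => ⟨hB, h⟩, fun h => absurd h (by omega)⟩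
      · exact ⟨0, fun h => absurd h hj, fun _ => rfl⟩
    choose B hB hB0 using hB
    have hA' : ∀ j, ∃ A' : MvPolynomial (Fin 3) (Polynomial F), j ≤ m →
        A' ∈ formsSub _ (13 * n) (3 * (m - j)) ∧
        A j = MvPolynomial.map Polynomial.C (cubic D.b D.g) * MvPolynomial.map Polynomial.C (B j) +
          C Polynomial.X * A' := by
      intro j
      by_cases hj : j ≤ m
      · have hC : ∀ Q : MvPolynomial (Fin 3) F,
            MvPolynomial.map (Polynomial.evalRingHom 0) (MvPolynomial.map Polynomial.C Q) = Q := fun Q => by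
          rw [map_map]
          convert map_id Q
          ext; simp
        obtain ⟨A', h1, h2⟩ := exists_eq_C_X_mul
          (A := A j - MvPolynomial.map Polynomial.C (MvPolynomial.map (Polynomial.evalRingHom 0) (A j)))
          (sub_mem (hA j hj) (map_C_mem_formsSub (hA0 j hj)))
          (by rw [map_sub, hC, sub_self])
        refine ⟨A', fun _ => ⟨h1, ?_⟩⟩
        rw [← h2, (hB j hj).2, map_mul]
        ring
      · exact ⟨0, fun h => absurd h hj⟩
    choose A' hA' using hA'
    -- The part `B j` gains a factor of the cubic and keeps its power of t, while `A' (j - 1)` gains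
    -- a factor t. The convention `B (m + 1) = 0` closes the range.
    refine ⟨fun j => MvPolynomial.map Polynomial.C (B j) + if j = 0 then 0 else A' (j - 1), fun j hj => ?_, ?_⟩
    · have hBm : ∀ j ≤ m + 1, MvPolynomial.map Polynomial.C (B j) ∈
          formsSub (Polynomial F) (13 * n) (3 * (m + 1 - j)) := by
        intro j hj
        rcases Nat.lt_or_ge m j with h | h
        · rw [hB0 j h, map_zero]; exact zero_mem _
        · have := map_C_mem_formsSub (hB j h).1
          convert this using 1
          congr 1
          omega
      rcases j with - | j
      · beta_reduce
        rw [if_pos rfl, add_zero]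
        exact hBm 0 hj
      · refine add_mem (hBm _ hj) ?_
        rw [if_neg (Nat.succ_ne_zero j), Nat.add_sub_cancel, Nat.add_sub_add_right]
        exact (hA' j (by omega)).1
    · simp_rw [mul_add, Finset.sum_add_distrib]
      rw [Finset.sum_range_succ, hB0 (m + 1) (by omega), map_zero, mul_zero, add_zero,
        Finset.sum_range_succ' _ (m + 1)]
      rw [if_pos rfl, mul_zero, add_zero, ← Finset.sum_add_distrib]
      refine hGA.trans (Finset.sum_congr rfl fun j hj => ?_)
      rw [Finset.mem_range] at hj
      rw [(hA' j (by omega)).2, Nat.add_sub_add_right, show m + 1 - j = m - j + 1 by omega,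
        if_neg (Nat.succ_ne_zero j), Nat.add_sub_cancel]
      ring

/-- On a line through the point 0 transverse to the cubic, the restriction has degree at most 13n -
5n = 8n, while the factor `cubic ^ (4n + 1)` alone has degree 8n + 2. So the cofactor `B` vanishes
off the tangent line, hence everywhere. -/
theorem map_eval_eq_zero [Infinite F] {n : ℕ} (hP : (4 * n) • D.P 0 true ≠ 0)
    {G : MvPolynomial (Fin 3) (Polynomial F)} (hG : G.IsHomogeneous (13 * n))
    (hv : ∀ i, VanishesAt G (D.pt i) (n * mult i)) :
    MvPolynomial.map (Polynomial.evalRingHom 0) G = 0 := by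
  obtain ⟨A, -, hGA⟩ := exists_expansion hP hG hv (4 * n + 1) le_rfl
  set B := MvPolynomial.map (Polynomial.evalRingHom 0) (A 0) with hBdef
  have hB : MvPolynomial.map (Polynomial.evalRingHom 0) G = cubic D.b D.g ^ (4 * n + 1) * B := by
    rw [hGA, map_sum, Finset.sum_eq_single 0]
    · have : MvPolynomial.map (Polynomial.evalRingHom 0) (MvPolynomial.map Polynomial.C (cubic D.b D.g)) = cubic D.b D.g := by
        rw [map_map]
        convert map_id (cubic D.b D.g)
        ext; simp
      simp [this, hBdef]
    · intro j _ hj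
      simp [hj]
    · simp
  have hv0 : VanishesAt (MvPolynomial.map (Polynomial.evalRingHom 0) G) ![D.X 0, D.Y 0, 1] (n * 5) := by
    have := VanishesAt.map (Polynomial.evalRingHom 0) (hv 0)
    convert this using 1
    · funext j
      fin_cases j <;> simp [pt]
    · simp [mult]
  have hL : ∀ w : Fin 3 → F, ((D.Y 0 - 3 * D.X 0 ^ 2 - 2 * D.b * D.X 0 + 4 * D.g) * w 0 +
      (2 * D.Y 0 + D.X 0) * w 1 + (D.Y 0 ^ 2 + D.X 0 * D.Y 0 - D.b * D.X 0 ^ 2 +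
      8 * D.g * D.X 0 + 3 * (1 + 4 * D.b) * D.g) * w 2) * eval w B = 0 := by
    intro w
    by_contra hne
    obtain ⟨h1, h2⟩ := mul_ne_zero_iff.1 hne
    have hdeg := VanishesAt.natDegree_le (hG.map (Polynomial.evalRingHom 0)) hv0 w
    rw [hB, map_mul, map_pow] at hdeg
    have hB0 : (eval₂Hom Polynomial.C (fun j => Polynomial.X * Polynomial.C (![D.X 0, D.Y 0, 1] j) +
      Polynomial.C (w j)) B).eval 0 = eval w B := by
      have : (Polynomial.evalRingHom 0).comp (eval₂Hom Polynomial.C (fun j => Polynomial.X *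
          Polynomial.C (![D.X 0, D.Y 0, 1] j) + Polynomial.C (w j))) = eval w := by
        refine MvPolynomial.ringHom_ext (fun r => ?_) fun j => ?_ <;> simp
      exact RingHom.congr_fun this B
    have hBne : eval₂Hom Polynomial.C (fun j => Polynomial.X *
        Polynomial.C (![D.X 0, D.Y 0, 1] j) + Polynomial.C (w j)) B ≠ 0 := fun h => by
      rw [h, Polynomial.eval_zero] at hB0
      exact h2 hB0.symm
    have hcd : (eval₂Hom Polynomial.C (fun j => Polynomial.X *
        Polynomial.C (![D.X 0, D.Y 0, 1] j) + Polynomial.C (w j)) (cubic D.b D.g)).natDegree = 2 := by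
      rw [cubic_line]
      exact Polynomial.natDegree_quadratic h1
    have hcne : eval₂Hom Polynomial.C (fun j => Polynomial.X *
        Polynomial.C (![D.X 0, D.Y 0, 1] j) + Polynomial.C (w j)) (cubic D.b D.g) ≠ 0 := fun h => by
      rw [h] at hcd
      simp at hcd
    rw [Polynomial.natDegree_mul (pow_ne_zero _ hcne) hBne, Polynomial.natDegree_pow, hcd] at hdeg
    omega
  have hmul : (C (D.Y 0 - 3 * D.X 0 ^ 2 - 2 * D.b * D.X 0 + 4 * D.g) * MvPolynomial.X 0 +
      C (2 * D.Y 0 + D.X 0) * MvPolynomial.X 1 + C (D.Y 0 ^ 2 + D.X 0 * D.Y 0 - D.b * D.X 0 ^ 2 +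
      8 * D.g * D.X 0 + 3 * (1 + 4 * D.b) * D.g) * MvPolynomial.X 2 : MvPolynomial (Fin 3) F) * B = 0 :=
    MvPolynomial.funext fun w => by simpa using hL w
  rw [hB]
  refine mul_eq_zero_of_right _ ((mul_eq_zero.1 hmul).resolve_left fun h => D.ne_zero 0 ?_)
  have := congrArg (eval ![0, 1, 0]) h
  rw [← TenPoints.X]
  simpa using this

end TenPoints

end BlowUpPlane

/-! ### Construction of the ten points -/

namespace BlowUpPlane

section Existence

variable {F : Type*} [Field F] [IsAlgClosed F]

theorem exists_add_mul_eq (a c : F) : ∃ x x' : F, x + x' = a ∧ x * x' = c := by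
  obtain ⟨x, hx⟩ := IsAlgClosed.exists_root (Polynomial.X ^ 2 - Polynomial.C a * Polynomial.X +
    Polynomial.C c) (by
      have : (Polynomial.X ^ 2 - Polynomial.C a * Polynomial.X + Polynomial.C c).degree = 2 := by
        compute_degree!
      rw [this]; decide)
  refine ⟨x, a - x, by ring, ?_⟩
  simp only [Polynomial.IsRoot, Polynomial.eval_add, Polynomial.eval_sub, Polynomial.eval_mul,
    Polynomial.eval_pow, Polynomial.eval_X, Polynomial.eval_C] at hx
  linear_combination -hx

/-- The points of the quotient curve on a conic. -/
theorem exists_conic_points {u v : F} (hΔ : 1 - 8 * (u + v) + 16 * (u - v) ^ 2 ≠ 0)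
    (h5 : 5 - 4 * (u + v) + 4 * (u * v) ≠ 0) (h1 : (u - v) ^ 2 ≠ 1) :
    ∃ X Y : Bool → F, (∀ s, Y s ^ 2 + X s * Y s =
        (X s - (u + v)) * (X s ^ 2 - 4 * (u * v)) - u * v ∧
        2 * Y s + X s ≠ 0 ∧ X s ^ 2 + X s + 2 * Y s - 4 * (u * v) = 0 ∧ X s ≠ u + v) ∧
      Function.Injective fun s => (X s, Y s) := by
  -- In characteristic 2 the conic degenerates to X(X + 1) = 0, and both points lie on X = 1.
  -- Otherwise Y is eliminated; apart from the excluded solutions X² = 4uv there remains (X - 2)² =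
  -- 5 - 4(u + v) + 4uv.
  by_cases h2 : (2 : F) = 0
  · obtain ⟨y, y', hs, hp⟩ := exists_add_mul_eq (-1) (-((1 - (u + v)) * (1 - 4 * (u * v)) - u * v))
    have hy' : y' = -1 - y := by linear_combination hs
    subst hy'
    refine ⟨fun _ => 1, fun s => if s then y else -1 - y, fun s => ⟨?_, ?_, ?_, ?_⟩, ?_⟩
    · cases s <;> simp only [if_true, Bool.false_eq_true, if_false] <;> linear_combination -hp
    · rw [h2]; simp
    · cases s <;> simp only [if_true, Bool.false_eq_true, if_false]
      · linear_combination (1 - 1 - y - 2 * (u * v)) * h2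
      · linear_combination (1 + y - 2 * (u * v)) * h2
    · intro h
      apply h1
      linear_combination (-(u + v) - 1) * h - 2 * u * v * h2
    · have : y ≠ -1 - y := fun h => one_ne_zero (α := F) (by linear_combination h - y * h2)
      intro s t h
      cases s <;> cases t <;> simp_all
  · obtain ⟨s, s', hs, hp⟩ := exists_add_mul_eq 0 (-(5 - 4 * (u + v) + 4 * (u * v)))
    have hs' : s' = -s := by linear_combination hs
    subst hs'
    have hs0 : s ≠ 0 := by
      rintro rfl
      apply h5
      linear_combination hp
    have key : ∀ X : F, (X - 2) ^ 2 = 5 - 4 * (u + v) + 4 * (u * v) →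
        ((4 * (u * v) - X - X ^ 2) / 2) ^ 2 + X * ((4 * (u * v) - X - X ^ 2) / 2) =
          (X - (u + v)) * (X ^ 2 - 4 * (u * v)) - u * v ∧
        2 * ((4 * (u * v) - X - X ^ 2) / 2) + X ≠ 0 ∧
        X ^ 2 + X + 2 * ((4 * (u * v) - X - X ^ 2) / 2) - 4 * (u * v) = 0 ∧ X ≠ u + v := by
      intro X hX
      refine ⟨?_, fun h => ?_, ?_, ?_⟩
      · field_simp
        linear_combination (X ^ 2 - 4 * (u * v)) * hX
      · rw [mul_div_cancel₀ _ h2] at h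
        have h4 : 4 * X = 4 * (u + v) - 1 := by linear_combination -hX - h
        apply hΔ
        linear_combination (-(4 * X) - (4 * (u + v) - 1)) * h4 - 16 * h
      · field_simp
        ring
      · rintro rfl
        apply h1
        linear_combination hX
    refine ⟨fun t => if t then 2 + s else 2 - s,
      fun t => (4 * (u * v) - (if t then 2 + s else 2 - s) - (if t then 2 + s else 2 - s) ^ 2) / 2,
      fun t => key _ ?_, ?_⟩
    · cases t <;> simp only [if_true, Bool.false_eq_true, if_false] <;> linear_combination -hp
    · have : 2 + s ≠ 2 - s := fun h => mul_ne_zero h2 hs0 (by linear_combination h)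
      intro t t' h
      have h := congrArg Prod.fst h
      cases t <;> cases t' <;> simp_all

theorem exists_injective_fin {α : Type*} {T : Set α} [Infinite α] (hT : T.Finite) {a : α}
    (ha : a ∉ T) (n : ℕ) : ∃ c : Fin (n + 1) → α, c 0 = a ∧ Function.Injective c ∧
      ∀ k, c k ∉ T := by
  classical
  have := hT.infinite_compl.to_subtype
  let f : Fin (n + 1) → (Tᶜ : Set α) := fun k => Infinite.natEmbedding (Tᶜ : Set α) k
  have hf : Function.Injective f := fun i j h => Fin.ext ((Infinite.natEmbedding _).injective h)
  refine ⟨fun k => Equiv.swap (f 0) ⟨a, ha⟩ (f k), by simp, ?_, fun k =>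
    (Equiv.swap (f 0) ⟨a, ha⟩ (f k)).2⟩
  exact Subtype.val_injective.comp ((Equiv.injective _).comp hf)

theorem exists_equiv_apply_zero {ι : Type*} [Fintype ι] {n : ℕ} (h : Fintype.card ι = n + 1)
    (a : ι) : ∃ e : Fin (n + 1) ≃ ι, e 0 = a := by
  classical
  let e := (Fintype.equivFinOfCardEq h).symm
  exact ⟨e.trans (Equiv.swap (e 0) a), by simp⟩

/-- Eight points come in pairs on four vertical lines and the other two lie on the conic. The point
0 is (u + v, -v), the image of (u, 0). -/
theorem exists_tenPoints {u v : F} (hu : u ≠ 0) (hv : v ≠ 0) (huv : u ≠ v)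
    (hΔ : 1 - 8 * (u + v) + 16 * (u - v) ^ 2 ≠ 0)
    (h5 : 5 - 4 * (u + v) + 4 * (u * v) ≠ 0) (h1 : (u - v) ^ 2 ≠ 1) :
    ∃ D : TenPoints F, D.x 0 true = u ∧ D.x 0 false = v := by
  have : Infinite F := IsAlgClosed.instInfinite
  obtain ⟨X', Y', hXY, hinj⟩ := exists_conic_points hΔ h5 h1
  -- To be avoided: lines X = c on which 2Y + X vanishes at a point of the cubic, so that the pair
  -- collapses, and lines through the two conic points.
  set T : Set F := {c | (c ^ 2 - 4 * (u * v)) * (4 * (c - (u + v)) + 1) = 0} ∪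
    {c | c = X' true ∨ c = X' false} with hT
  have huvT : (u + v) ∉ T := by
    rintro (h | h | h)
    · rw [Set.mem_ofPred_eq, sub_self, mul_zero, zero_add, mul_one] at h
      apply sub_ne_zero.2 huv
      rw [← pow_eq_zero_iff two_ne_zero, ← h]
      ring
    · exact (hXY _).2.2.2 h.symm
    · exact (hXY _).2.2.2 h.symm
  have hTfin : T.Finite := by
    refine Set.Finite.union ?_ ((Set.finite_singleton _).insert _)
    have hp : ((Polynomial.X ^ 2 - Polynomial.C (4 * (u * v))) *
        (Polynomial.C 4 * (Polynomial.X - Polynomial.C (u + v)) + 1) : Polynomial F) ≠ 0 := by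
      intro h
      have := congrArg (Polynomial.eval (u + v)) h
      apply huvT
      left
      simpa using this
    convert Polynomial.finite_setOfPred_isRoot hp using 2
    simp [Polynomial.IsRoot]
  obtain ⟨c, hc0, hcinj, hcT⟩ := exists_injective_fin hTfin huvT 3
  have hroot : ∀ k, ∃ y : F, y ^ 2 + c k * y = (c k - (u + v)) * (c k ^ 2 - 4 * (u * v)) - u * v ∧
      (k = 0 → y = -v) := by
    intro k
    by_cases hk : k = 0
    · refine ⟨-v, ?_, fun _ => rfl⟩
      rw [hk, hc0]
      ring
    · obtain ⟨y, y', hs, hp⟩ := exists_add_mul_eq (-c k)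
        (-((c k - (u + v)) * (c k ^ 2 - 4 * (u * v)) - u * v))
      refine ⟨y, ?_, fun h => absurd h hk⟩
      have hy' : y' = -c k - y := by linear_combination hs
      rw [hy'] at hp
      linear_combination -hp
  choose y hy hy0 using hroot
  have hyne : ∀ k, 2 * y k + c k ≠ 0 := by
    intro k h
    refine hcT k (Or.inl ?_)
    rw [Set.mem_ofPred_eq]
    linear_combination (2 * y k + c k) * h - 4 * hy k
  obtain ⟨e, he⟩ := exists_equiv_apply_zero (ι := (Fin 4 × Bool) ⊕ Bool) (n := 9) rfl
    (Sum.inl (0, true))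
  let XX : (Fin 4 × Bool) ⊕ Bool → F := Sum.elim (fun p => c p.1) X'
  let YY : (Fin 4 × Bool) ⊕ Bool → F :=
    Sum.elim (fun p => if p.2 then y p.1 else -c p.1 - y p.1) Y'
  have hlift : ∀ i : Fin 10, ∃ x : Bool → F, x true + x false = XX (e i) ∧
      x true * x false = u * v ∧ (i = 0 → x true = u ∧ x false = v) := by
    intro i
    by_cases hi : i = 0
    · exact ⟨fun s => if s then u else v, by simp [hi, he, XX, hc0], by simp, by simp⟩
    · obtain ⟨x, x', hs, hp⟩ := exists_add_mul_eq (XX (e i)) (u * v)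
      exact ⟨fun s => if s then x else x', by simpa using hs, by simpa using hp,
        fun h => absurd h hi⟩
  choose x hxs hxp hx0 using hlift
  refine ⟨⟨-(u + v), u * v, c, x, fun i => YY (e i), ?_, mul_ne_zero hu hv, hxp, fun i => ?_,
    fun i => ?_, ?_, fun i => ?_, ?_, ?_⟩, (hx0 0 rfl).1, (hx0 0 rfl).2⟩
  · have : (curve (-(u + v)) (u * v)).Δ =
        (u * v) ^ 2 * (1 - 8 * (u + v) + 16 * (u - v) ^ 2) := by
      simp only [curve, WeierstrassCurve.Δ, WeierstrassCurve.b₂, WeierstrassCurve.b₄,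
        WeierstrassCurve.b₆, WeierstrassCurve.b₈]
      ring
    rw [this]
    exact mul_ne_zero (pow_ne_zero _ (mul_ne_zero hu hv)) hΔ
  · rw [hxs, ← sub_eq_add_neg]
    rcases e i with ⟨k, s⟩ | s
    · cases s <;> simp only [XX, YY, Sum.elim_inl, if_true, Bool.false_eq_true, if_false] <;>
        linear_combination hy k
    · exact (hXY s).1
  · rw [hxs]
    rcases e i with ⟨k, s⟩ | s
    · cases s <;> simp only [XX, YY, Sum.elim_inl, if_true, Bool.false_eq_true, if_false]
      · intro h
        exact hyne k (by linear_combination -h)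
      · exact hyne k
    · exact (hXY s).2.1
  · simp_rw [hxs]
    have : Function.Injective fun o => (XX o, YY o) := by
      rintro (⟨k, s⟩ | s) (⟨l, t⟩ | t) h
      · have hkl : k = l := hcinj (Prod.mk.inj h).1
        subst hkl
        have h2 := (Prod.mk.inj h).2
        simp only [YY, Sum.elim_inl] at h2
        cases s <;> cases t <;> simp only [if_true, Bool.false_eq_true, if_false] at h2 ⊢
        · exact absurd (by linear_combination -h2) (hyne k)
        · exact absurd (by linear_combination h2) (hyne k)
      · refine absurd (Or.inr ?_) (hcT k)
        have := (Prod.mk.inj h).1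
        simp only [XX, Sum.elim_inl, Sum.elim_inr] at this
        cases t
        · exact Or.inr this
        · exact Or.inl this
      · refine absurd (Or.inr ?_) (hcT l)
        have := (Prod.mk.inj h).1
        simp only [XX, Sum.elim_inl, Sum.elim_inr] at this
        cases s
        · exact Or.inr this.symm
        · exact Or.inl this.symm
      · exact congrArg Sum.inr (hinj h)
    exact this.comp e.injective
  · rw [hxs]
    rcases hei : e i with ⟨k, s⟩ | s
    · refine mul_eq_zero_of_left (Finset.prod_eq_zero (Finset.mem_univ k) ?_) _
      simp [XX]
    · refine mul_eq_zero_of_right _ ?_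
      exact (hXY s).2.2.1
  · rw [(hx0 0 rfl).1, (hx0 0 rfl).2]
  · rw [(hx0 0 rfl).2, he]
    simpa [YY] using hy0 0 rfl

end Existence

end BlowUpPlane

/-! ### A point of large order, by orders of power series -/

namespace BlowUpPlane

section Order

variable {k F : Type*} [Field k] [Field F]

/-- The element `x` is the image of a power series of order `j`. -/
def HasOrder (ι : PowerSeries k →+* F) (j : ℕ) (x : F) : Prop :=
  ∃ w : PowerSeries k, PowerSeries.constantCoeff w ≠ 0 ∧ x = ι (PowerSeries.X ^ j * w)

theorem HasOrder.le {ι : PowerSeries k →+* F} (hι : Function.Injective ι) {i j : ℕ} {x : F}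
    (hi : HasOrder ι i x) (hj : HasOrder ι j x) : i ≤ j := by
  obtain ⟨w, hw, rfl⟩ := hi
  obtain ⟨w', hw', h⟩ := hj
  by_contra! hlt
  obtain ⟨a, rfl⟩ := Nat.exists_eq_add_of_lt hlt
  have h1 := hι h
  rw [pow_add, pow_add, mul_assoc, mul_assoc] at h1
  have h2 := mul_left_cancel₀ (pow_ne_zero j PowerSeries.X_ne_zero) h1
  apply hw'
  rw [← h2]
  simp

theorem HasOrder.eq {ι : PowerSeries k →+* F} (hι : Function.Injective ι) {i j : ℕ} {x : F}
    (hi : HasOrder ι i x) (hj : HasOrder ι j x) : i = j :=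
  le_antisymm (hi.le hι hj) (hj.le hι hi)

namespace TenPoints

open WeierstrassCurve.Affine

variable {D : TenPoints F}

/-- The duplication formula x(2Q) = (x² - g)²/(2y + x)², simplified by (2y + x)² = x²(1 + 4(x + g/x
+ b)). -/
theorem addX_mul_eq [DecidableEq F] {x y z : F} (h : D.W.Equation x y) (hz : x * z = D.g)
    (hx : x ≠ 0) (hy : y ≠ D.W.negY x y) :
    D.W.addX x x (D.W.slope x x y y) * (1 + 4 * (x + z + D.b)) = (x - z) ^ 2 := by
  have h0 := D.equation_iff.1 h
  have hd : 2 * y + x ≠ 0 := by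
    intro h
    apply hy
    rw [negY_eq]
    linear_combination h
  have h1 : D.W.a₁ = 1 := rfl
  have h2 : D.W.a₂ = D.b := rfl
  have h3 : D.W.a₃ = 0 := rfl
  have h4 : D.W.a₄ = D.g := rfl
  have hs : D.W.slope x x y y = (3 * x ^ 2 + 2 * D.b * x + D.g - y) / (2 * y + x) := by
    rw [slope_of_Y_ne rfl hy, h1, h2, h4, negY_eq]
    congr 1 <;> ring
  have hd2 : (2 * y + x) ^ 2 = x ^ 2 * (1 + 4 * (x + z + D.b)) := by
    linear_combination 4 * h0 - 4 * x * hz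
  apply mul_left_cancel₀ (pow_ne_zero 2 hx)
  rw [mul_left_comm, ← hd2, addX, hs, h1, h2]
  field_simp
  rw [← hz] at h0 ⊢
  linear_combination (-1 - 4 * D.b - 8 * x) * h0

/-- If x has order j with 2j ≤ M, then g/x has the larger order M + 1 - j, so (x - g/x)² has order
2j, and the factor 1 + 4(x + g/x + b) is a unit. -/
theorem exists_two_smul_eq [DecidableEq F] {ι : PowerSeries k →+* F} (hι : Function.Injective ι)
    {M : ℕ} (hM : M ≠ 0) (hu : D.x 0 true = ι PowerSeries.X)
    (hv : D.x 0 false = ι (PowerSeries.X ^ M)) {j : ℕ} (hj : j ≠ 0) (hjM : 2 * j ≤ M) {x y : F}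
    (h : D.W.Nonsingular x y) (hx : HasOrder ι j x) :
    ∃ (x' y' : F) (h' : D.W.Nonsingular x' y'),
      2 • (Point.some x y h : D.W.Point) = Point.some x' y' h' ∧ HasOrder ι (2 * j) x' := by
  obtain ⟨w, hw, hxw⟩ := hx
  have hw1 := PowerSeries.mul_inv_cancel w hw
  obtain ⟨a, rfl⟩ := Nat.exists_eq_add_of_le hjM
  set z : F := ι (PowerSeries.X ^ (j + a + 1) * w⁻¹) with hz
  have hxz : x * z = D.g := by
    rw [← D.x_mul 0, hu, hv, hxw, hz, ← map_mul, ← map_mul]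
    congr 1
    linear_combination PowerSeries.X ^ (2 * j + a + 1) * hw1
  have hx0 : x ≠ 0 := by
    rintro rfl
    rw [zero_mul] at hxz
    exact D.g_ne_zero hxz.symm
  set e : PowerSeries k := 1 + 4 * (PowerSeries.X ^ j * w + PowerSeries.X ^ (j + a + 1) * w⁻¹ -
    (PowerSeries.X + PowerSeries.X ^ (2 * j + a))) with he
  have he0 : PowerSeries.constantCoeff e ≠ 0 := by
    rw [he]
    simp [hj]
  have hιe : ι e = 1 + 4 * (x + z + D.b) := by
    rw [he, D.b_eq, hu, hv, hxw, hz]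
    simp only [map_add, map_sub, map_mul, map_one, map_ofNat]
    ring
  have hιe0 : ι e ≠ 0 := fun h => by
    rw [map_eq_zero_iff ι hι] at h
    rw [h, map_zero] at he0
    exact he0 rfl
  have hy : y ≠ D.W.negY x y := by
    intro hy
    rw [negY_eq] at hy
    have h0 := D.equation_iff.1 h.1
    have : x ^ 2 * ι e = 0 := by
      rw [hιe]
      linear_combination -4 * h0 + 4 * x * hxz + (2 * y + x) * hy
    exact mul_ne_zero (pow_ne_zero 2 hx0) hιe0 this
  refine ⟨_, _, _, (two_nsmul _).trans (Point.add_self_of_Y_ne hy),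
    (w - PowerSeries.X ^ (a + 1) * w⁻¹) ^ 2 * e⁻¹, ?_, ?_⟩
  · rw [map_mul]
    refine mul_ne_zero ?_ ?_
    · simpa using hw
    · simpa using he0
  · apply mul_right_cancel₀ hιe0
    rw [← map_mul]
    have h1 : PowerSeries.X ^ (2 * j) * ((w - PowerSeries.X ^ (a + 1) * w⁻¹) ^ 2 * e⁻¹) * e =
        (PowerSeries.X ^ j * w - PowerSeries.X ^ (j + a + 1) * w⁻¹) ^ 2 := by
      have := PowerSeries.mul_inv_cancel e he0
      linear_combination (PowerSeries.X ^ (2 * j) * (w - PowerSeries.X ^ (a + 1) * w⁻¹) ^ 2) * this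
    rw [h1, hιe, addX_mul_eq h.1 hxz hx0 hy, map_pow, map_sub, ← hxw]

theorem exists_two_pow_smul_eq [DecidableEq F] {ι : PowerSeries k →+* F}
    (hι : Function.Injective ι) {M : ℕ} (hu : D.x 0 true = ι PowerSeries.X)
    (hv : D.x 0 false = ι (PowerSeries.X ^ M)) (i : ℕ) (hi : 2 ^ i ≤ M) :
    ∃ (x y : F) (h : D.W.Nonsingular x y),
      2 ^ i • D.P 0 true = Point.some x y h ∧ HasOrder ι (2 ^ i) x := by
  induction i with
  | zero =>
    refine ⟨_, _, _, by rw [pow_zero, one_smul, P], 1, by simp, ?_⟩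
    rw [pow_zero, pow_one, mul_one, hu]
  | succ i ih =>
    have h1 : 0 < 2 ^ i := by positivity
    rw [pow_succ'] at hi ⊢
    obtain ⟨x, y, h, he, hx⟩ := ih (by omega)
    obtain ⟨x', y', h', he', hx'⟩ := exists_two_smul_eq hι (by omega) hu hv h1.ne' hi h hx
    exact ⟨x', y', h', by rw [mul_smul, he, he'], hx'⟩

/-- The multiples by 2^0, …, 2^m have x-coordinates of distinct orders, but two of these m + 1
powers agree modulo m. -/
theorem smul_P_ne_zero [DecidableEq F] {ι : PowerSeries k →+* F} (hι : Function.Injective ι)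
    {m : ℕ} (hm : m ≠ 0) (hu : D.x 0 true = ι PowerSeries.X)
    (hv : D.x 0 false = ι (PowerSeries.X ^ 2 ^ m)) : m • D.P 0 true ≠ 0 := by
  intro h
  have : NeZero m := ⟨hm⟩
  obtain ⟨i, j, hij, hmod⟩ := Fintype.exists_ne_map_eq_of_card_lt
    (fun i : Fin (m + 1) => ((2 ^ (i : ℕ) : ℕ) : ZMod m)) (by simp)
  have hmod := ((ZMod.natCast_eq_natCast_iff _ _ _).1 hmod).of_dvd (addOrderOf_dvd_of_nsmul_eq_zero h)
  rw [← nsmul_eq_nsmul_iff_modEq] at hmod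
  obtain ⟨x, y, h1, he, hx⟩ := exists_two_pow_smul_eq hι hu hv i
    (Nat.pow_le_pow_right two_pos (Nat.lt_succ_iff.1 i.2))
  obtain ⟨x', y', h1', he', hx'⟩ := exists_two_pow_smul_eq hι hu hv j
    (Nat.pow_le_pow_right two_pos (Nat.lt_succ_iff.1 j.2))
  rw [he, he', Point.some.injEq] at hmod
  rw [hmod.1] at hx
  exact hij (Fin.ext (Nat.pow_right_injective le_rfl (hx.eq hι hx')))

end TenPoints

theorem exists_tenPoints_smul_ne_zero (k : Type*) [Field k] [IsAlgClosed F] [DecidableEq F]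
    {ι : PowerSeries k →+* F} (hι : Function.Injective ι) {m : ℕ} (hm : m ≠ 0) :
    ∃ D : TenPoints F, m • D.P 0 true ≠ 0 := by
  have h2 : 2 ≤ 2 ^ m := Nat.le_self_pow hm 2
  have hne : ∀ f : PowerSeries k, PowerSeries.constantCoeff f ≠ 0 → ι f ≠ 0 := by
    intro f hf h
    rw [map_eq_zero_iff ι hι] at h
    rw [h, map_zero] at hf
    exact hf rfl
  have hX : (PowerSeries.X : PowerSeries k) ≠ 0 := PowerSeries.X_ne_zero
  have hc : PowerSeries.constantCoeff ((PowerSeries.X : PowerSeries k) ^ 2 ^ m) = 0 := by simp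
  obtain ⟨D, hu, hv⟩ := exists_tenPoints (F := F) (u := ι PowerSeries.X)
    (v := ι (PowerSeries.X ^ 2 ^ m)) ((map_ne_zero_iff ι hι).2 hX)
    ((map_ne_zero_iff ι hι).2 (pow_ne_zero _ hX))
    (fun h => by
      have h1 := congrArg (PowerSeries.coeff 1) (hι h)
      rw [PowerSeries.coeff_one_X, PowerSeries.coeff_X_pow, if_neg (by omega)] at h1
      exact one_ne_zero h1)
    (by
      have := hne (1 - 8 * (PowerSeries.X + PowerSeries.X ^ 2 ^ m) +
        16 * (PowerSeries.X - PowerSeries.X ^ 2 ^ m) ^ 2) (by simp)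
      simpa only [map_add, map_sub, map_mul, map_pow, map_one, map_ofNat] using this)
    (by
      intro h
      have h0 : (5 - 4 * (PowerSeries.X + PowerSeries.X ^ 2 ^ m) +
          4 * (PowerSeries.X * PowerSeries.X ^ 2 ^ m) : PowerSeries k) = 0 := by
        apply hι
        simpa only [map_add, map_sub, map_mul, map_pow, map_one, map_ofNat, map_zero] using h
      obtain ⟨a, ha⟩ := Nat.exists_eq_add_of_le' h2
      -- The constant term 5 can vanish only in characteristic 5, and then the linear coefficient -4
      -- does not.
      have h1 : (5 : k) = 0 := by
        have := congrArg PowerSeries.constantCoeff h0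
        rw [← map_ofNat PowerSeries.constantCoeff]
        simpa using this
      have h5 : (5 : PowerSeries k) = 0 := by
        rw [← map_ofNat PowerSeries.C, h1, map_zero]
      have h3 : (PowerSeries.X : PowerSeries k) * (-4 + PowerSeries.X *
          (-4 * PowerSeries.X ^ a + 4 * PowerSeries.X ^ (a + 1))) = 0 := by
        rw [ha] at h0
        linear_combination h0 - h5
      have h4 := congrArg PowerSeries.constantCoeff ((mul_eq_zero.1 h3).resolve_left hX)
      have h6 : (4 : k) = 0 := by
        rw [← map_ofNat PowerSeries.constantCoeff]
        simpa using h4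
      exact one_ne_zero (α := k) (by linear_combination h1 - h6))
    (fun h => hne (1 - (PowerSeries.X - PowerSeries.X ^ 2 ^ m) ^ 2) (by simp) (by
      rw [map_sub, map_pow, map_sub, h, map_one, sub_self]))
  exact ⟨D, D.smul_P_ne_zero hι hm hu hv⟩

end Order

end BlowUpPlane

/-! ### The Taylor matrix and passage to general points -/

namespace BlowUpPlane

/-- A matrix with independent columns has a nonvanishing maximal minor. -/
theorem _root_.Matrix.exists_submatrix_det_ne_zero {L κ ρ : Type*} [Field L] [Fintype κ]
    [DecidableEq κ] (M : Matrix ρ κ L) (h : ∀ f : κ → L, M.mulVec f = 0 → f = 0) :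
    ∃ r : κ → ρ, (M.submatrix r id).det ≠ 0 := by
  -- Otherwise a nonzero functional kills all rows, and its coefficients form a nonzero vector in
  -- the kernel.
  have hspan : Submodule.span L (Set.range M.row) = ⊤ := by
    by_contra hne
    obtain ⟨φ, hφ, hle⟩ := Submodule.exists_le_ker_of_lt_top _ (lt_top_iff_ne_top.2 hne)
    apply hφ
    have hφ' : ∀ v : κ → L, φ v = ∑ i, v i * φ (Pi.single i 1) := fun v => by
      conv_lhs => rw [pi_eq_sum_univ' v]
      simp
    have h0 := h (fun i => φ (Pi.single i 1)) (by
      funext r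
      have := hle (Submodule.subset_span ⟨r, rfl⟩)
      rw [LinearMap.mem_ker, hφ'] at this
      exact this)
    ext i
    simpa using congrFun h0 i
  obtain ⟨κ', a, -, ha, hli⟩ := exists_linearIndependent' L M.row
  rw [hspan] at ha
  let b := Module.Basis.mk hli ha.ge
  have : Finite κ' := Module.Finite.finite_basis b
  have := Fintype.ofFinite κ'
  have hcard : Fintype.card κ = Fintype.card κ' := by
    rw [← Module.finrank_eq_card_basis b, Module.finrank_fintype_fun_eq_card]
  let e := Fintype.equivOfCardEq hcard
  refine ⟨a ∘ e, ?_⟩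
  rw [← isUnit_iff_ne_zero, ← Matrix.isUnit_iff_isUnit_det,
    ← Matrix.linearIndependent_rows_iff_isUnit]
  exact hli.comp e e.injective

section

variable {R : Type*} [CommRing R] {r : ℕ}

/-- The exponents of the monomials of degree `d` in three variables. -/
abbrev Exponent (d : ℕ) : Type := (Finset.univ : Finset (Fin 3)).finsuppAntidiag d

/-- The Taylor coefficients of order less than `m i` at the `i`-th of `r` points. -/
abbrev TaylorIndex (m : Fin r → ℕ) : Type :=
  {a : Fin r × (Fin 3 →₀ ℕ) // a.2.degree < m a.1}

/-- The matrix that takes the coefficients of a form of degree `d` to its Taylor coefficients at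
given points. -/
def taylorMatrix (p : Fin r → Fin 3 → R) (d : ℕ) (m : Fin r → ℕ) :
    Matrix (TaylorIndex m) (Exponent d) R :=
  Matrix.of fun a β => ∏ j, ((β.1 j).choose (a.1.2 j) : R) * p a.1.1 j ^ (β.1 j - a.1.2 j)

theorem taylorMatrix_map {S : Type*} [CommRing S] (φ : R →+* S) (p : Fin r → Fin 3 → R) (d : ℕ)
    (m : Fin r → ℕ) :
    (taylorMatrix p d m).map φ = taylorMatrix (fun i j => φ (p i j)) d m := by
  ext a β
  simp [taylorMatrix]

theorem mem_exponent {d : ℕ} {β : Fin 3 →₀ ℕ} :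
    β ∈ (Finset.univ : Finset (Fin 3)).finsuppAntidiag d ↔ β.degree = d := by
  simp [Finset.mem_finsuppAntidiag, Finsupp.degree_eq_sum]

theorem taylorMatrix_mulVec_eq_zero_iff {p : Fin r → Fin 3 → R} {d : ℕ} {m : Fin r → ℕ}
    {F : MvPolynomial (Fin 3) R} (hF : F.IsHomogeneous d) :
    (taylorMatrix p d m).mulVec (fun β => coeff β.1 F) = 0 ↔
      ∀ i, VanishesAt F (p i) (m i) := by
  have key : ∀ i α, ∑ β : Exponent d, (∏ j, ((β.1 j).choose (α j) : R) * p i j ^ (β.1 j - α j)) *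
      coeff β.1 F = coeff α (aeval (fun j => X j + C (p i j)) F) := by
    intro i α
    rw [coeff_aeval_X_add_C, Finset.sum_coe_sort (Finset.univ.finsuppAntidiag d) fun β =>
      (∏ j, ((β j).choose (α j) : R) * p i j ^ (β j - α j)) * coeff β F]
    symm
    refine (Finset.sum_subset (fun β hβ => ?_) fun β _ hβ => ?_).trans
      (Finset.sum_congr rfl fun β _ => mul_comm _ _)
    · rw [mem_exponent, ← hF (mem_support_iff.1 hβ), Finsupp.degree_eq_weight_one]
      rfl
    · rw [notMem_support_iff.1 hβ, zero_mul]
  refine ⟨fun h i α hα => ?_, fun h => funext fun a => ?_⟩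
  · rw [← key]
    exact congrFun h ⟨(i, α), hα⟩
  · exact (key a.1.1 a.1.2).trans (h a.1.1 a.1.2 a.2)

/-- The form with given coefficients. -/
noncomputable def formOfCoeff {d : ℕ} (f : Exponent d → R) : MvPolynomial (Fin 3) R :=
  ∑ β, monomial β.1 (f β)

theorem coeff_formOfCoeff {d : ℕ} (f : Exponent d → R) (β : Exponent d) :
    coeff β.1 (formOfCoeff f) = f β := by
  rw [formOfCoeff, coeff_sum, Finset.sum_eq_single β]
  · simp
  · intro γ _ h
    rw [coeff_monomial, if_neg fun h' => h (Subtype.ext h')]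
  · simp

theorem isHomogeneous_formOfCoeff {d : ℕ} (f : Exponent d → R) :
    (formOfCoeff f).IsHomogeneous d :=
  IsHomogeneous.sum _ _ _ fun β _ => isHomogeneous_monomial _ (mem_exponent.1 β.2)

end

/-- The coordinates of the generic points. -/
noncomputable def genericPoint (k : Type*) [Field k] (r : ℕ) (i : Fin r) (j : Fin 3) :
    MvPolynomial (Fin r × Fin 3) k := X (i, j)

theorem isMultihomogeneous_taylorMatrix {k : Type*} [Field k] {r d : ℕ} {m : Fin r → ℕ}
    (a : TaylorIndex m) (β : Exponent d) :
    IsMultihomogeneous (taylorMatrix (genericPoint k r) d m a β)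
      (Pi.single a.1.1 (d - a.1.2.degree)) := by
  rw [taylorMatrix, Matrix.of_apply]
  by_cases hle : ∀ j, a.1.2 j ≤ β.1 j
  · have h1 : (Pi.single a.1.1 (d - a.1.2.degree) : Fin r → ℕ) =
        ∑ j, (0 + (β.1 j - a.1.2 j) • Pi.single a.1.1 1) := by
      simp_rw [zero_add]
      rw [← Finset.sum_smul, Finset.sum_tsub_distrib _ fun i _ => hle i,
        ← Finsupp.degree_eq_sum, ← Finsupp.degree_eq_sum, mem_exponent.1 β.2, ← Pi.single_smul]
      simp
    rw [h1]
    refine IsWeightedHomogeneous.prod _ _ _ fun j _ => IsWeightedHomogeneous.mul ?_ ?_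
    · have := isWeightedHomogeneous_C
        (fun ij : Fin r × Fin 3 => (Pi.single ij.1 1 : Fin r → ℕ)) ((β.1 j).choose (a.1.2 j) : k)
      simpa using this
    · exact (isWeightedHomogeneous_X k _ (a.1.1, j)).pow _
  · push Not at hle
    obtain ⟨j, hj⟩ := hle
    rw [Finset.prod_eq_zero (Finset.mem_univ j)]
    · exact isWeightedHomogeneous_zero _ _ _
    · rw [Nat.choose_eq_zero_of_lt hj, Nat.cast_zero, zero_mul]

/-- The multidegree of an entry depends only on its row, and every term of the determinant uses each
row once. -/
theorem isMultihomogeneous_det {k : Type*} [Field k] {r : ℕ} {κ : Type*} [Fintype κ]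
    [DecidableEq κ] (M : Matrix κ κ (MvPolynomial (Fin r × Fin 3) k)) (e : κ → Fin r → ℕ)
    (h : ∀ a b, IsMultihomogeneous (M a b) (e a)) : IsMultihomogeneous M.det (∑ a, e a) := by
  rw [Matrix.det_apply']
  refine IsWeightedHomogeneous.sum _ _ _ fun σ _ => ?_
  have h1 := IsWeightedHomogeneous.prod Finset.univ (fun i => M (σ i) i) (fun i => e (σ i))
    fun i _ => h _ _
  rw [Equiv.sum_comp σ e] at h1
  have h2 := h1.C_mul ((Equiv.Perm.sign σ : ℤ) : k)
  simpa using h2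

/-- If there are points over an extension of `k` such that no form of degree `d` vanishes at these
points, then there is no form of degree `d` that vanishes at general points. -/
theorem exists_isMultihomogeneous {k L : Type*} [Field k] [Field L] (φ : k →+* L) {r d : ℕ}
    {m : Fin r → ℕ} (p : Fin r → Fin 3 → L) (hp : ∀ F : MvPolynomial (Fin 3) L,
      F.IsHomogeneous d → (∀ i, VanishesAt F (p i) (m i)) → F = 0) :
    ∃ (e : Fin r → ℕ) (G : MvPolynomial (Fin r × Fin 3) k), IsMultihomogeneous G e ∧ G ≠ 0 ∧
      ∀ (K : Type*) [Field K] [Algebra k K] (q : Fin r → Plane K), multiEval q G ≠ 0 →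
        ¬ ExistsCurve q d m := by
  obtain ⟨s, hs⟩ := (taylorMatrix p d m).exists_submatrix_det_ne_zero fun f hf => by
    have h1 := hp (formOfCoeff f) (isHomogeneous_formOfCoeff f)
      ((taylorMatrix_mulVec_eq_zero_iff (isHomogeneous_formOfCoeff f)).1 (by
        simpa only [coeff_formOfCoeff] using hf))
    funext β
    rw [← coeff_formOfCoeff f β, h1, coeff_zero]
    rfl
  -- The minor of the matrix at indeterminate points has coefficients in `k`. It specialises to the
  -- nonzero minor at `p`, and at any `q` where it is nonzero it forces all coefficients of a form
  -- to vanish.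
  refine ⟨_, ((taylorMatrix (genericPoint k r) d m).submatrix s id).det,
    isMultihomogeneous_det _ (fun β => Pi.single (s β).1.1 (d - (s β).1.2.degree))
      fun β γ => isMultihomogeneous_taylorMatrix _ _, fun h0 => hs ?_, ?_⟩
  · have := congrArg (eval₂Hom φ fun ij : Fin r × Fin 3 => p ij.1 ij.2) h0
    rw [RingHom.map_det, map_zero, RingHom.mapMatrix_apply, ← Matrix.submatrix_map,
      taylorMatrix_map] at this
    simpa [genericPoint] using this
  · rintro K _ _ q hq ⟨F, hF0, hF, hv⟩
    apply hF0
    have hM := (taylorMatrix_mulVec_eq_zero_iff (p := fun i => (q i).rep) (m := m) hF).2 hv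
    rw [multiEval, AlgHom.map_det, AlgHom.mapMatrix_apply, ← Matrix.submatrix_map] at hq
    have h2 := taylorMatrix_map (aeval fun ij : Fin r × Fin 3 => (q ij.1).rep ij.2 :
      MvPolynomial (Fin r × Fin 3) k →ₐ[k] K).toRingHom (genericPoint k r) d m
    have h3 := Matrix.eq_zero_of_mulVec_eq_zero hq (v := fun β => coeff β.1 F) (by
      funext β
      refine Eq.trans ?_ (congrFun hM (s β))
      rw [Matrix.mulVec, Matrix.mulVec]
      congr 1
      funext γ
      have := congrFun (congrFun h2 (s β)) γ
      refine this.trans ?_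
      simp [genericPoint])
    ext β
    by_cases hβ : β.degree = d
    · exact congrFun h3 ⟨β, mem_exponent.2 hβ⟩
    · rw [coeff_zero]
      by_contra hne
      apply hβ
      rw [← hF hne, Finsupp.degree_eq_weight_one]
      rfl

end BlowUpPlane

/-! ### Descent in the parameter and vanishing at general points -/

namespace BlowUpPlane

theorem VanishesAt.of_C_mul {σ R : Type*} [Fintype σ] [CommRing R] [IsDomain R] {a : R}
    (ha : a ≠ 0) {G : MvPolynomial σ R} {p : σ → R} {m : ℕ} (h : VanishesAt (C a * G) p m) :
    VanishesAt G p m := fun α hα => by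
  have := h α hα
  rw [map_mul, algHom_C, algebraMap_eq, coeff_C_mul] at this
  exact (mul_eq_zero.1 this).resolve_left ha

theorem VanishesAt.C_mul {σ R : Type*} [Fintype σ] [CommRing R] (a : R)
    {G : MvPolynomial σ R} {p : σ → R} {m : ℕ} (h : VanishesAt G p m) :
    VanishesAt (C a * G) p m := fun α hα => by
  rw [map_mul, algHom_C, algebraMap_eq, coeff_C_mul, h α hα, mul_zero]

theorem VanishesAt.of_map {σ R S : Type*} [Fintype σ] [CommRing R] [CommRing S] {φ : R →+* S}
    (hφ : Function.Injective φ) {G : MvPolynomial σ R} {p : σ → R} {m : ℕ}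
    (h : VanishesAt (MvPolynomial.map φ G) (fun j => φ (p j)) m) : VanishesAt G p m := by
  intro α hα
  have h1 := h α hα
  rwa [aeval_X_add_C_map, coeff_map, map_eq_zero_iff φ hφ] at h1

section

variable {F : Type*} [Field F] {D : TenPoints F} [DecidableEq F] [Infinite F]

/-- Divisibility by t passes to the quotient, which satisfies the same conditions; the degrees in t
of its nonzero coefficients drop each time. -/
theorem TenPoints.eq_zero_of_vanishesAt {n : ℕ} (hP : (4 * n) • D.P 0 true ≠ 0)
    {G : MvPolynomial (Fin 3) (Polynomial F)} (hG : G.IsHomogeneous (13 * n))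
    (hv : ∀ i, VanishesAt G (D.pt i) (n * mult i)) : G = 0 := by
  have key : ∀ N, ∀ G : MvPolynomial (Fin 3) (Polynomial F), G.IsHomogeneous (13 * n) →
      (∀ i, VanishesAt G (D.pt i) (n * mult i)) → ∀ β, (coeff β G).natDegree < N →
        coeff β G = 0 := by
    intro N
    induction N with
    | zero => intro G _ _ β h; exact absurd h (Nat.not_lt_zero _)
    | succ N ih =>
      intro G hG hv β hN
      obtain ⟨B, hB, rfl⟩ := exists_eq_C_X_mul
        (mem_formsSub.2 (Or.inr ⟨13 * n, add_zero _, hG⟩)) (map_eval_eq_zero hP hG hv)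
      by_contra hne
      rw [coeff_C_mul] at hne hN
      obtain ⟨-, h⟩ := mul_ne_zero_iff.1 hne
      rw [mul_comm, Polynomial.natDegree_mul_X h] at hN
      refine h (ih B ?_ (fun i => (hv i).of_C_mul Polynomial.X_ne_zero) β (by omega))
      intro γ hγ
      refine hG ?_
      rw [coeff_C_mul]
      exact mul_ne_zero Polynomial.X_ne_zero hγ
  ext1 β
  exact key _ G hG hv β (Nat.lt_succ_self _)

theorem TenPoints.eq_zero_of_vanishesAt_fractionRing {n : ℕ} (hP : (4 * n) • D.P 0 true ≠ 0)
    {G : MvPolynomial (Fin 3) (FractionRing (Polynomial F))} (hG : G.IsHomogeneous (13 * n))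
    (hv : ∀ i, VanishesAt G (fun j => algebraMap (Polynomial F) _ (D.pt i j)) (n * mult i)) :
    G = 0 := by
  have hinj := IsFractionRing.injective (Polynomial F) (FractionRing (Polynomial F))
  obtain ⟨b, hb⟩ := IsLocalization.exist_integer_multiples (nonZeroDivisors (Polynomial F))
    G.support fun β => coeff β G
  have hb0 : algebraMap (Polynomial F) (FractionRing (Polynomial F)) b ≠ 0 :=
    (map_ne_zero_iff _ hinj).2 (nonZeroDivisors.ne_zero b.2)
  obtain ⟨G', hG'⟩ : ∃ G', map (algebraMap (Polynomial F) _) G' =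
      C (algebraMap (Polynomial F) (FractionRing (Polynomial F)) b) * G := by
    have : ∀ β, ∃ a, algebraMap (Polynomial F) _ a =
        algebraMap (Polynomial F) (FractionRing (Polynomial F)) b * coeff β G := by
      intro β
      by_cases hβ : β ∈ G.support
      · obtain ⟨a, ha⟩ := hb β hβ
        exact ⟨a, by rw [ha, Algebra.smul_def]⟩
      · exact ⟨0, by simp [notMem_support_iff.1 hβ]⟩
    choose a ha using this
    refine ⟨∑ β ∈ G.support, monomial β (a β), ?_⟩
    rw [map_sum]
    conv_rhs => rw [G.as_sum, Finset.mul_sum]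
    refine Finset.sum_congr rfl fun β _ => ?_
    rw [map_monomial, ha, C_mul_monomial]
  have h1 : G' = 0 := by
    refine D.eq_zero_of_vanishesAt hP (fun β hβ => hG (d := β) ?_) fun i => ?_
    · have := congrArg (coeff β) hG'
      rw [coeff_map, coeff_C_mul] at this
      intro h
      rw [h, mul_zero, map_eq_zero_iff _ hinj] at this
      exact hβ this
    · refine VanishesAt.of_map hinj ?_
      rw [hG']
      exact (hv i).C_mul _
  rw [h1, map_zero, eq_comm, mul_eq_zero, C_eq_zero] at hG'
  exact hG'.resolve_left hb0

end

theorem exists_isMultihomogeneous_mult (k : Type*) [Field k] {n : ℕ} (hn : 0 < n) :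
    ∃ (e : Fin 10 → ℕ) (G : MvPolynomial (Fin 10 × Fin 3) k), IsMultihomogeneous G e ∧ G ≠ 0 ∧
      ∀ (K : Type*) [Field K] [Algebra k K] (q : Fin 10 → Plane K), multiEval q G ≠ 0 →
        ¬ ExistsCurve q (n * 13) fun i => n * mult i := by
  classical
  let F := AlgebraicClosure (FractionRing (PowerSeries k))
  let ι : PowerSeries k →+* F := (algebraMap (FractionRing (PowerSeries k)) F).comp
    (algebraMap (PowerSeries k) (FractionRing (PowerSeries k)))
  have hι : Function.Injective ι :=
    (algebraMap (FractionRing (PowerSeries k)) F).injective.comp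
      (IsFractionRing.injective (PowerSeries k) (FractionRing (PowerSeries k)))
  obtain ⟨D, hD⟩ := exists_tenPoints_smul_ne_zero k hι (show 4 * n ≠ 0 by omega)
  have : Infinite F := IsAlgClosed.instInfinite
  refine exists_isMultihomogeneous
    ((algebraMap (Polynomial F) (FractionRing (Polynomial F))).comp
      (Polynomial.C.comp (ι.comp PowerSeries.C)))
    (fun i j => algebraMap (Polynomial F) _ (D.pt i j)) fun G hG hv => ?_
  rw [mul_comm] at hG
  exact D.eq_zero_of_vanishesAt_fractionRing hD hG hv

end BlowUpPlane

/-! ### Points of the multicone outside the exceptional divisors -/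

namespace BlowUpPlane

section Vectors

variable {K : Type*} [Field K]

theorem exists_smul_eq_of_cross_eq_zero {v w : Fin 3 → K} (hw : w ≠ 0)
    (h : crossProduct v w = 0) : ∃ c : K, v = c • w := by
  obtain ⟨j, hj⟩ := Function.ne_iff.1 hw
  have h0 := congrFun h 0
  have h1 := congrFun h 1
  have h2 := congrFun h 2
  simp only [cross_apply, Matrix.cons_val, Pi.zero_apply] at h0 h1 h2 hj
  refine ⟨v j / w j, funext fun i => ?_⟩
  rw [Pi.smul_apply, smul_eq_mul, div_mul_eq_mul_div, eq_div_iff hj]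
  fin_cases i <;> fin_cases j <;> simp only [Fin.mk_one, Fin.zero_eta, Fin.reduceFinMk] <;>
    first | rfl | exact sub_eq_zero.1 h0 | exact (sub_eq_zero.1 h0).symm | exact sub_eq_zero.1 h1 |
      exact (sub_eq_zero.1 h1).symm | exact sub_eq_zero.1 h2 | exact (sub_eq_zero.1 h2).symm

theorem exists_eq_smul_cross {l v w : Fin 3 → K} (hv : l ⬝ᵥ v = 0) (hw : l ⬝ᵥ w = 0)
    (h : crossProduct v w ≠ 0) : ∃ c : K, l = c • crossProduct v w := by
  refine exists_smul_eq_of_cross_eq_zero h ?_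
  rw [cross_cross_eq_smul_sub_smul', hw, dotProduct_comm, hv]
  simp

theorem exists_cross_eq {l w : Fin 3 → K} (hw : w ≠ 0) (h : l ⬝ᵥ w = 0) :
    ∃ u, crossProduct u w = l := by
  obtain ⟨j, hj⟩ := Function.ne_iff.1 hw
  refine ⟨-crossProduct l (Pi.single j (w j)⁻¹), ?_⟩
  rw [map_neg, LinearMap.neg_apply, cross_cross_eq_smul_sub_smul, h, single_dotProduct,
    inv_mul_cancel₀ hj]
  simp

theorem exists_cross_ne_zero {w : Fin 3 → K} (hw : w ≠ 0) : ∃ u, crossProduct u w ≠ 0 := by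
  obtain ⟨j, hj⟩ := Function.ne_iff.1 hw
  refine ⟨Pi.single (j + 1) 1, fun h => hj ?_⟩
  have := congrFun h (j + 2)
  fin_cases j <;> simpa [cross_apply] using this

theorem dotProduct_cross_eq_zero {x v w : Fin 3 → K} (h : crossProduct x w = 0) :
    x ⬝ᵥ crossProduct v w = 0 := by
  rw [triple_product_permutation, ← cross_anticomm, h]
  simp

theorem map_crossProduct {R S : Type*} [CommRing R] [CommRing S] (φ : R →+* S) (v w : Fin 3 → R)
    (j : Fin 3) : φ (crossProduct v w j) = crossProduct (fun i => φ (v i)) (fun i => φ (w i)) j := by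
  fin_cases j <;> simp [cross_apply]

end Vectors

section Polynomials

variable {K : Type*} [Field K]

theorem exists_eval_ne_zero [Infinite K] {σ : Type*} {h : MvPolynomial σ K} (hh : h ≠ 0) :
    ∃ x, eval x h ≠ 0 := by
  by_contra! h0
  exact hh (MvPolynomial.funext fun x => by rw [h0, map_zero])

theorem eq_zero_of_forall_eval [Infinite K] {σ : Type*} {h Q : MvPolynomial σ K} (hh : h ≠ 0)
    (hQ : ∀ x, eval x h ≠ 0 → eval x Q = 0) : Q = 0 := by
  refine (mul_eq_zero.1 (?_ : Q * h = 0)).resolve_right hh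
  refine MvPolynomial.funext fun x => ?_
  rw [map_mul, map_zero]
  by_cases h0 : eval x h = 0
  · rw [h0, mul_zero]
  · rw [hQ x h0, zero_mul]

theorem eval_aeval_curve {σ : Type*} (γ : σ → Polynomial K) (A : MvPolynomial σ K) (t : K) :
    (aeval γ A).eval t = eval (fun c => (γ c).eval t) A := by
  have : (Polynomial.evalRingHom t).comp (aeval γ : MvPolynomial σ K →ₐ[K] Polynomial K).toRingHom =
      eval fun c => (γ c).eval t := by
    refine MvPolynomial.ringHom_ext (fun r => ?_) fun j => ?_ <;> simp
  exact RingHom.congr_fun this A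

theorem eval_aeval_surface {σ τ : Type*} (γ : σ → MvPolynomial τ K) (A : MvPolynomial σ K)
    (x : τ → K) : eval x (aeval γ A) = eval (fun c => eval x (γ c)) A := by
  have : (eval x).comp (aeval γ : MvPolynomial σ K →ₐ[K] MvPolynomial τ K).toRingHom =
      eval fun c => eval x (γ c) := by
    refine MvPolynomial.ringHom_ext (fun r => ?_) fun j => ?_ <;> simp
  exact RingHom.congr_fun this A

/-- The restriction of a polynomial to a line through the origin. -/
theorem coeff_aeval_X_mul_C {σ : Type*} [Fintype σ] (T : MvPolynomial σ K) (u : σ → K) (e : ℕ) :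
    (aeval (fun j => Polynomial.X * Polynomial.C (u j)) T).coeff e =
      eval u (homogeneousComponent e T) := by
  rw [aeval_def, eval₂_eq', Polynomial.finsetSum_coeff, homogeneousComponent_apply, map_sum,
    Finset.sum_filter]
  refine Finset.sum_congr rfl fun β _ => ?_
  have h1 : ∏ i, (Polynomial.X * Polynomial.C (u i)) ^ β i =
      Polynomial.X ^ β.degree * Polynomial.C (∏ i, u i ^ β i) := by
    simp_rw [mul_pow, Finset.prod_mul_distrib, Finset.prod_pow_eq_pow_sum, Finsupp.degree_eq_sum]
    simp
  rw [h1, Polynomial.algebraMap_eq, Polynomial.coeff_C_mul, Polynomial.coeff_mul_C,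
    Polynomial.coeff_X_pow, eval_monomial, Finsupp.prod_fintype _ _ (by simp)]
  simp only [eq_comm (a := e)]
  split_ifs <;> simp

end Polynomials

section Cone

variable {K : Type*} [Field K] {r : ℕ} (p : Fin r → Plane K)

/-- The vectors that do not represent one of the given points. -/
def offPoints : Set (Fin 3 → K) := {x | ∀ i, crossProduct x (p i).rep ≠ 0}

/-- The lines through the given points and another point. -/
noncomputable def zeta (x : Fin 3 → K) : Coord r → K :=
  Sum.elim x fun ij => crossProduct x (p ij.1).rep ij.2

/-- The polynomials that describe `zeta`. -/
noncomputable def zetaPoly : Coord r → MvPolynomial (Fin 3) K :=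
  Sum.elim X fun ij => crossProduct X (fun j => C ((p ij.1).rep j)) ij.2

theorem eval_zetaPoly (x : Fin 3 → K) (c : Coord r) : eval x (zetaPoly p c) = zeta p x c := by
  rcases c with j | ⟨i, j⟩
  · simp [zetaPoly, zeta]
  · simp only [zetaPoly, zeta, Sum.elim_inr, map_crossProduct, eval_X, eval_C]

variable {p}

theorem zeta_mem [NeZero r] {x : Fin 3 → K} (hx : x ∈ offPoints p) : zeta p x ∈ cone p := by
  have hx0 : x ≠ 0 := fun h => hx 0 (by rw [h]; simp)
  refine ⟨Function.ne_iff.1 hx0, fun i => ⟨Function.ne_iff.1 (hx i), ?_, ?_⟩⟩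
  · exact (dotProduct_comm _ _).trans (dot_cross_self x (p i).rep)
  · exact (dotProduct_comm _ _).trans (dot_self_cross x (p i).rep)

theorem cross_rep_ne_zero (hp : Function.Injective p) {i j : Fin r} (hij : i ≠ j) :
    crossProduct (p i).rep (p j).rep ≠ 0 := by
  intro h
  obtain ⟨c, hc⟩ := exists_smul_eq_of_cross_eq_zero (p j).rep_nonzero h
  apply hij
  apply hp
  rw [← (p i).mk_rep, ← (p j).mk_rep, Projectivization.mk_eq_mk_iff']
  exact ⟨c, hc.symm⟩

theorem exists_offPoints (p : Fin r → Plane K) : ∃ h : MvPolynomial (Fin 3) K, h ≠ 0 ∧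
    ∀ x, eval x h ≠ 0 → x ∈ offPoints p := by
  have : ∀ i, ∃ h : MvPolynomial (Fin 3) K, h ≠ 0 ∧
      ∀ x, eval x h ≠ 0 → crossProduct x (p i).rep ≠ 0 := by
    intro i
    obtain ⟨u, hu⟩ := exists_cross_ne_zero (p i).rep_nonzero
    obtain ⟨j, hj⟩ := Function.ne_iff.1 hu
    have he : ∀ x, eval x (zetaPoly p (Sum.inr (i, j))) = crossProduct x (p i).rep j :=
      fun x => eval_zetaPoly p x _
    refine ⟨zetaPoly p (Sum.inr (i, j)), fun h => hj ?_, fun x hx h => hx ?_⟩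
    · rw [← he, h, map_zero]; rfl
    · rw [he, h]; rfl
  choose h h0 hx using this
  refine ⟨∏ i, h i, Finset.prod_ne_zero_iff.2 fun i _ => h0 i, fun x hne i => hx i x ?_⟩
  rw [map_prod] at hne
  exact Finset.prod_ne_zero_iff.1 hne i (Finset.mem_univ i)

/-- The points have codimension two in the plane, so a general line misses them, and a polynomial
without zeros on a line over an algebraically closed field is constant there. -/
theorem eq_C_of_forall_eval_ne_zero [IsAlgClosed K] {b : MvPolynomial (Fin 3) K}
    (hb : ∀ x ∈ offPoints p, eval x b ≠ 0) : ∃ c ≠ 0, b = C c := by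
  have : Infinite K := IsAlgClosed.instInfinite
  obtain ⟨h, hh, hoff⟩ := exists_offPoints p
  obtain ⟨u, hu⟩ := exists_eval_ne_zero hh
  have hu := hoff u hu
  refine ⟨eval u b, hb u hu, ?_⟩
  rw [← sub_eq_zero]
  -- This linear form is nonzero at `w` exactly when `w` lies outside the plane spanned by `u` and
  -- the representative of `p i`; the line from `u` to `w` then avoids `p i`.
  have hD : ∀ i, ∑ j, C (crossProduct u (p i).rep j) * (X j : MvPolynomial (Fin 3) K) ≠ 0 := by
    intro i h
    refine hu i (funext fun j => ?_)
    have := congrArg (eval (Pi.single j 1)) h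
    simpa [Pi.single_apply] using this
  have hD' := Finset.prod_ne_zero_iff.2 fun i (_ : i ∈ Finset.univ) => hD i
  refine eq_zero_of_forall_eval hD' fun w hw => ?_
  rw [map_prod, Finset.prod_ne_zero_iff] at hw
  by_contra hne
  set β : Polynomial K := aeval (fun j => Polynomial.C (u j) +
    Polynomial.X * Polynomial.C (w j - u j)) b with hβ
  have heval : ∀ t, β.eval t = eval (u + t • (w - u)) b := fun t => by
    rw [hβ, eval_aeval_curve]
    congr 2
    funext j
    simp
  have hroot : ∀ t, β.eval t ≠ 0 := by
    intro t
    rw [heval]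
    refine hb _ fun i h => ?_
    have h1 := dotProduct_cross_eq_zero (v := u) h
    rw [add_dotProduct, dot_self_cross, zero_add, smul_dotProduct, sub_dotProduct, dot_self_cross,
      sub_zero, smul_eq_mul, mul_eq_zero] at h1
    rcases h1 with rfl | h1
    · rw [zero_smul, add_zero] at h
      exact hu i h
    · refine hw i (Finset.mem_univ i) ?_
      rw [← h1, dotProduct_comm, map_sum]
      simp [dotProduct]
  have hdeg : β.degree = 0 := by
    by_contra h
    obtain ⟨t, ht⟩ := IsAlgClosed.exists_root β h
    exact hroot t ht
  rw [Polynomial.eq_C_of_degree_eq_zero hdeg] at heval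
  apply hne
  have h0 := heval 0
  have h1 := heval 1
  rw [Polynomial.eval_C] at h0 h1
  rw [map_sub, eval_C, sub_eq_zero]
  rw [zero_smul, add_zero] at h0
  rw [one_smul, add_sub_cancel] at h1
  rw [← h0, h1]

end Cone

end BlowUpPlane

/-! ### From sections on the blow-up to plane forms -/

namespace BlowUpPlane

variable {K : Type*} [Field K] {r : ℕ} {p : Fin r → Plane K}

theorem smul_mem_offPoints {x : Fin 3 → K} (hx : x ∈ offPoints p) {t : K} (ht : t ≠ 0) :
    t • x ∈ offPoints p := fun i => by
  rw [map_smul, LinearMap.smul_apply]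
  exact smul_ne_zero ht (hx i)

theorem apply_zeta_smul [NeZero r] {d : ℕ} {m : Fin r → ℕ} {s : cone p → K} (hs : s ∈ H0 p d m)
    {x : Fin 3 → K} (hx : x ∈ offPoints p) {t : K} (ht : t ≠ 0) :
    s ⟨zeta p (t • x), zeta_mem (smul_mem_offPoints hx ht)⟩ = t ^ d * s ⟨zeta p x, zeta_mem hx⟩ :=
  hs.1 _ _ t (fun _ => t) (fun j => by simp [zeta]) fun i j => by simp [zeta]

/-- A section is regular outside of the exceptional divisors. -/
theorem exists_local_quotient [NeZero r] {d : ℕ} {m : Fin r → ℕ} {s : cone p → K}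
    (hs : s ∈ H0 p d m) {x : Fin 3 → K} (hx : x ∈ offPoints p) :
    ∃ A B : MvPolynomial (Fin 3) K, eval x B ≠ 0 ∧ ∀ y (hy : y ∈ offPoints p),
      s ⟨zeta p y, zeta_mem hy⟩ * eval y B = eval y A := by
  obtain ⟨A, B, -, hB, h⟩ := hs.2 ⟨zeta p x, zeta_mem hx⟩
  have he : ∀ y (Q : MvPolynomial (Coord r) K),
      eval y (aeval (zetaPoly p) Q) = eval (zeta p y) Q := fun y Q => by
    rw [eval_aeval_surface]
    simp_rw [eval_zetaPoly]
  refine ⟨aeval (zetaPoly p) A, aeval (zetaPoly p) B, by rwa [he], fun y hy => ?_⟩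
  rw [he, he]
  exact h _

/-- A section is given by a form. -/
theorem exists_form_of_mem_H0 [IsAlgClosed K] [NeZero r] {d : ℕ} {m : Fin r → ℕ} {s : cone p → K}
    (hs : s ∈ H0 p d m) : ∃ F : MvPolynomial (Fin 3) K, F.IsHomogeneous d ∧
      ∀ x (hx : x ∈ offPoints p), s ⟨zeta p x, zeta_mem hx⟩ = eval x F := by
  have : Infinite K := IsAlgClosed.instInfinite
  obtain ⟨h, hh, hoff⟩ := exists_offPoints p
  obtain ⟨u, hu⟩ := exists_eval_ne_zero hh
  obtain ⟨A₀, B₀, hB₀, h₀⟩ := exists_local_quotient hs (hoff u hu)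
  have hB₀' : B₀ ≠ 0 := fun h => hB₀ (by rw [h, map_zero])
  -- In lowest terms, the denominator `b` divides the denominator of every local quotient, so it
  -- vanishes nowhere off the points.
  obtain ⟨a, b, g, hab, rfl, rfl⟩ :=
    UniqueFactorizationMonoid.exists_reduced_factors' A₀ B₀ hB₀'
  have hg : g ≠ 0 := left_ne_zero_of_mul hB₀'
  have key : ∀ x (hx : x ∈ offPoints p), eval x b ≠ 0 ∧
      s ⟨zeta p x, zeta_mem hx⟩ * eval x b = eval x a := by
    intro x hx
    obtain ⟨A, B, hB, hAB⟩ := exists_local_quotient hs hx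
    have heq : A * b = a * B := by
      rw [← sub_eq_zero]
      refine eq_zero_of_forall_eval (mul_ne_zero hh hg) fun y hy => ?_
      rw [map_mul, mul_ne_zero_iff] at hy
      have h1 := h₀ y (hoff y hy.1)
      have h2 := hAB y (hoff y hy.1)
      rw [map_mul, map_mul] at h1
      rw [map_sub, map_mul, map_mul, ← h2]
      apply mul_left_cancel₀ hy.2
      linear_combination eval y B * h1
    have hdvd : b ∣ B := hab.symm.dvd_of_dvd_mul_left (Dvd.intro_left A heq)
    obtain ⟨e, rfl⟩ := hdvd
    have hb : eval x b ≠ 0 := by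
      rw [map_mul] at hB
      exact left_ne_zero_of_mul hB
    refine ⟨hb, ?_⟩
    apply mul_right_cancel₀ hB
    have h1 := hAB x hx
    have h2 := congrArg (eval x) heq
    rw [map_mul, map_mul (eval x) a] at h2
    rw [← h2, ← h1]
    ring
  obtain ⟨c, hc, rfl⟩ := eq_C_of_forall_eval_ne_zero fun x hx => (key x hx).1
  have hF : ∀ x (hx : x ∈ offPoints p),
      s ⟨zeta p x, zeta_mem hx⟩ = eval x (C c⁻¹ * a) := by
    intro x hx
    have := (key x hx).2
    rw [eval_C] at this
    rw [map_mul, eval_C, ← this]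
    field_simp
  refine ⟨homogeneousComponent d (C c⁻¹ * a), homogeneousComponent_isHomogeneous _ _,
    fun x hx => ?_⟩
  rw [hF x hx, ← coeff_aeval_X_mul_C]
  have hpoly : aeval (fun j => Polynomial.X * Polynomial.C (x j)) (C c⁻¹ * a) =
      Polynomial.C (eval x (C c⁻¹ * a)) * Polynomial.X ^ d := by
    rw [← sub_eq_zero]
    refine (mul_eq_zero.1 (?_ : _ * Polynomial.X = 0)).resolve_right Polynomial.X_ne_zero
    refine Polynomial.funext fun t => ?_
    rw [Polynomial.eval_mul, Polynomial.eval_X, Polynomial.eval_zero]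
    by_cases ht : t = 0
    · rw [ht, mul_zero]
    · have h1 := apply_zeta_smul hs hx ht
      rw [hF _ hx, hF _ (smul_mem_offPoints hx ht)] at h1
      refine mul_eq_zero_of_left ?_ _
      rw [Polynomial.eval_sub, eval_aeval_curve, sub_eq_zero, Polynomial.eval_mul,
        Polynomial.eval_C, Polynomial.eval_pow, Polynomial.eval_X, mul_comm _ (t ^ d), ← h1]
      congr 2
      funext j
      simp [mul_comm t]
  rw [hpoly, Polynomial.coeff_C_mul, Polynomial.coeff_X_pow, if_pos rfl, mul_one]

section Curve

variable (p) (i : Fin r) (a : K) (c : Fin r → K) (u : Fin 3 → K)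

/-- A point on a curve in the cone that meets the exceptional divisor over `p i` for `t = 0`. -/
noncomputable def curvePoint (t : K) : Coord r → K :=
  Sum.elim (a • (p i).rep + t • u) fun ij => if ij.1 = i then crossProduct u (p i).rep ij.2
    else c ij.1 * crossProduct (a • (p i).rep + t • u) (p ij.1).rep ij.2

/-- A line through `p i`, parametrised by polynomials. -/
noncomputable def linePoly (j : Fin 3) : Polynomial K :=
  Polynomial.C (a * (p i).rep j) + Polynomial.X * Polynomial.C (u j)

/-- The polynomials that describe `curvePoint`. -/
noncomputable def curvePoly : Coord r → Polynomial K :=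
  Sum.elim (linePoly p i a u) fun ij => if ij.1 = i then
    Polynomial.C (crossProduct u (p i).rep ij.2)
    else Polynomial.C (c ij.1) *
      crossProduct (linePoly p i a u) (fun j => Polynomial.C ((p ij.1).rep j)) ij.2

theorem eval_linePoly (t : K) :
    (fun j => (linePoly p i a u j).eval t) = a • (p i).rep + t • u := by
  funext j
  simp [linePoly, mul_comm t]

theorem eval_cross_linePoly (t : K) (k : Fin r) (j : Fin 3) :
    (crossProduct (linePoly p i a u) (fun j => Polynomial.C ((p k).rep j)) j).eval t =
      crossProduct (a • (p i).rep + t • u) (p k).rep j := by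
  rw [← Polynomial.coe_evalRingHom, map_crossProduct, ← eval_linePoly]
  simp only [Polynomial.coe_evalRingHom, Polynomial.eval_C]

theorem eval_curvePoly (t : K) :
    (fun x => (curvePoly p i a c u x).eval t) = curvePoint p i a c u t := by
  funext x
  rcases x with j | ⟨k, j⟩
  · exact congrFun (eval_linePoly p i a u t) j
  · simp only [curvePoly, curvePoint, Sum.elim_inr]
    split_ifs
    · simp
    · rw [Polynomial.eval_mul, Polynomial.eval_C, eval_cross_linePoly]

variable {p i a c u}

theorem curvePoint_mem (hc : ∀ j, c j ≠ 0) (hu : crossProduct u (p i).rep ≠ 0) {t : K}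
    (h0 : a • (p i).rep + t • u ≠ 0)
    (h : ∀ j ≠ i, crossProduct (a • (p i).rep + t • u) (p j).rep ≠ 0) :
    curvePoint p i a c u t ∈ cone p := by
  refine ⟨Function.ne_iff.1 h0, fun k => ?_⟩
  have hl : (fun j => curvePoint p i a c u t (Sum.inr (k, j))) = if k = i then
      crossProduct u (p i).rep else
      c k • crossProduct (a • (p i).rep + t • u) (p k).rep := by
    funext j
    simp only [curvePoint, Sum.elim_inr]
    split_ifs <;> rfl
  have hx : (fun j => curvePoint p i a c u t (Sum.inl j)) = a • (p i).rep + t • u := rfl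
  change (∃ j, (fun j => curvePoint p i a c u t (Sum.inr (k, j))) j ≠ 0) ∧
    (fun j => curvePoint p i a c u t (Sum.inr (k, j))) ⬝ᵥ (p k).rep = 0 ∧
    (fun j => curvePoint p i a c u t (Sum.inr (k, j))) ⬝ᵥ
      (fun j => curvePoint p i a c u t (Sum.inl j)) = 0
  rw [hx, hl]
  split_ifs with hk
  · subst hk
    refine ⟨Function.ne_iff.1 hu, ?_, ?_⟩
    · rw [dotProduct_comm, dot_cross_self]
    · rw [dotProduct_comm, add_dotProduct, smul_dotProduct, smul_dotProduct, dot_cross_self,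
        dot_self_cross]
      simp
  · refine ⟨Function.ne_iff.1 (smul_ne_zero (hc k) (h k hk)), ?_, ?_⟩
    · rw [dotProduct_comm, dotProduct_smul, dot_cross_self, smul_zero]
    · rw [dotProduct_comm, dotProduct_smul, dot_self_cross, smul_zero]

theorem curvePoint_zero_mem (hp : Function.Injective p) (ha : a ≠ 0) (hc : ∀ j, c j ≠ 0)
    (hu : crossProduct u (p i).rep ≠ 0) : curvePoint p i a c u 0 ∈ cone p := by
  refine curvePoint_mem hc hu ?_ fun j hj => ?_
  · rw [zero_smul, add_zero]
    exact smul_ne_zero ha (p i).rep_nonzero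
  · rw [zero_smul, add_zero, map_smul, LinearMap.smul_apply]
    exact smul_ne_zero ha (cross_rep_ne_zero hp hj.symm)

/-- For almost all t the curve point is `zeta` of the point on the line, up to scaling the line
coordinates by t and the `c j`. Sections have degree 0 in these, so the local equation becomes an
identity of polynomials in t, valid also at t = 0. -/
theorem curve_identity [Infinite K] [NeZero r] (hp : Function.Injective p) (ha : a ≠ 0)
    (hc : ∀ j, c j ≠ 0) (hu : crossProduct u (p i).rep ≠ 0) {d : ℕ} {m : Fin r → ℕ}
    {s : cone p → K} (hs : s ∈ H0 p d m) {F : MvPolynomial (Fin 3) K}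
    (hF : ∀ x (hx : x ∈ offPoints p), s ⟨zeta p x, zeta_mem hx⟩ = eval x F)
    {A B : MvPolynomial (Coord r) K} (hAB : ∀ z : cone p, s z * eval z.1 B = eval z.1 A) :
    aeval (linePoly p i a u) F * aeval (curvePoly p i a c u) B =
      aeval (curvePoly p i a c u) A := by
  have hN : ∀ j, ∃ N : Polynomial K, N ≠ 0 ∧ ∀ t, t ≠ 0 → N.eval t ≠ 0 →
      crossProduct (a • (p i).rep + t • u) (p j).rep ≠ 0 := by
    intro j
    rcases eq_or_ne j i with rfl | hj
    · refine ⟨1, one_ne_zero, fun t ht _ => ?_⟩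
      rw [map_add, map_smul, map_smul, LinearMap.add_apply, LinearMap.smul_apply,
        LinearMap.smul_apply, cross_self, smul_zero, zero_add]
      exact smul_ne_zero ht hu
    · obtain ⟨l, hl⟩ := Function.ne_iff.1 (smul_ne_zero ha (cross_rep_ne_zero hp hj.symm))
      refine ⟨crossProduct (linePoly p i a u) (fun j' => Polynomial.C ((p j).rep j')) l,
        fun h => hl ?_, fun t _ ht h => ht ?_⟩
      · have := eval_cross_linePoly p i a u 0 j l
        rw [h, Polynomial.eval_zero, zero_smul, add_zero, map_smul, LinearMap.smul_apply] at this
        exact this.symm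
      · rw [eval_cross_linePoly, h]
        rfl
  choose N hN0 hN using hN
  have hprod : Polynomial.X * ∏ j, N j ≠ 0 :=
    mul_ne_zero Polynomial.X_ne_zero (Finset.prod_ne_zero_iff.2 fun j _ => hN0 j)
  rw [← sub_eq_zero]
  refine (mul_eq_zero.1 (?_ : _ * (Polynomial.X * ∏ j, N j) = 0)).resolve_right hprod
  refine Polynomial.funext fun t => ?_
  rw [Polynomial.eval_mul, Polynomial.eval_zero]
  rcases eq_or_ne ((Polynomial.X * ∏ j, N j).eval t) 0 with ht | ht
  · rw [ht, mul_zero]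
  refine mul_eq_zero_of_left ?_ _
  rw [Polynomial.eval_mul, Polynomial.eval_X, Polynomial.eval_prod, mul_ne_zero_iff,
    Finset.prod_ne_zero_iff] at ht
  have hx : a • (p i).rep + t • u ∈ offPoints p := fun j => hN j t ht.1 (ht.2 j (Finset.mem_univ j))
  have hx0 : a • (p i).rep + t • u ≠ 0 := fun h => hx i (by rw [h]; simp)
  have hmem : curvePoint p i a c u t ∈ cone p := curvePoint_mem hc hu hx0 fun j _ => hx j
  have hsz : s ⟨zeta p (a • (p i).rep + t • u), zeta_mem hx⟩ = s ⟨_, hmem⟩ := by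
    have := hs.1 ⟨_, hmem⟩ ⟨_, zeta_mem hx⟩ 1 (fun k => if k = i then t else (c k)⁻¹)
      (fun j => by simp [zeta, curvePoint]) (fun k j => by
        simp only [zeta, curvePoint, Sum.elim_inr]
        split_ifs with hk
        · subst hk
          rw [map_add, map_smul, map_smul, LinearMap.add_apply, LinearMap.smul_apply,
            LinearMap.smul_apply, cross_self, smul_zero, zero_add]
          rfl
        · rw [inv_mul_cancel_left₀ (hc k)])
    rwa [one_pow, one_mul] at this
  have h1 := hAB ⟨_, hmem⟩
  rw [← hsz, hF _ hx] at h1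
  rw [Polynomial.eval_sub, Polynomial.eval_mul, eval_aeval_curve, eval_aeval_curve,
    eval_aeval_curve, eval_linePoly, eval_curvePoly, h1, sub_self]

end Curve

/-- The lifted line meets the exceptional divisor at t = 0, so the ideal of that divisor pulls back
into (t) and `A` into (t)^(m i). The denominator is prime to t and can be cancelled. -/
theorem X_pow_dvd_aeval_linePoly [Infinite K] [NeZero r] (hp : Function.Injective p) {i : Fin r}
    {u : Fin 3 → K} (hu : crossProduct u (p i).rep ≠ 0) {d : ℕ} {m : Fin r → ℕ}
    {s : cone p → K} (hs : s ∈ H0 p d m) {F : MvPolynomial (Fin 3) K}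
    (hF : ∀ x (hx : x ∈ offPoints p), s ⟨zeta p x, zeta_mem hx⟩ = eval x F) :
    Polynomial.X ^ m i ∣ aeval (linePoly p i 1 u) F := by
  have hc : ∀ j : Fin r, (fun _ => (1 : K)) j ≠ 0 := fun _ => one_ne_zero
  have hmem := curvePoint_zero_mem hp one_ne_zero hc hu
  obtain ⟨A, B, hA, hB, hAB⟩ := hs.2 ⟨_, hmem⟩
  have key := curve_identity hp one_ne_zero hc hu hs hF hAB
  refine Polynomial.prime_X.pow_dvd_of_dvd_mul_right (m i)
    (b := aeval (curvePoly p i 1 (fun _ => 1) u) B) (fun h => hB ?_) ?_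
  · rw [Polynomial.X_dvd_iff, Polynomial.coeff_zero_eq_eval_zero, eval_aeval_curve,
      eval_curvePoly] at h
    exact h
  · rw [key, ← Ideal.mem_span_singleton, ← Ideal.span_singleton_pow]
    have hle : vanishingIdeal K (exceptional p i) ≤
        (Ideal.span {Polynomial.X}).comap (aeval (curvePoly p i 1 (fun _ => 1) u)) := by
      intro f hf
      rw [Ideal.mem_comap, Ideal.mem_span_singleton, Polynomial.X_dvd_iff,
        Polynomial.coeff_zero_eq_eval_zero, eval_aeval_curve, eval_curvePoly]
      refine (mem_vanishingIdeal_iff.1 hf) _ ⟨hmem, ?_⟩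
      rw [Projectivization.submodule_eq, Submodule.mem_span_singleton]
      exact ⟨1, by funext j; simp [curvePoint]⟩
    have h1 : A ∈ vanishingIdeal K (exceptional p i) ^ m i :=
      Ideal.le_of_dvd (Finset.dvd_prod_of_mem _ (Finset.mem_univ i)) hA
    exact Ideal.pow_right_mono (Ideal.map_le_iff_le_comap.2 hle) _
      (by rw [← Ideal.map_pow]; exact Ideal.mem_map_of_mem _ h1)

theorem vanishesToOrder_of_mem_H0 [Infinite K] [NeZero r] (hp : Function.Injective p) {d : ℕ}
    {m : Fin r → ℕ} {s : cone p → K} (hs : s ∈ H0 p d m) {F : MvPolynomial (Fin 3) K}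
    (hF : ∀ x (hx : x ∈ offPoints p), s ⟨zeta p x, zeta_mem hx⟩ = eval x F) (i : Fin r) :
    VanishesToOrder F (p i) (m i) := by
  intro α hα
  set T : MvPolynomial (Fin 3) K := aeval (fun j => X j + C ((p i).rep j)) F with hT
  obtain ⟨h, hh, hoff⟩ := exists_offPoints p
  have h0 : homogeneousComponent α.degree T = 0 := by
    refine eq_zero_of_forall_eval hh fun u hu => ?_
    have hdvd := X_pow_dvd_aeval_linePoly hp (hoff u hu i) hs hF
    rw [← coeff_aeval_X_mul_C]
    have : aeval (fun j => Polynomial.X * Polynomial.C (u j)) T = aeval (linePoly p i 1 u) F := by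
      rw [hT, ← AlgHom.comp_apply]
      congr 1
      refine MvPolynomial.algHom_ext fun j => ?_
      simp [linePoly, add_comm]
    rw [this]
    exact Polynomial.X_pow_dvd_iff.1 hdvd _ hα
  have := congrArg (coeff α) h0
  rwa [coeff_homogeneousComponent, if_pos rfl, coeff_zero] at this

/-- Outside the exceptional divisors scaling suffices. A point on an exceptional divisor is joined
to the complement by a curve as above; the free parameters `a` and `c` let it pass through any
representative. -/
theorem eq_zero_of_form_eq_zero [Infinite K] [NeZero r] (hp : Function.Injective p) {d : ℕ}
    {m : Fin r → ℕ} {s : cone p → K} (hs : s ∈ H0 p d m)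
    (hF : ∀ x (hx : x ∈ offPoints p), s ⟨zeta p x, zeta_mem hx⟩ = 0) : s = 0 := by
  funext ⟨q, hq⟩
  obtain ⟨hx0, hq'⟩ := id hq
  set x : Fin 3 → K := fun j => q (Sum.inl j) with hx
  set l : Fin r → Fin 3 → K := fun i j => q (Sum.inr (i, j)) with hl
  have hl0 : ∀ i, l i ≠ 0 := fun i => Function.ne_iff.2 (hq' i).1
  have hlp : ∀ i, l i ⬝ᵥ (p i).rep = 0 := fun i => (hq' i).2.1
  have hlx : ∀ i, l i ⬝ᵥ x = 0 := fun i => (hq' i).2.2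
  by_cases hoff : x ∈ offPoints p
  · choose b hb using fun i => exists_eq_smul_cross (hlx i) (hlp i) (hoff i)
    have := hs.1 ⟨_, zeta_mem hoff⟩ ⟨q, hq⟩ 1 b (fun j => by simp [zeta, hx])
      fun i j => congrFun (hb i) j
    rw [this, hF x hoff]
    simp
  · obtain ⟨i, hi⟩ : ∃ i, crossProduct x (p i).rep = 0 := by
      by_contra! h
      exact hoff h
    obtain ⟨a, ha⟩ := exists_smul_eq_of_cross_eq_zero (p i).rep_nonzero hi
    have ha0 : a ≠ 0 := by
      rintro rfl
      rw [zero_smul] at ha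
      obtain ⟨j, hj⟩ := hx0
      exact hj (congrFun ha j)
    obtain ⟨u, hu⟩ := exists_cross_eq (p i).rep_nonzero (hlp i)
    have hc : ∀ j, ∃ c : K, c ≠ 0 ∧ (j ≠ i → l j = c • crossProduct x (p j).rep) := by
      intro j
      by_cases hj : j = i
      · exact ⟨1, one_ne_zero, fun h => absurd hj h⟩
      · have hne : crossProduct x (p j).rep ≠ 0 := by
          rw [ha, map_smul, LinearMap.smul_apply]
          exact smul_ne_zero ha0 (cross_rep_ne_zero hp (Ne.symm hj))
        obtain ⟨c, hc⟩ := exists_eq_smul_cross (hlx j) (hlp j) hne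
        refine ⟨c, ?_, fun _ => hc⟩
        rintro rfl
        rw [zero_smul] at hc
        exact hl0 j hc
    choose c hc0 hc using hc
    have hq0 : curvePoint p i a c u 0 = q := by
      funext z
      rcases z with j | ⟨k, j⟩
      · simp only [curvePoint, Sum.elim_inl, zero_smul, add_zero, ← ha]
        rfl
      · simp only [curvePoint, Sum.elim_inr, zero_smul, add_zero, ← ha]
        split_ifs with hk
        · subst hk
          rw [hu]
        · exact (congrFun (hc k hk) j).symm
    obtain ⟨A, B, -, hB, hAB⟩ := hs.2 ⟨q, hq⟩
    have hui : crossProduct u (p i).rep ≠ 0 := by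
      rw [hu]
      exact hl0 i
    have key := curve_identity hp ha0 hc0 hui hs (F := 0) (by simpa using hF) hAB
    rw [map_zero, zero_mul] at key
    have h1 := congrArg (Polynomial.eval 0) key
    rw [Polynomial.eval_zero, eval_aeval_curve, eval_curvePoly, hq0] at h1
    have h2 := hAB ⟨q, hq⟩
    rw [← h1] at h2
    exact (mul_eq_zero.1 h2).resolve_right hB

/-- A nonzero section of a line bundle on the blow-up gives a plane curve. -/
theorem existsCurve_of_H0_ne_bot [IsAlgClosed K] [NeZero r] (hp : Function.Injective p) {d : ℕ}
    {m : Fin r → ℕ} (h : H0 p d m ≠ ⊥) : ExistsCurve p d m := by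
  have : Infinite K := IsAlgClosed.instInfinite
  obtain ⟨s, hs, hs0⟩ := Submodule.exists_mem_ne_zero_of_ne_bot h
  obtain ⟨F, hFd, hF⟩ := exists_form_of_mem_H0 hs
  refine ⟨F, ?_, hFd, vanishesToOrder_of_mem_H0 hp hs hF⟩
  rintro rfl
  exact hs0 (eq_zero_of_form_eq_zero hp hs (by simpa using hF))

theorem IsGeneric.injective {k : Type*} [Field k] [Algebra k K] (h : IsGeneric k p) :
    Function.Injective p := by
  intro i j hij
  by_contra hne
  -- A 2 × 2 minor of the two coordinate vectors vanishes when the points coincide.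
  refine h (Pi.single i 1 + Pi.single j 1) (X (i, 0) * X (j, 1) - X (j, 0) * X (i, 1)) ?_ ?_ ?_
  · refine IsWeightedHomogeneous.sub ?_ ?_
    · exact (isWeightedHomogeneous_X k _ (i, 0)).mul (isWeightedHomogeneous_X k _ (j, 1))
    · rw [add_comm]
      exact (isWeightedHomogeneous_X k _ (j, 0)).mul (isWeightedHomogeneous_X k _ (i, 1))
  · intro h0
    have := congrArg (eval fun ij => if ij = (i, 0) ∨ ij = (j, 1) then (1 : k) else 0) h0
    simp [hne, Ne.symm hne] at this
  · simp [multiEval, hij, mul_comm]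

end BlowUpPlane

/-! ### Conclusion: the generic statements follow from the open one -/

theorem mainTheorem9 (k : Type*) [Field k] (K : Type*) [Field K] [IsAlgClosed K] [Algebra k K] :
    (∀ p : Fin 10 → BlowUpPlane.Plane K, BlowUpPlane.IsGeneric k p →
      ¬ BlowUpPlane.IsSemiEffective p 13 BlowUpPlane.mult) ∧
    (∀ p : Fin 10 → BlowUpPlane.Plane K, BlowUpPlane.IsGeneric k p →
      ∀ n : ℕ, 0 < n →
        ¬ BlowUpPlane.ExistsCurve p (n * 13) (fun i => n * BlowUpPlane.mult i)) ∧
    (∀ n : ℕ, 0 < n → ∃ (e : Fin 10 → ℕ) (G : MvPolynomial (Fin 10 × Fin 3) k),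
      BlowUpPlane.IsMultihomogeneous G e ∧ G ≠ 0 ∧
        ∀ p : Fin 10 → BlowUpPlane.Plane K, Function.Injective p →
          BlowUpPlane.multiEval p G ≠ 0 →
          BlowUpPlane.H0 p (n * 13) (fun i => n * BlowUpPlane.mult i) = ⊥ ∧
          ¬ BlowUpPlane.ExistsCurve p (n * 13) (fun i => n * BlowUpPlane.mult i)) := by
  have key : ∀ n : ℕ, 0 < n → ∃ (e : Fin 10 → ℕ) (G : MvPolynomial (Fin 10 × Fin 3) k),
      BlowUpPlane.IsMultihomogeneous G e ∧ G ≠ 0 ∧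
        ∀ p : Fin 10 → BlowUpPlane.Plane K, Function.Injective p →
          BlowUpPlane.multiEval p G ≠ 0 →
          BlowUpPlane.H0 p (n * 13) (fun i => n * BlowUpPlane.mult i) = ⊥ ∧
          ¬ BlowUpPlane.ExistsCurve p (n * 13) (fun i => n * BlowUpPlane.mult i) := by
    intro n hn
    obtain ⟨e, G, hG, hG0, h⟩ := BlowUpPlane.exists_isMultihomogeneous_mult k hn
    refine ⟨e, G, hG, hG0, fun p hp hpG => ⟨?_, h K p hpG⟩⟩
    by_contra hne
    exact h K p hpG (BlowUpPlane.existsCurve_of_H0_ne_bot hp hne)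
  refine ⟨fun p hp => ?_, fun p hp n hn => ?_, key⟩
  · rintro ⟨n, hn, hne⟩
    obtain ⟨e, G, hG, hG0, h⟩ := key n hn
    exact hne (h p hp.injective (hp e G hG hG0)).1
  · obtain ⟨e, G, hG, hG0, h⟩ := key n hn
    exact (h p hp.injective (hp e G hG hG0)).2
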